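/- Let $F$ be an algebraically closed field of characteristic $\neq 2$ and let $p,q\in F^\times$ not be roots of unity. For $n\ge 0$ let $H_n$ be the affine Hecke algebra of type $B_n$: the associative $F$-algebra generated by $X_0^{\pm1},\dots,X_n^{\pm1},T_0,\dots,T_{n-1}$, where the $X_i$ commute, subject to $(T_0-p)(T_0+p^{-1})=0$; $(T_i-q)(T_i+q^{-1})=0$ for $i\ge1$; $T_iT_{i+1}T_i=T_{i+1}T_iT_{i+1}$ for $i\ge 1$; $T_iT_j=T_jT_i$ for $|i-j|>1$; $T_1T_0T_1T_0=T_0T_1T_0T_1$; $T_0X_0T_0=X_0X_1$; $T_iX_j=X_jT_i$ for $j\ne i,i+1$; $T_iX_iT_i=X_{i+1}$ for $i\ge1$ (so $H_0=F[X_0^{\pm1}]$). Let $H_m^A$ be the affine Hecke algebra of type $A$ (for $GL_m$), with generators $X_1^{\pm1},\dots,X_m^{\pm1},T_1,\dots,T_{m-1}$ and those of the above relations that involve only these generators. Identify $H_n\otimes H_m^A$ with the parabolic subalgebra $H_{n,m}$ of $H_{n+m}$ generated by all $X_j^{\pm1}$ and all $T_i$ with $i\ne n$ (the generators $X_j,T_i$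 of $H_m^A$ correspond to $X_{n+j},T_{n+i}$), and write $\operatorname{ind}_{n,m}^{n+m}=H_{n+m}\otimes_{H_{n,m}}-$. For $a\in F^\times$ let $L^A(a^{(m)})$ be the $H_m^A$-module induced from the one-dimensional module of $F[X_1^{\pm1},\dots,X_m^{\pm1}]$ on which every $X_j$ acts as $a$; for $m=1$ it is the one-dimensional module $(a)$. For a nonzero finite-dimensional $H_n$-module $M$ let $\varepsilon_a(M)$ be the largest $m\in\{0,\dots,n\}$ such that the simultaneous generalized $a$-eigenspace $\Delta_{a^{(m)}}M$ of $X_{n-m+1},\dots,X_n$ on $M$ is nonzero. The cosocle $\operatorname{cosoc} M$ is the largest semisimple quotient of $M$. Let $a\in F\setminus\{0,1,-1\}$, let $n\ge 0$ and let $N$ be an irreducible finite-dimensional $H_n$-module. Then: 1. For every $m\ge0$ the module $M=\operatorname{ind}_{n,m}^{n+m}\bigl(N\boxtimes L^A(a^{(m)})\bigr)$ is finite-dimensional, $\operatorname{cosoc} M$ is irreducible, $\varepsilon_a(\operatorname{cosoc} M)=\varepsilon_a(N)+m$, and all other composition factors $L$ of $M$ satisfy $\varepsilon_a(L)<\varepsilon_a(N)+m$;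 that is, in every composition series of $M$ one factor is isomorphic to $\operatorname{cosoc} M$ and each of the remaining factors $L$ satisfies $\varepsilon_a(L)<\varepsilon_a(N)+m$. 2. Consequently the Kashiwara operator $\tilde f_a N:=\operatorname{cosoc}\operatorname{ind}_{n,1}^{n+1}\bigl(N\boxtimes(a)\bigr)$ is well defined on isomorphism classes of irreducibles: $\tilde f_aN$ is an irreducible $H_{n+1}$-module, and $N\cong N'$ implies $\tilde f_aN\cong\tilde f_aN'$. -/

import Mathlib

open scoped TensorProduct

universe u v w

noncomputable section

namespace AffineHecke

/-! ### The affine Hecke algebra of type `B` -/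

/-- Generators of the type `B` affine Hecke algebra `H_n`: `T_0, …, T_{n-1}`,
`X_0, …, X_n` and the inverses of the latter. -/
inductive GenB (n : ℕ) : Type
  | T (i : Fin n)
  | X (j : Fin (n + 1))
  | Xinv (j : Fin (n + 1))

section RelB

variable {F : Type u} [Field F] {n : ℕ}

/-- `T_i` in the free algebra. -/
abbrev fT (i : Fin n) : FreeAlgebra F (GenB n) := FreeAlgebra.ι F (GenB.T i)

/-- `X_j` in the free algebra. -/
abbrev fX (j : Fin (n + 1)) : FreeAlgebra F (GenB n) := FreeAlgebra.ι F (GenB.X j)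

/-- The formal inverse of `X_j` in the free algebra. -/
abbrev fXinv (j : Fin (n + 1)) : FreeAlgebra F (GenB n) := FreeAlgebra.ι F (GenB.Xinv j)

/-- The defining relations of the type `B` affine Hecke algebra. For `n = 0` only the first three
remain, and the algebra is `F[X_0^{±1}]`. -/
inductive RelB (p q : F) (n : ℕ) :
    FreeAlgebra F (GenB n) → FreeAlgebra F (GenB n) → Prop
  | X_mul_inv (j : Fin (n + 1)) : RelB p q n (fX j * fXinv j) 1
  | X_inv_mul (j : Fin (n + 1)) : RelB p q n (fXinv j * fX j) 1
  | X_comm (i j : Fin (n + 1)) : RelB p q n (fX i * fX j) (fX j * fX i)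
  | quad_zero (h : 0 < n) :
      RelB p q n ((fT ⟨0, h⟩ - algebraMap F _ p) * (fT ⟨0, h⟩ + algebraMap F _ p⁻¹)) 0
  | quad (i : Fin n) (hi : 1 ≤ i.val) :
      RelB p q n ((fT i - algebraMap F _ q) * (fT i + algebraMap F _ q⁻¹)) 0
  | braid (i : ℕ) (hi : 1 ≤ i) (h : i + 1 < n) :
      RelB p q n (fT ⟨i, by omega⟩ * fT ⟨i + 1, h⟩ * fT ⟨i, by omega⟩)
        (fT ⟨i + 1, h⟩ * fT ⟨i, by omega⟩ * fT ⟨i + 1, h⟩)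
  | T_comm (i j : Fin n) (h : i.val + 1 < j.val) : RelB p q n (fT i * fT j) (fT j * fT i)
  | braid_zero (h : 1 < n) :
      RelB p q n (fT ⟨1, h⟩ * fT ⟨0, by omega⟩ * fT ⟨1, h⟩ * fT ⟨0, by omega⟩)
        (fT ⟨0, by omega⟩ * fT ⟨1, h⟩ * fT ⟨0, by omega⟩ * fT ⟨1, h⟩)
  | T_X_zero (h : 0 < n) :
      RelB p q n (fT ⟨0, h⟩ * fX ⟨0, by omega⟩ * fT ⟨0, h⟩)
        (fX ⟨0, by omega⟩ * fX ⟨1, by omega⟩)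
  | T_X_comm (i : Fin n) (j : Fin (n + 1)) (h : j.val ≠ i.val) (h' : j.val ≠ i.val + 1) :
      RelB p q n (fT i * fX j) (fX j * fT i)
  | T_X (i : ℕ) (hi : 1 ≤ i) (h : i < n) :
      RelB p q n (fT ⟨i, h⟩ * fX ⟨i, by omega⟩ * fT ⟨i, h⟩) (fX ⟨i + 1, by omega⟩)

end RelB

/-- The affine Hecke algebra `H_n` of type `B_n` with parameters `p` (for `T_0`) and `q`. -/
def HB {F : Type u} [Field F] (p q : F) (n : ℕ) : Type u := RingQuot (RelB p q n)

section HB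

variable {F : Type u} [Field F] (p q : F) (n : ℕ)

instance : Ring (HB p q n) := inferInstanceAs (Ring (RingQuot (RelB p q n)))

instance : Algebra F (HB p q n) := inferInstanceAs (Algebra F (RingQuot (RelB p q n)))

/-- The quotient map from the free algebra. -/
def mkB : FreeAlgebra F (GenB n) →ₐ[F] HB p q n := RingQuot.mkAlgHom F (RelB p q n)

variable {n}

/-- The generator `T_i` of `H_n`. -/
def TB (i : Fin n) : HB p q n := mkB p q n (fT i)

/-- The generator `X_j` of `H_n`. -/
def XB (j : Fin (n + 1)) : HB p q n := mkB p q n (fX j)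

/-- The inverse of `X_j` in `H_n`. -/
def XinvB (j : Fin (n + 1)) : HB p q n := mkB p q n (fXinv j)

variable {p q}

theorem mkB_rel {x y : FreeAlgebra F (GenB n)} (h : RelB p q n x y) :
    mkB p q n x = mkB p q n y := RingQuot.mkAlgHom_rel F h

theorem X_mul_XinvB (j : Fin (n + 1)) : XB p q j * XinvB p q j = 1 := by
  simpa [XB, XinvB] using mkB_rel (p := p) (q := q) (.X_mul_inv j)

theorem Xinv_mul_XB (j : Fin (n + 1)) : XinvB p q j * XB p q j = 1 := by
  simpa [XB, XinvB] using mkB_rel (p := p) (q := q) (.X_inv_mul j)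

theorem X_commB (i j : Fin (n + 1)) : XB p q i * XB p q j = XB p q j * XB p q i := by
  simpa [XB] using mkB_rel (p := p) (q := q) (.X_comm i j)

theorem quad_zeroB (h : 0 < n) :
    (TB p q ⟨0, h⟩ - algebraMap F _ p) * (TB p q ⟨0, h⟩ + algebraMap F _ p⁻¹) = 0 := by
  simpa [TB] using mkB_rel (p := p) (q := q) (.quad_zero h)

theorem quadB (i : Fin n) (hi : 1 ≤ i.val) :
    (TB p q i - algebraMap F _ q) * (TB p q i + algebraMap F _ q⁻¹) = 0 := by
  simpa [TB] using mkB_rel (p := p) (q := q) (.quad i hi)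

theorem braidB (i : ℕ) (hi : 1 ≤ i) (h : i + 1 < n) :
    TB p q ⟨i, by omega⟩ * TB p q ⟨i + 1, h⟩ * TB p q ⟨i, by omega⟩ =
      TB p q ⟨i + 1, h⟩ * TB p q ⟨i, by omega⟩ * TB p q ⟨i + 1, h⟩ := by
  simpa [TB] using mkB_rel (p := p) (q := q) (.braid i hi h)

theorem T_commB (i j : Fin n) (h : i.val + 1 < j.val) :
    TB p q i * TB p q j = TB p q j * TB p q i := by
  simpa [TB] using mkB_rel (p := p) (q := q) (.T_comm i j h)

theorem braid_zeroB (h : 1 < n) :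
    TB p q ⟨1, h⟩ * TB p q ⟨0, by omega⟩ * TB p q ⟨1, h⟩ * TB p q ⟨0, by omega⟩ =
      TB p q ⟨0, by omega⟩ * TB p q ⟨1, h⟩ * TB p q ⟨0, by omega⟩ * TB p q ⟨1, h⟩ := by
  simpa [TB] using mkB_rel (p := p) (q := q) (.braid_zero h)

theorem T_X_zeroB (h : 0 < n) :
    TB p q ⟨0, h⟩ * XB p q ⟨0, by omega⟩ * TB p q ⟨0, h⟩ =
      XB p q ⟨0, by omega⟩ * XB p q ⟨1, by omega⟩ := by
  simpa [TB, XB] using mkB_rel (p := p) (q := q) (.T_X_zero h)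

theorem T_X_commB (i : Fin n) (j : Fin (n + 1)) (h : j.val ≠ i.val) (h' : j.val ≠ i.val + 1) :
    TB p q i * XB p q j = XB p q j * TB p q i := by
  simpa [TB, XB] using mkB_rel (p := p) (q := q) (.T_X_comm i j h h')

theorem T_XB (i : ℕ) (hi : 1 ≤ i) (h : i < n) :
    TB p q ⟨i, h⟩ * XB p q ⟨i, by omega⟩ * TB p q ⟨i, h⟩ = XB p q ⟨i + 1, by omega⟩ := by
  simpa [TB, XB] using mkB_rel (p := p) (q := q) (.T_X i hi h)

end HB

/-! ### The affine Hecke algebra of type `A` -/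

/-- Generators of the affine Hecke algebra `H_m^A` of `GL_m`. Indices are shifted by one:
`X j` stands for `X_{j+1}` (`0 ≤ j < m`), and `T i` for `T_{i+1}` (`0 ≤ i < m - 1`). -/
inductive GenA (m : ℕ) : Type
  | T (i : ℕ) (h : i + 1 < m)
  | X (j : Fin m)
  | Xinv (j : Fin m)

section RelA

variable {F : Type u} [Field F] {m : ℕ}

/-- `T_{i+1}` in the free algebra. -/
abbrev aT (i : ℕ) (h : i + 1 < m) : FreeAlgebra F (GenA m) := FreeAlgebra.ι F (GenA.T i h)

/-- `X_{j+1}` in the free algebra. -/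
abbrev aX (j : Fin m) : FreeAlgebra F (GenA m) := FreeAlgebra.ι F (GenA.X j)

/-- The formal inverse of `X_{j+1}` in the free algebra. -/
abbrev aXinv (j : Fin m) : FreeAlgebra F (GenA m) := FreeAlgebra.ι F (GenA.Xinv j)

/-- The defining relations of the type `A` affine Hecke algebra. -/
inductive RelA (q : F) (m : ℕ) :
    FreeAlgebra F (GenA m) → FreeAlgebra F (GenA m) → Prop
  | X_mul_inv (j : Fin m) : RelA q m (aX j * aXinv j) 1
  | X_inv_mul (j : Fin m) : RelA q m (aXinv j * aX j) 1
  | X_comm (i j : Fin m) : RelA q m (aX i * aX j) (aX j * aX i)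
  | quad (i : ℕ) (h : i + 1 < m) :
      RelA q m ((aT i h - algebraMap F _ q) * (aT i h + algebraMap F _ q⁻¹)) 0
  | braid (i : ℕ) (h : i + 1 + 1 < m) :
      RelA q m (aT i (by omega) * aT (i + 1) h * aT i (by omega))
        (aT (i + 1) h * aT i (by omega) * aT (i + 1) h)
  | T_comm (i j : ℕ) (hi : i + 1 < m) (hj : j + 1 < m) (h : i + 1 < j) :
      RelA q m (aT i hi * aT j hj) (aT j hj * aT i hi)
  | T_X_comm (i : ℕ) (hi : i + 1 < m) (j : Fin m) (h : j.val ≠ i) (h' : j.val ≠ i + 1) :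
      RelA q m (aT i hi * aX j) (aX j * aT i hi)
  | T_X (i : ℕ) (h : i + 1 < m) :
      RelA q m (aT i h * aX ⟨i, by omega⟩ * aT i h) (aX ⟨i + 1, h⟩)

end RelA

/-- The affine Hecke algebra `H_m^A` of type `A` (for `GL_m`) with parameter `q`. -/
def HA {F : Type u} [Field F] (q : F) (m : ℕ) : Type u := RingQuot (RelA q m)

section HA

variable {F : Type u} [Field F] (q : F) (m : ℕ)

instance : Ring (HA q m) := inferInstanceAs (Ring (RingQuot (RelA q m)))

instance : Algebra F (HA q m) := inferInstanceAs (Algebra F (RingQuot (RelA q m)))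

/-- The quotient map from the free algebra. -/
def mkA : FreeAlgebra F (GenA m) →ₐ[F] HA q m := RingQuot.mkAlgHom F (RelA q m)

variable {m}

/-- The generator `X_{j+1}` of `H_m^A`, as a unit. -/
def XA (j : Fin m) : (HA q m)ˣ where
  val := mkA q m (aX j)
  inv := mkA q m (aXinv j)
  val_inv := by
    rw [← map_mul, ← map_one (mkA q m)]
    exact RingQuot.mkAlgHom_rel F (.X_mul_inv j)
  inv_val := by
    rw [← map_mul, ← map_one (mkA q m)]
    exact RingQuot.mkAlgHom_rel F (.X_inv_mul j)

theorem XA_comm (i j : Fin m) : Commute (XA q i) (XA q j) := by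
  apply Units.ext
  change mkA q m (aX i) * mkA q m (aX j) = mkA q m (aX j) * mkA q m (aX i)
  rw [← map_mul, ← map_mul]
  exact RingQuot.mkAlgHom_rel F (.X_comm i j)

end HA

/-! ### Parabolic subalgebras -/

section Parabolic

variable {F : Type u} [Field F] (p q : F) (n m : ℕ)

/-- The inclusion `H_n → H_{n+m}`, `T_i ↦ T_i`, `X_j ↦ X_j`. -/
def inclB : HB p q n →ₐ[F] HB p q (n + m) :=
  RingQuot.liftAlgHom F ⟨FreeAlgebra.lift F fun g => match g with
    | .T i => TB p q ⟨i.val, by omega⟩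
    | .X j => XB p q ⟨j.val, by omega⟩
    | .Xinv j => XinvB p q ⟨j.val, by omega⟩, by
      intro x y h
      cases h with
      | X_mul_inv j => simpa using X_mul_XinvB _
      | X_inv_mul j => simpa using Xinv_mul_XB _
      | X_comm i j => simpa using X_commB _ _
      | quad_zero h => simpa using quad_zeroB (p := p) (q := q) (n := n + m) (by omega)
      | quad i hi => simpa using quadB (p := p) (q := q) (n := n + m) ⟨i.val, by omega⟩ hi
      | braid i hi h => simpa using braidB (p := p) (q := q) (n := n + m) i hi (by omega)
      | T_comm i j h =>
        simpa using T_commB (p := p) (q := q) (n := n + m) ⟨i.val, by omega⟩ ⟨j.val, by omega⟩ h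
      | braid_zero h => simpa using braid_zeroB (p := p) (q := q) (n := n + m) (by omega)
      | T_X_zero h => simpa using T_X_zeroB (p := p) (q := q) (n := n + m) (by omega)
      | T_X_comm i j h h' =>
        simpa using T_X_commB (p := p) (q := q) (n := n + m) ⟨i.val, by omega⟩ ⟨j.val, by omega⟩
          h h'
      | T_X i hi h => simpa using T_XB (p := p) (q := q) (n := n + m) i hi (by omega)⟩

/-- The map `H_m^A → H_{n+m}`, `T_i ↦ T_{n+i}` (`1 ≤ i < m`), `X_j ↦ X_{n+j}` (`1 ≤ j ≤ m`). -/
def inclA : HA q m →ₐ[F] HB p q (n + m) :=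
  RingQuot.liftAlgHom F ⟨FreeAlgebra.lift F fun g => match g with
    | .T i h => TB p q ⟨n + i + 1, by omega⟩
    | .X j => XB p q ⟨n + j.val + 1, by omega⟩
    | .Xinv j => XinvB p q ⟨n + j.val + 1, by omega⟩, by
      intro x y h
      cases h with
      | X_mul_inv j => simpa using X_mul_XinvB _
      | X_inv_mul j => simpa using Xinv_mul_XB _
      | X_comm i j => simpa using X_commB _ _
      | quad i h =>
        simpa using quadB (p := p) (q := q) (n := n + m) ⟨n + i + 1, by omega⟩ (by simp)
      | braid i h =>
        simp only [map_mul, FreeAlgebra.lift_ι_apply]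
        exact braidB (p := p) (q := q) (n := n + m) (n + i + 1) (by omega) (by omega)
      | T_comm i j hi hj h =>
        simpa using T_commB (p := p) (q := q) (n := n + m) ⟨n + i + 1, by omega⟩
          ⟨n + j + 1, by omega⟩ (by simp; omega)
      | T_X_comm i hi j h h' =>
        simpa using T_X_commB (p := p) (q := q) (n := n + m) ⟨n + i + 1, by omega⟩
          ⟨n + j.val + 1, by omega⟩ (by simp; omega) (by simp; omega)
      | T_X i h =>
        simp only [map_mul, FreeAlgebra.lift_ι_apply]
        exact T_XB (p := p) (q := q) (n := n + m) (n + i + 1) (by omega) (by omega)⟩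

@[simp] theorem inclB_T (i : Fin n) :
    inclB p q n m (mkB p q n (fT i)) = TB p q ⟨i.val, by omega⟩ := by
  simp only [inclB, mkB]
  erw [RingQuot.liftAlgHom_mkAlgHom_apply]
  simp

@[simp] theorem inclB_X (j : Fin (n + 1)) :
    inclB p q n m (mkB p q n (fX j)) = XB p q ⟨j.val, by omega⟩ := by
  simp only [inclB, mkB]
  erw [RingQuot.liftAlgHom_mkAlgHom_apply]
  simp

@[simp] theorem inclB_Xinv (j : Fin (n + 1)) :
    inclB p q n m (mkB p q n (fXinv j)) = XinvB p q ⟨j.val, by omega⟩ := by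
  simp only [inclB, mkB]
  erw [RingQuot.liftAlgHom_mkAlgHom_apply]
  simp

@[simp] theorem inclA_T (i : ℕ) (h : i + 1 < m) :
    inclA p q n m (mkA q m (aT i h)) = TB p q ⟨n + i + 1, by omega⟩ := by
  simp only [inclA, mkA]
  erw [RingQuot.liftAlgHom_mkAlgHom_apply]
  simp

@[simp] theorem inclA_X (j : Fin m) :
    inclA p q n m (mkA q m (aX j)) = XB p q ⟨n + j.val + 1, by omega⟩ := by
  simp only [inclA, mkA]
  erw [RingQuot.liftAlgHom_mkAlgHom_apply]
  simp

@[simp] theorem inclA_Xinv (j : Fin m) :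
    inclA p q n m (mkA q m (aXinv j)) = XinvB p q ⟨n + j.val + 1, by omega⟩ := by
  simp only [inclA, mkA]
  erw [RingQuot.liftAlgHom_mkAlgHom_apply]
  simp

/-- If `z` commutes with a unit, it commutes with the inverse of that unit. -/
theorem commute_inv_of {R : Type*} [Ring R] {x y z : R} (h : Commute z x) (h1 : x * y = 1)
    (h2 : y * x = 1) : Commute z y :=
  Commute.units_inv_right (u := ⟨x, y, h1, h2⟩) h

theorem commute_inclA_of (z : HB p q (n + m))
    (hT : ∀ (i : ℕ) (h : i + 1 < m), Commute z (TB p q ⟨n + i + 1, by omega⟩))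
    (hX : ∀ j : Fin m, Commute z (XB p q ⟨n + j.val + 1, by omega⟩)) (y : HA q m) :
    Commute z (inclA p q n m y) := by
  obtain ⟨y, rfl⟩ : ∃ y', mkA q m y' = y := RingQuot.mkAlgHom_surjective F _ y
  induction y using FreeAlgebra.induction with
  | grade0 r => simpa using Algebra.commute_algebraMap_right r z
  | grade1 g =>
    cases g with
    | T i h => rw [inclA_T]; exact hT i h
    | X j => rw [inclA_X]; exact hX j
    | Xinv j => rw [inclA_Xinv]; exact commute_inv_of (hX j) (X_mul_XinvB _) (Xinv_mul_XB _)
  | mul a b ha hb => simpa using ha.mul_right hb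
  | add a b ha hb => simpa using ha.add_right hb

theorem commute_inclB_inclA (x : HB p q n) (y : HA q m) :
    Commute (inclB p q n m x) (inclA p q n m y) := by
  have hX (j : Fin (n + 1)) :
      Commute (XB p q ⟨j.val, Nat.lt_of_lt_of_le j.isLt (Nat.succ_le_succ (Nat.le_add_right n m))⟩)
        (inclA p q n m y) := by
    apply commute_inclA_of p q n m
    · intro i h
      apply Commute.symm
      apply T_X_commB
      · change j.val ≠ n + i + 1
        omega
      · change j.val ≠ n + i + 1 + 1
        omega
    · intro k
      exact X_commB _ _
  have hT (i : Fin n) :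
      Commute (TB p q ⟨i.val, Nat.lt_of_lt_of_le i.isLt (Nat.le_add_right n m)⟩)
        (inclA p q n m y) := by
    apply commute_inclA_of p q n m
    · intro k h
      apply T_commB
      change i.val + 1 < n + k + 1
      omega
    · intro k
      apply T_X_commB
      · change n + k.val + 1 ≠ i.val
        omega
      · change n + k.val + 1 ≠ i.val + 1
        omega
  obtain ⟨x, rfl⟩ : ∃ x', mkB p q n x' = x := RingQuot.mkAlgHom_surjective F _ x
  induction x using FreeAlgebra.induction with
  | grade0 r => simpa using Algebra.commute_algebraMap_left r (inclA p q n m y)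
  | grade1 g =>
    cases g with
    | T i => rw [inclB_T]; exact hT i
    | X j => rw [inclB_X]; exact hX j
    | Xinv j =>
      rw [inclB_Xinv]
      exact (commute_inv_of (hX j).symm (X_mul_XinvB _) (Xinv_mul_XB _)).symm
  | mul a b ha hb => simpa using ha.mul_left hb
  | add a b ha hb => simpa using ha.add_left hb

/-- The identification of `H_n ⊗ H_m^A` with the parabolic subalgebra `H_{n,m}` of `H_{n+m}`
generated by all `X_j^{±1}` and all `T_i` with `i ≠ n`, as a homomorphism to `H_{n+m}`. -/
def parabolic : HB p q n ⊗[F] HA q m →ₐ[F] HB p q (n + m) :=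
  Algebra.TensorProduct.lift (inclB p q n m) (inclA p q n m) (commute_inclB_inclA p q n m)

end Parabolic

/-! ### Induction, outer tensor products, one-dimensional modules -/

section Modules

variable {F : Type u} [Field F]

/-- The relations `(b φ(x)) ⊗ v = b ⊗ (x v)` defining `B ⊗_A N` as a quotient of `B ⊗_F N`. -/
def indRel {A : Type*} {B : Type*} [Ring A] [Algebra F A] [Ring B] [Algebra F B]
    (φ : A →ₐ[F] B) (N : Type*) [AddCommGroup N] [Module F N] [Module A N] :
    Submodule B (B ⊗[F] N) :=
  Submodule.span B
    {z | ∃ (b : B) (x : A) (v : N), z = (b * φ x) ⊗ₜ[F] v - b ⊗ₜ[F] (x • v)}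

/-- The induced module `B ⊗_A N` of a left `A`-module `N` along `φ : A → B`. -/
def Ind {A : Type*} {B : Type*} [Ring A] [Algebra F A] [Ring B] [Algebra F B]
    (φ : A →ₐ[F] B) (N : Type*) [AddCommGroup N] [Module F N] [Module A N] : Type _ :=
  (B ⊗[F] N) ⧸ indRel φ N

section

variable {A : Type*} {B : Type*} [Ring A] [Algebra F A] [Ring B] [Algebra F B]
  (φ : A →ₐ[F] B) (N : Type*) [AddCommGroup N] [Module F N] [Module A N]

instance : AddCommGroup (Ind φ N) := inferInstanceAs (AddCommGroup ((B ⊗[F] N) ⧸ indRel φ N))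

instance : Module B (Ind φ N) := inferInstanceAs (Module B ((B ⊗[F] N) ⧸ indRel φ N))

instance : Module F (Ind φ N) := inferInstanceAs (Module F ((B ⊗[F] N) ⧸ indRel φ N))

instance : IsScalarTower F B (Ind φ N) :=
  inferInstanceAs (IsScalarTower F B ((B ⊗[F] N) ⧸ indRel φ N))

end

/-- The vector space underlying the outer tensor product `N ⊠ L`. -/
def Outer (F : Type u) [Field F] (N : Type*) (L : Type*) [AddCommGroup N] [Module F N]
    [AddCommGroup L] [Module F L] : Type _ := N ⊗[F] L

section

variable (N : Type*) (L : Type*) [AddCommGroup N] [Module F N] [AddCommGroup L] [Module F L]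

instance : AddCommGroup (Outer F N L) := inferInstanceAs (AddCommGroup (N ⊗[F] L))

instance : Module F (Outer F N L) := inferInstanceAs (Module F (N ⊗[F] L))

/-- The action `(x ⊗ y)(v ⊗ l) = xv ⊗ yl` of `A ⊗ B` on `N ⊠ L`. -/
instance {A : Type*} {B : Type*} [Ring A] [Algebra F A] [Ring B] [Algebra F B]
    [Module A N] [IsScalarTower F A N] [Module B L] [IsScalarTower F B L] :
    Module (A ⊗[F] B) (Outer F N L) :=
  Module.compHom (N ⊗[F] L)
    (((Module.endTensorEndAlgHom (R := F) (S := F) (A := F) (M := N) (N := L)).comp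
      (Algebra.TensorProduct.map (Algebra.lsmul F F N) (Algebra.lsmul F F L))).toRingHom)

end

/-- The one-dimensional module on which `x ∈ A` acts as the scalar `χ x`. -/
def OneDim {A : Type*} [Ring A] [Algebra F A] (_χ : A →ₐ[F] F) : Type u := F

section

variable {A : Type*} [Ring A] [Algebra F A] (χ : A →ₐ[F] F)

instance : AddCommGroup (OneDim χ) := inferInstanceAs (AddCommGroup F)

instance : Module F (OneDim χ) := inferInstanceAs (Module F F)

instance : Module A (OneDim χ) := Module.compHom F χ.toRingHom

instance : IsScalarTower F A (OneDim χ) where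
  smul_assoc r x v := by
    have h (w : F) : χ (r • x) * w = r * (χ x * w) := by
      rw [map_smul, smul_eq_mul, mul_assoc]
    exact h v

end

/-! ### The principal series module `L^A(a^{(m)})` -/

/-- The Laurent polynomial ring in `m` commuting variables, as the group algebra of `ℤ^m`. -/
abbrev Laurent (F : Type u) [Field F] (m : ℕ) : Type u :=
  MonoidAlgebra F (Fin m → Multiplicative ℤ)

theorem zpowersHom_commute {G : Type*} [Group G] {m : ℕ} (x : Fin m → G)
    (hx : ∀ i j, Commute (x i) (x j)) :
    Pairwise fun i j => ∀ s t : Multiplicative ℤ,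
      Commute (zpowersHom G (x i) s) (zpowersHom G (x j) t) := by
  intro i j _ s t
  simpa using (hx i j).zpow_zpow s.toAdd t.toAdd

/-- The homomorphism from the Laurent polynomial ring sending the variables to given pairwise
commuting units. -/
def laurentLift {m : ℕ} {B : Type*} [Ring B] [Algebra F B] (x : Fin m → Bˣ)
    (hx : ∀ i j, Commute (x i) (x j)) : Laurent F m →ₐ[F] B :=
  MonoidAlgebra.lift F B (Fin m → Multiplicative ℤ)
    ((Units.coeHom B).comp
      (MonoidHom.noncommPiCoprod (fun i => zpowersHom Bˣ (x i)) (zpowersHom_commute x hx)))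

/-- The principal series module `L^A(a^{(m)})`: the `H_m^A`-module induced from the
one-dimensional module `a^{(m)}` of the Laurent polynomial ring in `X_1, …, X_m`, on which all
`X_j` act as `a`. -/
abbrev LA (q : F) (a : Fˣ) (m : ℕ) : Type u :=
  Ind (laurentLift (F := F) (B := HA q m) (XA q) (XA_comm q))
    (OneDim (laurentLift (F := F) (fun _ : Fin m => a) (fun _ _ => Commute.refl a)))

/-- The character of `H_1^A = F[X_1^{±1}]` with `X_1 ↦ a`. -/
def charA (q : F) (a : Fˣ) : HA q 1 →ₐ[F] F :=
  RingQuot.liftAlgHom F ⟨FreeAlgebra.lift F fun g => match g with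
    | .T _ _ => 0
    | .X _ => (a : F)
    | .Xinv _ => ((a⁻¹ : Fˣ) : F), by
      intro x y h
      cases h with
      | X_mul_inv j => simp
      | X_inv_mul j => simp
      | X_comm i j => simp
      | quad i h => omega
      | braid i h => omega
      | T_comm i j hi hj h => omega
      | T_X_comm i hi j h h' => omega
      | T_X i h => omega⟩

/-! ### Cosocle and the functors on `H_n`-modules -/

/-- The smallest submodule with semisimple quotient (for modules of finite length). -/
def cosocKer (A : Type*) [Ring A] (M : Type*) [AddCommGroup M] [Module A M] : Submodule A M :=
  sInf {K | IsSemisimpleModule A (M ⧸ K)}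

/-- The cosocle of `M`: its largest semisimple quotient. -/
abbrev Cosoc (A : Type*) [Ring A] (M : Type*) [AddCommGroup M] [Module A M] : Type _ :=
  M ⧸ cosocKer A M

/-- The `i`-th factor `M_{i+1} / M_i` of a composition series. -/
abbrev factor {A : Type*} [Ring A] {M : Type*} [AddCommGroup M] [Module A M]
    (s : CompositionSeries (Submodule A M)) (i : Fin s.length) : Type _ :=
  ↥(s i.succ) ⧸ (s i.castSucc).submoduleOf (s i.succ)

variable (p q : F)

/-- The underlying space of `Δ_{a^{(m)}} M`, for `m ≤ n`: the simultaneous generalized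
`a`-eigenspace of `X_{n-m+1}, …, X_n` on the `H_n`-module `M`. -/
def Delta (n : ℕ) (a : F) (m : ℕ) (M : Type*) [AddCommGroup M] [Module F M]
    [Module (HB p q n) M] [IsScalarTower F (HB p q n) M] : Submodule F M :=
  ⨅ j : Fin (n + 1), ⨅ _ : n < j.val + m,
    Module.End.maxGenEigenspace (Algebra.lsmul F F M (XB p q j)) a

/-- `ε_a(M) = max {m | Δ_{a^{(m)}} M ≠ 0}`, for a nonzero `H_n`-module `M`. -/
def epsilon (n : ℕ) (a : F) (M : Type*) [AddCommGroup M] [Module F M]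
    [Module (HB p q n) M] [IsScalarTower F (HB p q n) M] : ℕ :=
  sSup {m : ℕ | m ≤ n ∧ Delta p q n a m M ≠ ⊥}

/-- The module `ind_{n,m}^{n+m} (N ⊠ L^A(a^{(m)}))`. -/
abbrev IndLA (n : ℕ) (a : Fˣ) (m : ℕ) (N : Type v) [AddCommGroup N] [Module F N]
    [Module (HB p q n) N] [IsScalarTower F (HB p q n) N] : Type (max u v) :=
  Ind (parabolic p q n m) (Outer F N (LA q a m))

/-- The functor `f_a N = ind_{n,1}^{n+1} (N ⊠ (a))`, on objects. -/
abbrev fInd (n : ℕ) (a : Fˣ) (N : Type v) [AddCommGroup N] [Module F N]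
    [Module (HB p q n) N] [IsScalarTower F (HB p q n) N] : Type (max u v) :=
  Ind (parabolic p q n 1) (Outer F N (OneDim (charA q a)))

/-- The Kashiwara operator `f̃_a N = cosoc (f_a N)`. -/
abbrev fTilde (n : ℕ) (a : Fˣ) (N : Type v) [AddCommGroup N] [Module F N]
    [Module (HB p q n) N] [IsScalarTower F (HB p q n) N] : Type (max u v) :=
  Cosoc (HB p q (n + 1)) (fInd p q n a N)

end Modules

end AffineHecke

end

open AffineHecke

/-! Put `k = n - ε_a(N)` and `r = ε_a(N) + m`. Commuting operators with a nonzero joint generalized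
eigenspace have a genuine joint eigenvector there. So `N` contains a simple `H_k`-module `K` on
which `X_{k+1}, …, X_n` act as `a`, and maximality of `ε_a(N)` excludes `a`-eigenvectors of `X_k` in
`K` when `k ≥ 1`. Let `I` be the universal `H_{n+m}`-module generated by `K` with `X_{k+1}, …,
X_{n+m}` acting on `K` as `a`; it is built by inducing one step at a time (`exists_isLeviInd`). Both
`ind (N ⊠ L^A(a^{(m)}))` and, for `m = 1`, `ind (N ⊠ (a))` are generated by an image of `K` of this
kind, hence are quotients of `I` (`cosocle_of_isLeviHom`).

The crux is that the joint `a`-eigenspace of `X_{k+1}, …, X_{n+m}` in `I` is exactly `K`. As `K` is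
simple and generates `I`, a proper submodule of `I` contains no such eigenvector. So a proper
submodule of a quotient `V` of `I`, and every quotient of that submodule, has `Δ_{a^{(r)}} = 0`,
while every nonzero quotient of `V` has `Δ_{a^{(r)}} ≠ 0`. Two distinct maximal submodules `J`, `S`
are impossible, because `V/J` would be a quotient of `S`. Hence the cosocle is simple with `ε_a =
r`, and all composition factors below the top have smaller `ε_a`.

The eigenspace is found step by step (`mem_cosetFil_of_eigenvector`). A one-step induced module is
`⊕ D_t E` over the `2n + 2` coset representatives `D_t`, and the `X_l` act triangularly: `D_t` moves
the new eigenvalue `a` to another position, or moves and inverts it. In the top component of an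
eigenvector an inverted `a` is excluded by `a ≠ a⁻¹`, a position at or below `k` by the absence of
`a`-eigenvectors of `X_k` in `K`, and the remaining positions by a Jordan block with off-diagonal
entry `(q - q⁻¹) a ≠ 0`.

Directness of `⊕ D_t E` is a PBW theorem (`pbwMap_bijective`). Spanning comes from the braid and
Bernstein relations. Independence comes from a faithful action on rational functions by
Demazure–Lusztig operators: the leading terms of the `D_t` lie in eigenspaces for distinct
eigenvalues, and powers of `X_{n+1}` are separated by scaling a variable by `q`, which is not a root
of unity. -/

noncomputable section

namespace AffineHecke

/-! ### Generators indexed by natural numbers -/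

section Generators

variable {F : Type u} [Field F] (p q : F) (n : ℕ)

/-- `T_i` in `H_n`, and `0` if `i ≥ n`. -/
def gT (i : ℕ) : HB p q n := if h : i < n then TB p q ⟨i, h⟩ else 0

/-- `X_j` in `H_n`, and `1` if `j > n`. -/
def gX (j : ℕ) : HB p q n := if h : j < n + 1 then XB p q ⟨j, h⟩ else 1

/-- `X_j⁻¹` in `H_n`, and `1` if `j > n`. -/
def gY (j : ℕ) : HB p q n := if h : j < n + 1 then XinvB p q ⟨j, h⟩ else 1

/-- The coefficient in the quadratic relation of `T_i`. -/
def qc (i : ℕ) : F := if i = 0 then p - p⁻¹ else q - q⁻¹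

variable {p q n}

theorem gT_fin (i : Fin n) : gT p q n i = TB p q i := by simp [gT]

theorem gX_fin (j : Fin (n + 1)) : gX p q n j = XB p q j := by
  rw [gX, dif_pos j.isLt]

theorem gY_fin (j : Fin (n + 1)) : gY p q n j = XinvB p q j := by
  rw [gY, dif_pos j.isLt]

@[simp] theorem gX_mul_gY (j : ℕ) : gX p q n j * gY p q n j = 1 := by
  unfold gX gY
  split_ifs
  · exact X_mul_XinvB _
  · simp

@[simp] theorem gY_mul_gX (j : ℕ) : gY p q n j * gX p q n j = 1 := by
  unfold gX gY
  split_ifs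
  · exact Xinv_mul_XB _
  · simp

theorem gX_comm (i j : ℕ) : Commute (gX p q n i) (gX p q n j) := by
  unfold gX
  split_ifs
  · exact X_commB _ _
  all_goals simp

theorem commute_gY {z : HB p q n} {j : ℕ} (h : Commute z (gX p q n j)) :
    Commute z (gY p q n j) :=
  commute_inv_of h (gX_mul_gY j) (gY_mul_gX j)

theorem gX_gY_comm (i j : ℕ) : Commute (gX p q n i) (gY p q n j) := commute_gY (gX_comm i j)

theorem gY_comm (i j : ℕ) : Commute (gY p q n i) (gY p q n j) :=
  commute_gY (gX_gY_comm j i).symm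

theorem gT_comm {i j : ℕ} (h : i + 1 < j) : Commute (gT p q n i) (gT p q n j) := by
  unfold gT
  split_ifs
  · exact T_commB _ _ h
  all_goals simp

theorem gT_gX_comm {i j : ℕ} (h : j ≠ i) (h' : j ≠ i + 1) :
    Commute (gT p q n i) (gX p q n j) := by
  unfold gT gX
  split_ifs
  · exact T_X_commB _ _ h h'
  all_goals simp

theorem gT_gY_comm {i j : ℕ} (h : j ≠ i) (h' : j ≠ i + 1) :
    Commute (gT p q n i) (gY p q n j) :=
  commute_gY (gT_gX_comm h h')

theorem quad_expand {R : Type*} [Ring R] [Algebra F R] {r : F} (hr : r ≠ 0) {t : R}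
    (h : (t - algebraMap F R r) * (t + algebraMap F R r⁻¹) = 0) : t * t = (r - r⁻¹) • t + 1 := by
  have h1 : algebraMap F R r * algebraMap F R r⁻¹ = 1 := by
    rw [← map_mul, mul_inv_cancel₀ hr, map_one]
  have h2 : t * algebraMap F R r⁻¹ = r⁻¹ • t := by
    rw [Algebra.smul_def, Algebra.commutes]
  rw [sub_mul, mul_add, mul_add, h1, h2, ← Algebra.smul_def] at h
  rw [sub_smul, ← sub_eq_zero, ← h]
  abel

theorem gT_sq (hp : p ≠ 0) (hq : q ≠ 0) {i : ℕ} (h : i < n) :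
    gT p q n i * gT p q n i = qc p q i • gT p q n i + 1 := by
  simp only [gT, h, dif_pos, qc]
  split_ifs with hi
  · subst hi
    exact quad_expand hp (quad_zeroB h)
  · exact quad_expand hq (quadB _ (Nat.one_le_iff_ne_zero.mpr hi))

theorem gT_braid {i : ℕ} (hi : 1 ≤ i) (h : i + 1 < n) :
    gT p q n i * gT p q n (i + 1) * gT p q n i =
      gT p q n (i + 1) * gT p q n i * gT p q n (i + 1) := by
  simpa only [gT, h, (by omega : i < n), dif_pos] using braidB i hi h

theorem gT_braid_zero (h : 1 < n) :
    gT p q n 1 * gT p q n 0 * gT p q n 1 * gT p q n 0 =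
      gT p q n 0 * gT p q n 1 * gT p q n 0 * gT p q n 1 := by
  simpa only [gT, h, (by omega : 0 < n), dif_pos] using braid_zeroB h

theorem gT_gX_gT_zero (h : 0 < n) :
    gT p q n 0 * gX p q n 0 * gT p q n 0 = gX p q n 0 * gX p q n 1 := by
  simpa only [gT, gX, h, (by omega : 0 < n + 1), (by omega : 1 < n + 1), dif_pos]
    using T_X_zeroB h

theorem gT_gX_gT {i : ℕ} (hi : 1 ≤ i) (h : i < n) :
    gT p q n i * gX p q n i * gT p q n i = gX p q n (i + 1) := by
  simpa only [gT, gX, h, (by omega : i < n + 1), (by omega : i + 1 < n + 1), dif_pos]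
    using T_XB i hi h

/-! #### Moving `X` past `T` -/

section Bernstein

variable (hp : p ≠ 0) (hq : q ≠ 0)

include hp hq in
theorem gT_mul_inv {i : ℕ} (h : i < n) :
    gT p q n i * (gT p q n i - algebraMap F _ (qc p q i)) = 1 := by
  rw [mul_sub, gT_sq hp hq h, Algebra.smul_def, ← Algebra.commutes]
  simp

include hp hq in
theorem gT_inv_mul {i : ℕ} (h : i < n) :
    (gT p q n i - algebraMap F _ (qc p q i)) * gT p q n i = 1 := by
  rw [sub_mul, gT_sq hp hq h, Algebra.smul_def]
  simp

/-- If `t a t = b` in a ring where `t (t - c) = 1`, then `b t = t a + c b`. -/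
theorem mul_right_of_sandwich {R : Type*} [Ring R] [Algebra F R] {c : F} {t a b : R}
    (ht : t * (t - algebraMap F R c) = 1) (h : t * a * t = b) : b * t = t * a + c • b := by
  have h1 : b * (t - algebraMap F R c) = t * a := by rw [← h, mul_assoc, ht, mul_one]
  rw [mul_sub, ← Algebra.commutes, ← Algebra.smul_def] at h1
  rw [← h1, sub_add_cancel]

/-- If `t a t = b` in a ring where `(t - c) t = 1`, then `a t = t b - c b`. -/
theorem mul_right_of_sandwich' {R : Type*} [Ring R] [Algebra F R] {c : F} {t a b : R}
    (ht : (t - algebraMap F R c) * t = 1) (h : t * a * t = b) : a * t = t * b - c • b := by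
  have h1 : (t - algebraMap F R c) * b = a * t := by
    rw [← h, mul_assoc, ← mul_assoc, ht, one_mul]
  rw [← h1, sub_mul, Algebra.smul_def]

include hp hq in
theorem gX_succ_mul_gT {k : ℕ} (hk : 1 ≤ k) (h : k < n) :
    gX p q n (k + 1) * gT p q n k =
      gT p q n k * gX p q n k + qc p q k • gX p q n (k + 1) :=
  mul_right_of_sandwich (gT_mul_inv hp hq h) (gT_gX_gT hk h)

include hp hq in
theorem gX_mul_gT {k : ℕ} (hk : 1 ≤ k) (h : k < n) :
    gX p q n k * gT p q n k =
      gT p q n k * gX p q n (k + 1) - qc p q k • gX p q n (k + 1) :=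
  mul_right_of_sandwich' (gT_inv_mul hp hq h) (gT_gX_gT hk h)

/-- Inverting `t a t = b`. -/
theorem sandwich_inv {R : Type*} [Ring R] {t t' a a' b b' : R} (h : t * a * t = b)
    (ht : t * t' = 1) (ht' : t' * t = 1) (ha : a * a' = 1) (hb' : b' * b = 1) :
    t * b' * t = a' := by
  have h1 : b * (t' * a' * t') = 1 := by
    rw [← h]
    calc t * a * t * (t' * a' * t') = t * a * (t * t') * a' * t' := by noncomm_ring
      _ = t * (a * a') * t' := by rw [ht]; noncomm_ring
      _ = 1 := by rw [ha, mul_one, ht]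
  have h2 : b' = t' * a' * t' := by
    calc b' = b' * (b * (t' * a' * t')) := by rw [h1, mul_one]
      _ = t' * a' * t' := by rw [← mul_assoc, hb', one_mul]
  rw [h2]
  calc t * (t' * a' * t') * t = (t * t') * a' * (t' * t) := by noncomm_ring
    _ = a' := by rw [ht, ht', one_mul, mul_one]

include hp hq in
theorem gT_gY_gT {k : ℕ} (hk : 1 ≤ k) (h : k < n) :
    gT p q n k * gY p q n (k + 1) * gT p q n k = gY p q n k :=
  sandwich_inv (gT_gX_gT hk h) (gT_mul_inv hp hq h) (gT_inv_mul hp hq h) (gX_mul_gY _)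
    (gY_mul_gX _)

include hp hq in
theorem gY_mul_gT {k : ℕ} (hk : 1 ≤ k) (h : k < n) :
    gY p q n k * gT p q n k =
      gT p q n k * gY p q n (k + 1) + qc p q k • gY p q n k :=
  mul_right_of_sandwich (gT_mul_inv hp hq h) (gT_gY_gT hp hq hk h)

include hp hq in
theorem gY_succ_mul_gT {k : ℕ} (hk : 1 ≤ k) (h : k < n) :
    gY p q n (k + 1) * gT p q n k =
      gT p q n k * gY p q n k - qc p q k • gY p q n k :=
  mul_right_of_sandwich' (gT_inv_mul hp hq h) (gT_gY_gT hp hq hk h)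

include hp hq in
theorem gX_zero_mul_gT (h : 0 < n) :
    gX p q n 0 * gT p q n 0 =
      gT p q n 0 * (gX p q n 0 * gX p q n 1) - qc p q 0 • (gX p q n 0 * gX p q n 1) :=
  mul_right_of_sandwich' (gT_inv_mul hp hq h) (gT_gX_gT_zero h)

include hp hq in
theorem gY_zero_mul_gT (h : 0 < n) :
    gY p q n 0 * gT p q n 0 =
      gT p q n 0 * (gY p q n 1 * gY p q n 0) + qc p q 0 • gY p q n 0 :=
  mul_right_of_sandwich (gT_mul_inv hp hq h)
    (sandwich_inv (gT_gX_gT_zero h) (gT_mul_inv hp hq h) (gT_inv_mul hp hq h) (gX_mul_gY _)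
      (by rw [mul_assoc, ← mul_assoc (gY p q n 0), gY_mul_gX, one_mul, gY_mul_gX]))

include hp hq in
-- Since `X_1 = X_0⁻¹ T_0 X_0 T_0`, one has `X_1 T_0 = X_0⁻¹ T_0 X_0 T_0²`, and the quadratic
-- relation finishes. Up to terms without `T_0`, moving past `T_0` inverts `X_1`.
theorem gX_one_mul_gT (h : 0 < n) :
    gX p q n 1 * gT p q n 0 =
      gT p q n 0 * gY p q n 1 + qc p q 0 • (gX p q n 1 + 1) := by
  set t := gT p q n 0
  set c := qc p q 0
  set x := gX p q n 0
  set y := gX p q n 1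
  set x' := gY p q n 0
  set y' := gY p q n 1
  have hxx : x' * x = 1 := gY_mul_gX 0
  have hy : x' * (t * x * t) = y := by
    rw [gT_gX_gT_zero h, ← mul_assoc, hxx, one_mul]
  have hs : t * (y' * x') * t = x' :=
    sandwich_inv (gT_gX_gT_zero h) (gT_mul_inv hp hq h) (gT_inv_mul hp hq h) (gX_mul_gY _)
      (by rw [mul_assoc, ← mul_assoc (gY p q n 0), gY_mul_gX, one_mul, gY_mul_gX])
  have hsq : t * t = c • t + 1 := gT_sq hp hq h
  have h1 : x' * t = t * (y' * x') + c • x' :=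
    mul_right_of_sandwich (gT_mul_inv hp hq h) hs
  have hcomm : y' * x' = x' * y' := gY_comm 1 0
  have h2 : y * t = x' * t * x * (t * t) := by rw [← hy]; noncomm_ring
  have h3 : x' * t * x = t * y' + c • 1 := by
    rw [h1, add_mul, smul_mul_assoc, hxx, mul_assoc, mul_assoc, hxx, mul_one]
  have h4 : x' * t * x * t = y := by rw [← hy]; noncomm_ring
  rw [h2, hsq, mul_add, mul_one, mul_smul_comm, h4, h3, smul_add]
  abel

include hp hq in
theorem gY_one_mul_gT (h : 0 < n) :
    gY p q n 1 * gT p q n 0 =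
      gT p q n 0 * gX p q n 1 - qc p q 0 • (gX p q n 1 + 1) := by
  have h1 := gX_one_mul_gT hp hq h
  set t := gT p q n 0
  set c := qc p q 0
  set y := gX p q n 1
  set y' := gY p q n 1
  have hy : y' * y = 1 := gY_mul_gX 1
  have hy' : y * y' = 1 := gX_mul_gY 1
  have h2 : y' * (y * t) * y = y' * (t * y' + c • (y + 1)) * y := by rw [h1]
  have h3 : y' * (y * t) * y = t * y := by rw [← mul_assoc, hy, one_mul]
  have h4 : y' * (t * y' + c • (y + 1)) * y = y' * t * (y' * y) + c • ((y' * y) * y + y' * y) := by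
    simp only [mul_add, add_mul, mul_smul_comm, smul_mul_assoc, mul_one, mul_assoc]
  rw [h3, h4, hy, one_mul, mul_one] at h2
  rw [h2]
  abel

end Bernstein

/-! #### Induction over the generators -/

theorem HB.induction_on {P : HB p q n → Prop} (x : HB p q n)
    (halg : ∀ r : F, P (algebraMap F _ r)) (hT : ∀ i < n, P (gT p q n i))
    (hX : ∀ j ≤ n, P (gX p q n j)) (hY : ∀ j ≤ n, P (gY p q n j))
    (hmul : ∀ x y, P x → P y → P (x * y)) (hadd : ∀ x y, P x → P y → P (x + y)) : P x := by
  obtain ⟨x, rfl⟩ : ∃ x', mkB p q n x' = x := RingQuot.mkAlgHom_surjective F _ x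
  induction x using FreeAlgebra.induction with
  | grade0 r => simpa using halg r
  | grade1 g =>
    cases g with
    | T i => exact (congrArg P (gT_fin i)).mp (hT i i.isLt)
    | X j => exact (congrArg P (gX_fin j)).mp (hX j (Nat.lt_succ_iff.mp j.isLt))
    | Xinv j => exact (congrArg P (gY_fin j)).mp (hY j (Nat.lt_succ_iff.mp j.isLt))
  | mul a b ha hb => simpa using hmul _ _ ha hb
  | add a b ha hb => simpa using hadd _ _ ha hb

theorem inclB_gT {m i : ℕ} (h : i < n) : inclB p q n m (gT p q n i) = gT p q (n + m) i := by
  rw [gT, dif_pos h, gT, dif_pos (by omega)]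
  exact inclB_T p q n m ⟨i, h⟩

theorem inclB_gX {m j : ℕ} (h : j ≤ n) : inclB p q n m (gX p q n j) = gX p q (n + m) j := by
  rw [gX, dif_pos (by omega), gX, dif_pos (by omega)]
  exact inclB_X p q n m ⟨j, by omega⟩

theorem inclB_gY {m j : ℕ} (h : j ≤ n) : inclB p q n m (gY p q n j) = gY p q (n + m) j := by
  rw [gY, dif_pos (by omega), gY, dif_pos (by omega)]
  exact inclB_Xinv p q n m ⟨j, by omega⟩

section Modules

variable {V : Type*} [AddCommGroup V] [Module F V] [Module (HB p q n) V]
  [IsScalarTower F (HB p q n) V]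

theorem smul_mem_of_generators {W : Submodule F V}
    (hT : ∀ i < n, ∀ w ∈ W, gT p q n i • w ∈ W) (hX : ∀ j ≤ n, ∀ w ∈ W, gX p q n j • w ∈ W)
    (hY : ∀ j ≤ n, ∀ w ∈ W, gY p q n j • w ∈ W) (x : HB p q n) : ∀ w ∈ W, x • w ∈ W := by
  induction x using HB.induction_on with
  | halg r => intro w hw; rw [algebraMap_smul]; exact W.smul_mem r hw
  | hT i hi => exact hT i hi
  | hX j hj => exact hX j hj
  | hY j hj => exact hY j hj
  | hmul x y hx hy => intro w hw; rw [mul_smul]; exact hx _ (hy _ hw)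
  | hadd x y hx hy => intro w hw; rw [add_smul]; exact W.add_mem (hx _ hw) (hy _ hw)

end Modules

end Generators

/-! ### Coset representatives for `H_n` in `H_{n+1}` -/

section CosetRep

variable {F : Type u} [Field F] (p q : F) (n : ℕ)

/-- The products `1, T_n, T_{n-1} T_n, …, T_0 ⋯ T_n, T_1 T_0 ⋯ T_n, …, T_n ⋯ T_0 ⋯ T_n` in
`H_{n+1}`, in order of length. -/
def cosetRep : ℕ → HB p q (n + 1)
  | 0 => 1
  | t + 1 => gT p q (n + 1) ((n - t) + (t - n)) * cosetRep t

variable {p q n}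

@[simp] theorem cosetRep_zero : cosetRep p q n 0 = 1 := rfl

theorem cosetRep_succ (t : ℕ) :
    cosetRep p q n (t + 1) = gT p q (n + 1) ((n - t) + (t - n)) * cosetRep p q n t := rfl

theorem cosetRep_succ_of_le {t : ℕ} (h : t ≤ n) :
    cosetRep p q n (t + 1) = gT p q (n + 1) (n - t) * cosetRep p q n t := by
  rw [cosetRep_succ, Nat.sub_eq_zero_of_le h, add_zero]

theorem cosetRep_succ_add (j : ℕ) :
    cosetRep p q n (n + j + 1) = gT p q (n + 1) j * cosetRep p q n (n + j) := by
  rw [cosetRep_succ]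
  congr 2
  omega

theorem gT_mul_cosetRep_low {t k : ℕ} (h : k + t < n) :
    gT p q (n + 1) k * cosetRep p q n t = cosetRep p q n t * gT p q (n + 1) k := by
  induction t with
  | zero => simp
  | succ t ih =>
    rw [cosetRep_succ_of_le (by omega), ← mul_assoc, (gT_comm (by omega : k + 1 < n - t)).eq,
      mul_assoc, ih (by omega), mul_assoc]

/-- In the word `D_t = T_{n-t+1} ⋯ T_n`, `T_k` commutes with the letters to the left of `T_{k-1}
T_k`. There the braid relation turns it into `T_{k-1}`, which commutes with the rest. -/
theorem gT_mul_cosetRep_high {t k : ℕ} (h : n + 1 < k + t) (ht : t ≤ n) (hk : k ≤ n) :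
    gT p q (n + 1) k * cosetRep p q n t = cosetRep p q n t * gT p q (n + 1) (k - 1) := by
  induction t with
  | zero => omega
  | succ t ih =>
    rcases Nat.lt_or_ge (n + 1) (k + t) with h1 | h1
    · rw [cosetRep_succ_of_le (by omega), ← mul_assoc, (gT_comm (by omega : n - t + 1 < k)).symm.eq,
        mul_assoc, ih h1 (by omega), mul_assoc]
    · obtain ⟨t, rfl⟩ : ∃ s, t = s + 1 := ⟨t - 1, by omega⟩
      obtain ⟨k, rfl⟩ : ∃ s, k = s + 1 := ⟨k - 1, by omega⟩
      have e1 : n - (t + 1) = k := by omega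
      have e2 : n - t = k + 1 := by omega
      rw [cosetRep_succ_of_le (by omega), cosetRep_succ_of_le (by omega), e1, e2,
        Nat.add_sub_cancel, ← mul_assoc, ← mul_assoc,
        ← gT_braid (by omega : 1 ≤ k) (by omega), mul_assoc, gT_mul_cosetRep_low (by omega)]
      simp only [mul_assoc]

theorem gT_mul_cosetRep_neg_high {j k : ℕ} (h : j + 1 < k) (hk : k ≤ n) :
    gT p q (n + 1) k * cosetRep p q n (n + j + 1) =
      cosetRep p q n (n + j + 1) * gT p q (n + 1) (k - 1) := by
  induction j with
  | zero =>
    rw [cosetRep_succ_add 0, ← mul_assoc, (gT_comm (by omega : 0 + 1 < k)).symm.eq,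
      mul_assoc, add_zero, gT_mul_cosetRep_high (by omega) le_rfl hk, mul_assoc]
  | succ j ih =>
    rw [cosetRep_succ_add, ← mul_assoc, (gT_comm (by omega : j + 1 + 1 < k)).symm.eq,
      mul_assoc, ← add_assoc, ih (by omega), mul_assoc]

/-- In the word `T_j ⋯ T_0 ⋯ T_n`, `T_k` changes into `T_{k+1}` on the descending half and back into
`T_k` on the ascending half. For `k = 0` both changes happen at once, in the braid relation of
length four. -/
theorem gT_mul_cosetRep_neg_low {j k : ℕ} (h : k < j) (hj : j ≤ n) :
    gT p q (n + 1) k * cosetRep p q n (n + j + 1) =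
      cosetRep p q n (n + j + 1) * gT p q (n + 1) k := by
  induction j with
  | zero => omega
  | succ j ih =>
    rcases Nat.lt_or_ge k j with h1 | h1
    · rw [cosetRep_succ_add, ← mul_assoc, (gT_comm (by omega : k + 1 < j + 1)).eq,
        mul_assoc, ← add_assoc, ih h1 (by omega), mul_assoc]
    · obtain rfl : k = j := by omega
      rcases Nat.eq_zero_or_pos k with rfl | hk
      · obtain ⟨n, rfl⟩ : ∃ m, n = m + 1 := ⟨n - 1, by omega⟩
        have e : gT p q (n + 1 + 1) 0 * cosetRep p q (n + 1) n =
            cosetRep p q (n + 1) n * gT p q (n + 1 + 1) 0 := gT_mul_cosetRep_low (by omega)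
        rw [cosetRep_succ_add (0 + 1),
          show cosetRep p q (n + 1) (n + 1 + (0 + 1)) = _ from cosetRep_succ_add 0, add_zero,
          cosetRep_succ_of_le (by omega), Nat.add_sub_cancel_left, zero_add]
        simp only [← mul_assoc]
        rw [← gT_braid_zero (by omega)]
        simp only [mul_assoc]
        rw [e]
      · obtain ⟨k, rfl⟩ : ∃ s, k = s + 1 := ⟨k - 1, by omega⟩
        have e := gT_mul_cosetRep_neg_high (p := p) (q := q) (n := n) (by omega : k + 1 < k + 1 + 1)
          (by omega)
        rw [Nat.add_sub_cancel] at e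
        rw [cosetRep_succ_add, ← add_assoc, cosetRep_succ_add, ← add_assoc]
        simp only [← mul_assoc]
        rw [gT_braid (by omega) (by omega)]
        simp only [mul_assoc]
        rw [e]

end CosetRep

/-! ### The filtration of an `H_{n+1}`-module generated by an `H_n`-submodule -/

section Filtration

variable {F : Type u} [Field F] {p q : F} {n : ℕ}

/-! ### Subspaces stable under the `X_j` -/

section Stable

variable {V : Type*} [AddCommGroup V] [Module F V] [Module (HB p q n) V]
  [IsScalarTower F (HB p q n) V]

variable (p q n) in
/-- A subspace stable under all `X_j` and their inverses. -/
def XStable (W : Submodule F V) : Prop :=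
  ∀ j, ∀ w ∈ W, gX p q n j • w ∈ W ∧ gY p q n j • w ∈ W

/-- The subspace `W + T_k W`. -/
def supT (p q : F) (n k : ℕ) {V : Type*} [AddCommGroup V] [Module F V] [Module (HB p q n) V]
    [IsScalarTower F (HB p q n) V] (W : Submodule F V) : Submodule F V :=
  W ⊔ W.map (Algebra.lsmul F F V (gT p q n k))

theorem mem_supT_left {k : ℕ} {W : Submodule F V} {w : V} (h : w ∈ W) : w ∈ supT p q n k W :=
  Submodule.mem_sup_left h

theorem mem_supT_right {k : ℕ} {W : Submodule F V} {w : V} (h : w ∈ W) :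
    gT p q n k • w ∈ supT p q n k W :=
  Submodule.mem_sup_right ⟨w, h, rfl⟩

/-- Each Bernstein relation writes `X_j^{±1} T_k` as `T_k f + g` with `f`, `g` Laurent polynomials
in the `X_i`, which preserve `W`. -/
theorem XStable.supT (hp : p ≠ 0) (hq : q ≠ 0) {k : ℕ} (hk : k < n) {W : Submodule F V}
    (h : XStable p q n W) : XStable p q n (supT p q n k W) := by
  have key : ∀ j, ∀ w ∈ W, gX p q n j • gT p q n k • w ∈ AffineHecke.supT p q n k W ∧
      gY p q n j • gT p q n k • w ∈ AffineHecke.supT p q n k W := by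
    intro j w hw
    have hX : ∀ i, gX p q n i • w ∈ W := fun i => (h i w hw).1
    have hY : ∀ i, gY p q n i • w ∈ W := fun i => (h i w hw).2
    rw [smul_smul, smul_smul]
    rcases eq_or_ne j k with rfl | h1
    · rcases Nat.eq_zero_or_pos j with rfl | hj
      · rw [gX_zero_mul_gT hp hq hk, gY_zero_mul_gT hp hq hk]
        simp only [sub_smul, add_smul, mul_smul, smul_assoc]
        exact ⟨sub_mem (mem_supT_right (h _ _ (hX 1)).1)
          (Submodule.smul_mem _ _ (mem_supT_left (h _ _ (hX 1)).1)),
          add_mem (mem_supT_right (h _ _ (hY 0)).2)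
          (Submodule.smul_mem _ _ (mem_supT_left (hY 0)))⟩
      · rw [gX_mul_gT hp hq hj hk, gY_mul_gT hp hq hj hk]
        simp only [sub_smul, add_smul, mul_smul, smul_assoc]
        exact ⟨sub_mem (mem_supT_right (hX _)) (Submodule.smul_mem _ _ (mem_supT_left (hX _))),
          add_mem (mem_supT_right (hY _)) (Submodule.smul_mem _ _ (mem_supT_left (hY _)))⟩
    rcases eq_or_ne j (k + 1) with rfl | h2
    · rcases Nat.eq_zero_or_pos k with rfl | hj
      · rw [zero_add, gX_one_mul_gT hp hq hk, gY_one_mul_gT hp hq hk]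
        simp only [sub_smul, add_smul, mul_smul, smul_assoc, one_smul]
        exact ⟨add_mem (mem_supT_right (hY _))
          (Submodule.smul_mem _ _ (mem_supT_left (add_mem (hX _) hw))),
          sub_mem (mem_supT_right (hX _))
          (Submodule.smul_mem _ _ (mem_supT_left (add_mem (hX _) hw)))⟩
      · rw [gX_succ_mul_gT hp hq hj hk, gY_succ_mul_gT hp hq hj hk]
        simp only [sub_smul, add_smul, mul_smul, smul_assoc]
        exact ⟨add_mem (mem_supT_right (hX _)) (Submodule.smul_mem _ _ (mem_supT_left (hX _))),
          sub_mem (mem_supT_right (hY _)) (Submodule.smul_mem _ _ (mem_supT_left (hY _)))⟩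
    · rw [← (gT_gX_comm h1 h2).eq, ← (gT_gY_comm h1 h2).eq, mul_smul, mul_smul]
      exact ⟨mem_supT_right (hX _), mem_supT_right (hY _)⟩
  intro j w hw
  obtain ⟨x, hx, _, ⟨y, hy, rfl⟩, rfl⟩ := Submodule.mem_sup.mp hw
  rw [smul_add, smul_add]
  exact ⟨add_mem (mem_supT_left (h j x hx).1) (key j y hy).1,
    add_mem (mem_supT_left (h j x hx).2) (key j y hy).2⟩

end Stable

variable {V : Type*} [AddCommGroup V] [Module F V] [Module (HB p q (n + 1)) V]
  [IsScalarTower F (HB p q (n + 1)) V]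

variable (p q n) in
/-- A subspace stable under `T_0, …, T_{n-1}` and all `X_j^{±1}`. -/
structure LeviStable (E : Submodule F V) : Prop where
  T : ∀ k < n, ∀ y ∈ E, gT p q (n + 1) k • y ∈ E
  X : XStable p q (n + 1) E

variable (p q n) in
/-- The sum of the subspaces `D_t E` for the first `m` coset representatives `D_t`. -/
def cosetFil (E : Submodule F V) : ℕ → Submodule F V
  | 0 => ⊥
  | m + 1 => cosetFil E m ⊔ E.map (Algebra.lsmul F F V (cosetRep p q n m))

variable {E : Submodule F V}

theorem cosetFil_mono : Monotone (cosetFil p q n E) :=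
  monotone_nat_of_le_succ fun _ => le_sup_left

theorem cosetRep_smul_mem {t m : ℕ} (h : t < m) {y : V} (hy : y ∈ E) :
    cosetRep p q n t • y ∈ cosetFil p q n E m :=
  cosetFil_mono h (Submodule.mem_sup_right ⟨y, hy, rfl⟩)

theorem cosetFil_induction {P : V → Prop} {m : ℕ} (h0 : P 0)
    (hadd : ∀ x y, P x → P y → P (x + y))
    (hD : ∀ t < m, ∀ y ∈ E, P (cosetRep p q n t • y)) :
    ∀ x ∈ cosetFil p q n E m, P x := by
  induction m with
  | zero =>
    intro x hx
    rw [(Submodule.mem_bot F).mp hx]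
    exact h0
  | succ m ih =>
    intro z hz
    obtain ⟨x, hx, _, ⟨y, hy, rfl⟩, rfl⟩ := Submodule.mem_sup.mp hz
    exact hadd _ _ (ih (fun t ht => hD t (ht.trans (Nat.lt_succ_self m))) x hx)
      (hD m (Nat.lt_succ_self m) y hy)

/-- The excluded `k` is the letter leading to `D_{t+1}`. If `T_k` is the leftmost letter of `D_t`,
the quadratic relation returns `D_t` and `D_{t-1}`. Otherwise `T_k` passes through `D_t` and becomes
some `T_{k'}` with `k' < n`, which preserves `E`. -/
theorem gT_smul_cosetRep_smul_mem (hp : p ≠ 0) (hq : q ≠ 0) (hE : LeviStable p q n E) {t k : ℕ}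
    (ht : t ≤ 2 * n + 1) (hk : k ≤ n) (hkt : k ≠ (n - t) + (t - n)) {y : V} (hy : y ∈ E) :
    gT p q (n + 1) k • cosetRep p q n t • y ∈ cosetFil p q n E (t + 1) := by
  rw [smul_smul]
  have comm : ∀ k' < n, gT p q (n + 1) k * cosetRep p q n t =
      cosetRep p q n t * gT p q (n + 1) k' →
      (gT p q (n + 1) k * cosetRep p q n t) • y ∈ cosetFil p q n E (t + 1) := by
    intro k' hk' h
    rw [h, mul_smul]
    exact cosetRep_smul_mem (Nat.lt_succ_self t) (hE.T k' hk' y hy)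
  rcases Nat.eq_zero_or_pos t with rfl | ht0
  · exact comm k (by omega) (gT_mul_cosetRep_low (by omega))
  obtain ⟨t, rfl⟩ : ∃ s, t = s + 1 := ⟨t - 1, by omega⟩
  by_cases hs : k = (n - t) + (t - n)
  · rw [cosetRep_succ, ← hs, ← mul_assoc, gT_sq hp hq (by omega), add_mul, one_mul,
      smul_mul_assoc, add_smul, smul_assoc]
    refine add_mem (Submodule.smul_mem _ _ ?_)
      (cosetRep_smul_mem (by omega) hy)
    rw [hs, ← cosetRep_succ]
    exact cosetRep_smul_mem (by omega) hy
  rcases Nat.lt_or_ge n (t + 1) with h1 | h1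
  · obtain ⟨j, rfl⟩ : ∃ j, t = n + j := ⟨t - n, by omega⟩
    rcases Nat.lt_or_ge k j with h2 | h2
    · exact comm k (by omega) (gT_mul_cosetRep_neg_low h2 (by omega))
    · exact comm (k - 1) (by omega) (gT_mul_cosetRep_neg_high (by omega) hk)
  · rcases Nat.lt_or_ge (k + (t + 1)) n with h2 | h2
    · exact comm k (by omega) (gT_mul_cosetRep_low h2)
    · exact comm (k - 1) (by omega) (gT_mul_cosetRep_high (by omega) h1 hk)

theorem gT_smul_cosetFil (hp : p ≠ 0) (hq : q ≠ 0) (hE : LeviStable p q n E) {m k : ℕ}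
    (hm : m ≤ 2 * n + 2) (hk : k ≤ n) :
    ∀ x ∈ cosetFil p q n E m, gT p q (n + 1) k • x ∈ cosetFil p q n E (m + 1) := by
  apply cosetFil_induction
  · rw [smul_zero]
    exact zero_mem _
  · intro x y hx hy
    rw [smul_add]
    exact add_mem hx hy
  · intro t ht y hy
    by_cases h : k = (n - t) + (t - n)
    · rw [smul_smul, h, ← cosetRep_succ]
      exact cosetRep_smul_mem (by omega) hy
    · exact cosetFil_mono (by omega) (gT_smul_cosetRep_smul_mem hp hq hE (by omega) hk h hy)

/-- Each filtration step is thus of the form `W + T_k W`, so stability under the `X_j` propagates by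
`XStable.supT`. -/
theorem cosetFil_succ_eq (hp : p ≠ 0) (hq : q ≠ 0) (hE : LeviStable p q n E) {m : ℕ}
    (hm : m ≤ 2 * n) : cosetFil p q n E (m + 2) =
      supT p q (n + 1) ((n - m) + (m - n)) (cosetFil p q n E (m + 1)) := by
  apply le_antisymm
  · apply sup_le le_sup_left
    rintro _ ⟨y, hy, rfl⟩
    change cosetRep p q n (m + 1) • y ∈ _
    rw [cosetRep_succ, mul_smul]
    exact mem_supT_right (cosetRep_smul_mem (Nat.lt_succ_self m) hy)
  · apply sup_le (cosetFil_mono (Nat.le_succ _))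
    rintro _ ⟨y, hy, rfl⟩
    exact gT_smul_cosetFil hp hq hE (by omega) (by omega) y hy

theorem cosetFil_xStable (hp : p ≠ 0) (hq : q ≠ 0) (hE : LeviStable p q n E) {m : ℕ}
    (hm : m ≤ 2 * n + 2) : XStable p q (n + 1) (cosetFil p q n E m) := by
  induction m with
  | zero =>
    intro j w hw
    rw [(Submodule.mem_bot F).mp hw, smul_zero, smul_zero]
    exact ⟨zero_mem _, zero_mem _⟩
  | succ m ih =>
    rcases Nat.eq_zero_or_pos m with rfl | hm0
    · have : cosetFil p q n E (0 + 1) = E := by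
        ext x
        simp [cosetFil]
      rw [this]
      exact hE.X
    · obtain ⟨m, rfl⟩ : ∃ s, m = s + 1 := ⟨m - 1, by omega⟩
      rw [cosetFil_succ_eq hp hq hE (by omega)]
      exact (ih (by omega)).supT hp hq (by omega)

theorem smul_mem_cosetFil (hp : p ≠ 0) (hq : q ≠ 0) (hE : LeviStable p q n E)
    (x : HB p q (n + 1)) : ∀ w ∈ cosetFil p q n E (2 * n + 2),
      x • w ∈ cosetFil p q n E (2 * n + 2) := by
  apply smul_mem_of_generators
  · intro k hk
    apply cosetFil_induction
    · rw [smul_zero]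
      exact zero_mem _
    · intro x y hx hy
      rw [smul_add]
      exact add_mem hx hy
    · intro t ht y hy
      by_cases h : k = (n - t) + (t - n)
      -- Here `k ≤ n` forces `t ≤ 2n`, so `D_{t+1}` is still one of the `2n + 2` representatives and
      -- the filtration closes up.
      · rw [smul_smul, h, ← cosetRep_succ]
        exact cosetRep_smul_mem (by omega) hy
      · exact cosetFil_mono (by omega)
          (gT_smul_cosetRep_smul_mem hp hq hE (by omega) (by omega) h hy)
  · exact fun j _ w hw => (cosetFil_xStable hp hq hE le_rfl j w hw).1
  · exact fun j _ w hw => (cosetFil_xStable hp hq hE le_rfl j w hw).2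

theorem exists_sum_of_mem_cosetFil {m : ℕ} {x : V} (hx : x ∈ cosetFil p q n E m) :
    ∃ e : ℕ → V, (∀ t, e t ∈ E) ∧ x = ∑ t ∈ Finset.range m, cosetRep p q n t • e t := by
  revert x
  apply cosetFil_induction
  · exact ⟨0, fun _ => zero_mem _, by simp⟩
  · rintro x y ⟨e, he, rfl⟩ ⟨f, hf, rfl⟩
    exact ⟨e + f, fun t => add_mem (he t) (hf t), by simp [Finset.sum_add_distrib]⟩
  · intro t ht y hy
    refine ⟨Pi.single t y, fun s => ?_, ?_⟩
    · rcases eq_or_ne s t with rfl | h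
      · simpa using hy
      · simp [Pi.single_eq_of_ne h]
    · rw [Finset.sum_eq_single t]
      · simp
      · intro s _ h
        simp [Pi.single_eq_of_ne h]
      · intro h
        simp [ht] at h

/-! #### Leading coefficients -/

section Leading

variable {a : F} (ha : a ≠ 0) (hX : ∀ y ∈ E, gX p q (n + 1) (n + 1) • y = a • y)

/-- The action of the `X_l` with `l ≥ 1` on `D_t y` modulo the previous step of the filtration:
`D_t` moves the last coordinate to position `n + 1 - t` if `t ≤ n`, and inverts it and moves it to
position `t - n` otherwise. -/
structure LeadingTerms (E : Submodule F V) (a : F) (t : ℕ) : Prop where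
  lt : ∀ l, 1 ≤ l → l < (if t ≤ n then n + 1 - t else t - n) → ∀ y ∈ E,
    gX p q (n + 1) l • cosetRep p q n t • y - cosetRep p q n t • gX p q (n + 1) l • y ∈
      cosetFil p q n E t
  eq : ∀ y ∈ E,
    gX p q (n + 1) (if t ≤ n then n + 1 - t else t - n) • cosetRep p q n t • y -
      (if t ≤ n then a else a⁻¹) • cosetRep p q n t • y ∈ cosetFil p q n E t
  gt : ∀ l, l ≤ n → (if t ≤ n then n + 1 - t else t - n) ≤ l → ∀ y ∈ E,
    gX p q (n + 1) (l + 1) • cosetRep p q n t • y - cosetRep p q n t • gX p q (n + 1) l • y ∈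
      cosetFil p q n E t

/-- Moving `X_l` past `T_k` exchanges the indices `k` and `k + 1`; the correction in the Bernstein
relation is a multiple of `X_{k+1} w`, which lies in `W'`. -/
theorem gX_smul_gT_smul_sub_mem (hp : p ≠ 0) (hq : q ≠ 0) {W W' : Submodule F V} {k l l' : ℕ}
    (hk : k ≤ n) (hk0 : 1 ≤ k) (hl : l' = if l = k then k + 1 else if l = k + 1 then k else l)
    (hW' : XStable p q (n + 1) W') (hTW : ∀ w ∈ W, gT p q (n + 1) k • w ∈ W') {w z : V}
    (hw : w ∈ W') (h : gX p q (n + 1) l' • w - z ∈ W) :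
    gX p q (n + 1) l • gT p q (n + 1) k • w - gT p q (n + 1) k • z ∈ W' := by
  have h1 := hTW _ h
  rw [smul_sub] at h1
  rw [← sub_add_sub_cancel _ (gT p q (n + 1) k • gX p q (n + 1) l' • w) _]
  refine add_mem ?_ h1
  rw [smul_smul, smul_smul, ← sub_smul]
  split_ifs at hl with h2 h3
  · subst h2 hl
    rw [gX_mul_gT hp hq hk0 (by omega), sub_sub_cancel_left, neg_smul, smul_assoc]
    exact neg_mem (Submodule.smul_mem _ _ (hW' _ _ hw).1)
  · subst h3 hl
    rw [gX_succ_mul_gT hp hq hk0 (by omega), add_sub_cancel_left, smul_assoc]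
    exact Submodule.smul_mem _ _ (hW' _ _ hw).1
  · subst hl
    rw [(gT_gX_comm h2 h3).eq, sub_self, zero_smul]
    exact zero_mem _

include ha hX in
-- Induction on `t`, multiplying by one letter. A letter `T_k` with `k ≥ 1` moves the distinguished
-- position by one. The letter `T_0`, reached at `t = n` when that position is `1`, replaces `a` by
-- `a⁻¹`.
theorem leadingTerms (hp : p ≠ 0) (hq : q ≠ 0) (hE : LeviStable p q n E) {t : ℕ}
    (ht : t ≤ 2 * n + 1) : LeadingTerms (p := p) (q := q) (n := n) E a t := by
  induction t with
  | zero =>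
    refine ⟨?_, ?_, ?_⟩
    · intro l _ _ y _
      simp
    · intro y hy
      simp [hX y hy]
    · intro l hl hl'
      simp at hl'
      omega
  | succ t ih =>
    obtain ⟨h1, h2, h3⟩ := ih (by omega)
    have hst := cosetFil_xStable hp hq hE (m := t + 1) (by omega)
    have hmem : ∀ y ∈ E, cosetRep p q n t • y ∈ cosetFil p q n E (t + 1) :=
      fun y hy => cosetRep_smul_mem (Nat.lt_succ_self t) hy
    rcases Nat.lt_trichotomy t n with h | rfl | h
    · have hDs : ∀ z : V, gT p q (n + 1) (n - t) • cosetRep p q n t • z =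
          cosetRep p q n (t + 1) • z := fun z => by
        rw [smul_smul, ← cosetRep_succ_of_le h.le]
      have key : ∀ l l', l' = (if l = n - t then n - t + 1 else
          if l = n - t + 1 then n - t else l) → ∀ y ∈ E, ∀ z,
          gX p q (n + 1) l' • cosetRep p q n t • y - z ∈ cosetFil p q n E t →
          gX p q (n + 1) l • cosetRep p q n (t + 1) • y - gT p q (n + 1) (n - t) • z ∈
            cosetFil p q n E (t + 1) := by
        intro l l' hl y hy z hz
        rw [cosetRep_succ_of_le h.le, mul_smul]
        exact gX_smul_gT_smul_sub_mem hp hq (by omega) (by omega) hl hst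
          (gT_smul_cosetFil hp hq hE (by omega) (by omega)) (hmem y hy) hz
      have e1 : n + 1 - (t + 1) = n - t := by omega
      have e2 : n + 1 - t = n - t + 1 := by omega
      simp only [h.le, if_true] at h1 h2 h3
      refine ⟨?_, ?_, ?_⟩ <;> simp only [Nat.succ_le_of_lt h, if_true]
      · intro l hl hl' y hy
        have := key l l (by rw [if_neg (by omega), if_neg (by omega)]) y hy _
          (h1 l hl (by omega) y hy)
        rwa [hDs] at this
      · intro y hy
        rw [e1]
        have := key (n - t) (n + 1 - t) (by rw [if_pos rfl, e2]) y hy _ (h2 y hy)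
        rwa [smul_comm _ a, hDs] at this
      · intro l hl hl' y hy
        rcases eq_or_ne l (n - t) with rfl | hne
        · have := key (n - t + 1) (n - t) (by rw [if_neg (by omega), if_pos rfl]) y hy _
            (h1 (n - t) (by omega) (by omega) y hy)
          rwa [hDs] at this
        · have := key (l + 1) (l + 1) (by rw [if_neg (by omega), if_neg (by omega)]) y hy _
            (h3 l hl (by omega) y hy)
          rwa [hDs] at this
    · have e1 : t + 1 - t = 1 := by omega
      have hD : cosetRep p q t (t + 1) = gT p q (t + 1) 0 * cosetRep p q t t := by
        rw [cosetRep_succ_of_le le_rfl, Nat.sub_self]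
      have hDs : ∀ z : V, gT p q (t + 1) 0 • cosetRep p q t t • z =
          cosetRep p q t (t + 1) • z := fun z => by
        rw [smul_smul, ← hD]
      simp only [le_refl, if_true, e1] at h1 h2 h3
      refine ⟨?_, ?_, ?_⟩ <;> simp only [Nat.not_succ_le_self, if_false, e1]
      · intro l hl hl'
        omega
      · intro y hy
        have hz := h2 y hy
        have hzm := hmem y hy
        rw [hD, mul_smul]
        generalize cosetRep p q t t • y = z at hz hzm ⊢
        -- Apply `-a⁻¹ X_1⁻¹` to `X_1 z - a z`.
        have hz' : gY p q (t + 1) 1 • z - a⁻¹ • z ∈ cosetFil p q t E t := by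
          have h4 := Submodule.smul_mem _ (-a⁻¹)
            ((cosetFil_xStable hp hq hE (m := t) (by omega)) 1 _ hz).2
          rwa [smul_sub, smul_smul, gY_mul_gX, one_smul, smul_comm _ a, smul_sub, smul_smul,
            neg_mul, inv_mul_cancel₀ ha, neg_smul, neg_smul, one_smul, sub_neg_eq_add,
            neg_add_eq_sub] at h4
        have h5 := gT_smul_cosetFil hp hq hE (k := 0) (by omega) (by omega) _ hz'
        rw [smul_sub, smul_comm _ a⁻¹] at h5
        rw [← sub_add_sub_cancel _ (gT p q (t + 1) 0 • gY p q (t + 1) 1 • z) _]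
        refine add_mem ?_ h5
        rw [smul_smul, smul_smul, ← sub_smul, gX_one_mul_gT hp hq (by omega), add_sub_cancel_left,
          smul_assoc, add_smul, one_smul]
        exact Submodule.smul_mem _ _ (add_mem (hst _ _ hzm).1 hzm)
      · intro l hl hl' y hy
        have h4 := gT_smul_cosetFil hp hq hE (k := 0) (by omega) (by omega) _ (h3 l hl hl' y hy)
        rwa [smul_sub, smul_smul, (gT_gX_comm (by omega) (by omega)).eq, mul_smul, hDs, hDs] at h4
    · have hD : cosetRep p q n (t + 1) = gT p q (n + 1) (t - n) * cosetRep p q n t := by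
        rw [cosetRep_succ]
        congr 2
        omega
      have hDs : ∀ z : V, gT p q (n + 1) (t - n) • cosetRep p q n t • z =
          cosetRep p q n (t + 1) • z := fun z => by
        rw [smul_smul, ← hD]
      have key : ∀ l l', l' = (if l = t - n then t - n + 1 else
          if l = t - n + 1 then t - n else l) → ∀ y ∈ E, ∀ z,
          gX p q (n + 1) l' • cosetRep p q n t • y - z ∈ cosetFil p q n E t →
          gX p q (n + 1) l • cosetRep p q n (t + 1) • y - gT p q (n + 1) (t - n) • z ∈
            cosetFil p q n E (t + 1) := by
        intro l l' hl y hy z hz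
        rw [hD, mul_smul]
        exact gX_smul_gT_smul_sub_mem hp hq (by omega) (by omega) hl hst
          (gT_smul_cosetFil hp hq hE (by omega) (by omega)) (hmem y hy) hz
      have e2 : t + 1 - n = t - n + 1 := by omega
      have hn : ¬ t ≤ n := by omega
      have hn' : ¬ t + 1 ≤ n := by omega
      simp only [hn, if_false] at h1 h2 h3
      refine ⟨?_, ?_, ?_⟩ <;> simp only [hn', if_false, e2]
      · intro l hl hl' y hy
        rcases eq_or_ne l (t - n) with rfl | hne
        · have := key (t - n) (t - n + 1) (by rw [if_pos rfl]) y hy _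
            (h3 (t - n) (by omega) le_rfl y hy)
          rwa [hDs] at this
        · have := key l l (by rw [if_neg (by omega), if_neg (by omega)]) y hy _
            (h1 l hl (by omega) y hy)
          rwa [hDs] at this
      · intro y hy
        have := key (t - n + 1) (t - n) (by rw [if_neg (by omega), if_pos rfl]) y hy _ (h2 y hy)
        rwa [smul_comm _ a⁻¹, hDs] at this
      · intro l hl hl' y hy
        have := key (l + 1) (l + 1) (by rw [if_neg (by omega), if_neg (by omega)]) y hy _
          (h3 l hl (by omega) y hy)
        rwa [hDs] at this

end Leading

end Filtration

/-! ### Demazure–Lusztig operators -/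

section DemazureLusztig

variable {F : Type u} [Field F] {Q : Type v} [Field Q] [Algebra F Q]

/-- The coefficient `(r - r⁻¹) x / (x - 1)`. -/
def dlCoeff (r : F) (x : Q) : Q :=
  (algebraMap F Q r - (algebraMap F Q r)⁻¹) * x / (x - 1)

/-- The operator `g + (r - g) s`, where `g = (r - r⁻¹) x / (x - 1)`. -/
def dlOp (r : F) (x : Q) (s : Q ≃ₐ[F] Q) : Module.End F Q :=
  Algebra.lmul F Q (dlCoeff r x) +
    Algebra.lmul F Q (algebraMap F Q r - dlCoeff r x) * s.toLinearMap

theorem dlOp_apply (r : F) (x : Q) (s : Q ≃ₐ[F] Q) (f : Q) :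
    dlOp r x s f = dlCoeff r x * f + (algebraMap F Q r - dlCoeff r x) * s f := rfl

theorem map_dlCoeff (r : F) (x : Q) (s : Q ≃ₐ[F] Q) :
    s (dlCoeff r x) = dlCoeff r (s x) := by
  simp [dlCoeff, map_div₀, map_inv₀]

theorem dlOp_quad {r : F} (hr : r ≠ 0) {x : Q} {s : Q ≃ₐ[F] Q} (hs : ∀ f, s (s f) = f)
    (hx0 : x ≠ 0) (hx1 : x ≠ 1) (hsx : s x = x⁻¹) :
    (dlOp r x s - algebraMap F _ r) * (dlOp r x s + algebraMap F _ r⁻¹) = 0 := by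
  ext f
  have hR : algebraMap F Q r ≠ 0 := by simpa using hr
  simp only [Module.End.mul_apply, LinearMap.sub_apply, LinearMap.add_apply, dlOp_apply, map_add,
    map_mul, map_sub, hs, map_dlCoeff, hsx, Module.algebraMap_end_apply, LinearMap.zero_apply,
    Algebra.smul_def, AlgEquiv.commutes, map_inv₀]
  unfold dlCoeff
  generalize algebraMap F Q r = R at *
  generalize s f = f1
  have h1 : x - 1 ≠ 0 := sub_ne_zero.mpr hx1
  have h2 : x⁻¹ - 1 = -(x - 1) / x := by field_simp; ring
  rw [h2]
  field_simp
  ring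

theorem dlOp_sandwich {r : F} (hr : r ≠ 0) {x y : Q} {s : Q ≃ₐ[F] Q} (hs : ∀ f, s (s f) = f)
    (hx0 : x ≠ 0) (hy0 : y ≠ 0) (hxy : y ≠ x) (hsx : s x = y) :
    dlOp r (y / x) s * Algebra.lmul F Q x * dlOp r (y / x) s = Algebra.lmul F Q y := by
  ext f
  have hR : algebraMap F Q r ≠ 0 := by simpa using hr
  have hsy : s y = x := by rw [← hsx, hs]
  simp only [Module.End.mul_apply, dlOp_apply, map_add, map_mul, map_sub, hs, map_dlCoeff, map_div₀, hsx, hsy, AlgEquiv.commutes,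
    Algebra.coe_lmul_eq_mul, LinearMap.mul_apply']
  unfold dlCoeff
  generalize algebraMap F Q r = R at *
  generalize s f = f1
  have h1 : y - x ≠ 0 := sub_ne_zero.mpr hxy
  have h2 : y / x - 1 = (y - x) / x := by field_simp
  have h3 : x / y - 1 = -(y - x) / y := by field_simp; ring
  rw [h2, h3]
  field_simp
  ring

theorem dlOp_comm_lmul (r : F) (x : Q) {y : Q} {s : Q ≃ₐ[F] Q} (hy : s y = y) :
    dlOp r x s * Algebra.lmul F Q y = Algebra.lmul F Q y * dlOp r x s := by
  ext f
  simp only [Module.End.mul_apply, dlOp_apply, map_mul, hy, Algebra.coe_lmul_eq_mul,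
    LinearMap.mul_apply']
  ring

theorem dlOp_comm (r r' : F) {x y : Q} {s t : Q ≃ₐ[F] Q} (hst : ∀ f, s (t f) = t (s f))
    (hsy : s y = y) (htx : t x = x) :
    dlOp r x s * dlOp r' y t = dlOp r' y t * dlOp r x s := by
  ext f
  simp only [Module.End.mul_apply, dlOp_apply, map_add, map_mul, map_sub, map_dlCoeff, hsy, htx,
    AlgEquiv.commutes, hst]
  ring

theorem dlOp_braid {r : F} (hr : r ≠ 0) {x y : Q} {s t : Q ≃ₐ[F] Q} (hs : ∀ f, s (s f) = f)
    (ht : ∀ f, t (t f) = f) (hst : ∀ f, s (t (s f)) = t (s (t f))) (hx0 : x ≠ 0) (hx1 : x ≠ 1)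
    (hy0 : y ≠ 0) (hy1 : y ≠ 1) (hxy : x * y ≠ 1) (hsx : s x = x⁻¹) (hsy : s y = x * y)
    (htx : t x = x * y) (hty : t y = y⁻¹) :
    dlOp r x s * dlOp r y t * dlOp r x s = dlOp r y t * dlOp r x s * dlOp r y t := by
  ext f
  have hR : algebraMap F Q r ≠ 0 := by simpa using hr
  simp only [Module.End.mul_apply, dlOp_apply, map_add, map_mul, map_sub, map_dlCoeff, hsy, htx,
    hsx, hty, AlgEquiv.commutes, hs, ht, hst]
  unfold dlCoeff
  generalize algebraMap F Q r = R at *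
  generalize t (s (t f)) = f5
  generalize t (s f) = f4
  generalize s (t f) = f3
  generalize s f = f2
  generalize t f = f1
  have h1 : x - 1 ≠ 0 := sub_ne_zero.mpr hx1
  have h2 : y - 1 ≠ 0 := sub_ne_zero.mpr hy1
  have h3 : x * y - 1 ≠ 0 := sub_ne_zero.mpr hxy
  have e1 : x⁻¹ - 1 = -(x - 1) / x := by field_simp; ring
  have e2 : y⁻¹ - 1 = -(y - 1) / y := by field_simp; ring
  have e3 : x⁻¹ * (x * y) = y := by field_simp
  have e4 : x * y * y⁻¹ = x := by field_simp
  simp only [e1, e2, e3, e4]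
  field_simp
  ring

theorem dlCoeff_inv (r : F) {x : Q} (hx0 : x ≠ 0) (hx1 : x ≠ 1) :
    dlCoeff r x⁻¹ = algebraMap F Q r - (algebraMap F Q r)⁻¹ - dlCoeff r x := by
  unfold dlCoeff
  have h1 : x - 1 ≠ 0 := sub_ne_zero.mpr hx1
  have h2 : x⁻¹ - 1 = -(x - 1) / x := by field_simp; ring
  rw [h2]
  field_simp
  ring

/-- The arguments `x`, `xy`, `y`, `x²y` are the positive roots of `B_2`, written multiplicatively.
This is the one non-formal identity behind the braid relation of length four. -/
theorem dlCoeff_relation (r r' : F) {x y : Q} (hx1 : x ≠ 1) (hy1 : y ≠ 1) (hxy : x * y ≠ 1)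
    (hxxy : x * (x * y) ≠ 1) :
    dlCoeff r' (x * (x * y)) * (algebraMap F Q r - (algebraMap F Q r)⁻¹ - dlCoeff r (x * y)) +
      dlCoeff r (x * y) * (algebraMap F Q r' - (algebraMap F Q r')⁻¹ - dlCoeff r' y) +
      dlCoeff r' y * dlCoeff r x - dlCoeff r x * dlCoeff r' (x * (x * y)) = 0 := by
  unfold dlCoeff
  generalize algebraMap F Q r - (algebraMap F Q r)⁻¹ = c
  generalize algebraMap F Q r' - (algebraMap F Q r')⁻¹ = c'
  have h1 : x - 1 ≠ 0 := sub_ne_zero.mpr hx1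
  have h2 : y - 1 ≠ 0 := sub_ne_zero.mpr hy1
  have h3 : x * y - 1 ≠ 0 := sub_ne_zero.mpr hxy
  have h4 : x * (x * y) - 1 ≠ 0 := sub_ne_zero.mpr hxxy
  generalize hA : x - 1 = A at *
  generalize hB : y - 1 = B at *
  generalize hC : x * y - 1 = C at *
  generalize hD : x * (x * y) - 1 = D at *
  field_simp
  subst hA hB hC hD
  ring

/-- Expanded over the elements of the dihedral group, the two sides differ only in the coefficients
of `s`, `t`, `st` and `ts`, and each difference is a multiple of `dlCoeff_relation`. -/
theorem dlOp_braid_zero {r r' : F} {x y : Q} {s t : Q ≃ₐ[F] Q}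
    (hs : ∀ f, s (s f) = f) (ht : ∀ f, t (t f) = f)
    (hst : ∀ f, t (s (t (s f))) = s (t (s (t f)))) (hx0 : x ≠ 0) (hx1 : x ≠ 1)
    (hy0 : y ≠ 0) (hy1 : y ≠ 1) (hxy : x * y ≠ 1) (hxxy : x * (x * y) ≠ 1) (hsx : s x = x⁻¹)
    (hsy : s y = x * (x * y)) (htx : t x = x * y) (hty : t y = y⁻¹) :
    dlOp r' y t * dlOp r x s * dlOp r' y t * dlOp r x s =
      dlOp r x s * dlOp r' y t * dlOp r x s * dlOp r' y t := by
  ext f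
  have e3 : x⁻¹ * (x * (x * y)) = x * y := by field_simp
  have e4 : x * y * y⁻¹ = x := by field_simp
  have e5 : x * y * x = x * (x * y) := by ring
  have e6 : x⁻¹ * (x * y) = y := by field_simp
  have K := dlCoeff_relation r r' hx1 hy1 hxy hxxy
  simp only [Module.End.mul_apply, dlOp_apply, map_add, map_mul, map_sub, map_dlCoeff, hsy, htx,
    hsx, hty, AlgEquiv.commutes, hs, ht, hst, map_inv₀, e3, e4, e5, e6, dlCoeff_inv r hx0 hx1,
    dlCoeff_inv r' hy0 hy1]
  generalize dlCoeff r' (x * (x * y)) = D at *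
  generalize dlCoeff r (x * y) = B at *
  generalize dlCoeff r' y = C at *
  generalize dlCoeff r x = A at *
  generalize (algebraMap F Q r)⁻¹ = Ri at *
  generalize algebraMap F Q r = R at *
  generalize (algebraMap F Q r')⁻¹ = Ri' at *
  generalize algebraMap F Q r' = R' at *
  linear_combination ((R' - C) * (B - A) * t f + (R - A) * (C - D) * s f -
    (R - A) * (R' - D) * s (t f) + (R' - C) * (R - B) * t (s f)) * K

end DemazureLusztig

/-! ### The polynomial representation -/

section RationalFunctions

variable (F : Type u) [Field F]

/-- The field of rational functions in the variables `z_{i,±}`. -/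
abbrev RatField : Type u := FractionRing (MvPolynomial (ℕ × Bool) F)

variable {F}

/-- The variables of the field of rational functions. -/
def zVar (v : ℕ × Bool) : RatField F := algebraMap _ _ (MvPolynomial.X (R := F) v)

theorem zVar_ne_zero (v : ℕ × Bool) : (zVar v : RatField F) ≠ 0 := by
  simp [zVar, MvPolynomial.X_ne_zero]

theorem ratField_algHom_ext {φ ψ : RatField F →ₐ[F] RatField F}
    (h : ∀ v, φ (zVar v) = ψ (zVar v)) : φ = ψ := by
  apply IsLocalization.algHom_ext (W := nonZeroDivisors (MvPolynomial (ℕ × Bool) F))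
  apply MvPolynomial.algHom_ext
  exact h

/-- The automorphism of the field of rational functions permuting the variables. -/
def permAut (π : Equiv.Perm (ℕ × Bool)) : RatField F ≃ₐ[F] RatField F :=
  IsFractionRing.fieldEquivOfAlgEquiv F _ _ (MvPolynomial.renameEquiv F π)

@[simp] theorem permAut_zVar (π : Equiv.Perm (ℕ × Bool)) (v : ℕ × Bool) :
    permAut π (zVar v : RatField F) = zVar (π v) := by
  simp [permAut, zVar]

theorem permAut_permAut (π π' : Equiv.Perm (ℕ × Bool)) (f : RatField F) :
    permAut π (permAut π' f) = permAut (π * π') f := by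
  have : (permAut π : RatField F ≃ₐ[F] RatField F).toAlgHom.comp (permAut π').toAlgHom =
      (permAut (π * π')).toAlgHom := ratField_algHom_ext fun v => by simp
  exact DFunLike.congr_fun this f

theorem permAut_one (f : RatField F) : permAut 1 f = f := by
  have : (permAut 1 : RatField F ≃ₐ[F] RatField F).toAlgHom = AlgHom.id F _ :=
    ratField_algHom_ext fun v => by simp
  exact DFunLike.congr_fun this f

/-- The automorphism of the field of rational functions scaling one variable by `c`. -/
def scaleAut (c : Fˣ) (v : ℕ × Bool) : RatField F ≃ₐ[F] RatField F :=
  IsFractionRing.fieldEquivOfAlgEquiv F _ _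
    (AlgEquiv.ofAlgHom
      (MvPolynomial.aeval fun w => if w = v then MvPolynomial.C (c : F) * MvPolynomial.X w
        else MvPolynomial.X w)
      (MvPolynomial.aeval fun w => if w = v then MvPolynomial.C ((c⁻¹ : Fˣ) : F) * MvPolynomial.X w
        else MvPolynomial.X w)
      (by
        ext w
        by_cases h : w = v
        · simp [h, ← mul_assoc, ← MvPolynomial.C_mul]
        · simp [h])
      (by
        ext w
        by_cases h : w = v
        · simp [h, ← mul_assoc, ← MvPolynomial.C_mul]
        · simp [h]))

theorem scaleAut_self (c : Fˣ) (v : ℕ × Bool) :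
    scaleAut c v (zVar v) = algebraMap F _ (c : F) * zVar v := by
  simp only [scaleAut, zVar, IsFractionRing.fieldEquivOfAlgEquiv_algebraMap]
  simp [IsScalarTower.algebraMap_apply F (MvPolynomial (ℕ × Bool) F) (RatField F)]

theorem scaleAut_of_ne (c : Fˣ) {v w : ℕ × Bool} (h : w ≠ v) :
    scaleAut c v (zVar w) = zVar w := by
  simp only [scaleAut, zVar, IsFractionRing.fieldEquivOfAlgEquiv_algebraMap]
  simp [h]

/-! #### The coordinates and the simple reflections -/

/-- The rational functions by which the `X_j` with `j ≤ N` act. -/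
def xRat (N j : ℕ) : RatField F :=
  if j = 0 then ∏ i ∈ Finset.Icc 1 N, zVar (i, false) else zVar (j, true) / zVar (j, false)

theorem xRat_ne_zero (N j : ℕ) : (xRat N j : RatField F) ≠ 0 := by
  unfold xRat
  split_ifs
  · exact Finset.prod_ne_zero_iff.mpr fun i _ => zVar_ne_zero _
  · exact div_ne_zero (zVar_ne_zero _) (zVar_ne_zero _)

theorem xRat_of_ne_zero {N j : ℕ} (h : j ≠ 0) :
    (xRat N j : RatField F) = zVar (j, true) / zVar (j, false) := if_neg h

theorem xRat_zero (N : ℕ) :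
    (xRat N 0 : RatField F) = ∏ i ∈ Finset.Icc 1 N, zVar (i, false) := if_pos rfl

/-- The permutation of the variables inducing the simple reflection `s_i`. -/
def simplePerm (i : ℕ) : Equiv.Perm (ℕ × Bool) :=
  if i = 0 then Equiv.swap (1, true) (1, false)
  else Equiv.prodCongr (Equiv.swap i (i + 1)) (Equiv.refl Bool)

theorem simplePerm_zero_apply (j : ℕ) (b : Bool) :
    simplePerm 0 (j, b) = if j = 1 then (1, !b) else (j, b) := by
  cases b <;> by_cases h : j = 1 <;> simp [simplePerm, Equiv.swap_apply_def, h]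

theorem simplePerm_apply {i : ℕ} (hi : i ≠ 0) (j : ℕ) (b : Bool) :
    simplePerm i (j, b) = (Equiv.swap i (i + 1) j, b) := by
  simp [simplePerm, hi]

/-- Since the reflections permute the variables `z_{i,±}`, the Coxeter relations between them reduce
to identities of permutations. -/
theorem simplePerm_sq (i : ℕ) : simplePerm i * simplePerm i = 1 := by
  ext1 ⟨j, b⟩
  rcases eq_or_ne i 0 with rfl | hi
  · by_cases h : j = 1 <;> simp [simplePerm_zero_apply, h]
  · simp [simplePerm_apply hi]

theorem simplePerm_comm {i j : ℕ} (h : i + 1 < j) :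
    simplePerm i * simplePerm j = simplePerm j * simplePerm i := by
  ext1 ⟨k, b⟩
  rcases eq_or_ne i 0 with rfl | hi
  · simp only [Equiv.Perm.mul_apply, simplePerm_apply (by omega : j ≠ 0), simplePerm_zero_apply]
    by_cases hk : k = 1
    · subst hk
      simp [Equiv.swap_apply_of_ne_of_ne (by omega : 1 ≠ j) (by omega : 1 ≠ j + 1)]
    · have : Equiv.swap j (j + 1) k ≠ 1 := by
        rw [Equiv.swap_apply_def]
        split_ifs <;> omega
      simp [hk, this]
  · simp only [Equiv.Perm.mul_apply, simplePerm_apply (by omega : j ≠ 0), simplePerm_apply hi,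
      Equiv.swap_apply_def]
    congr 1
    split_ifs <;> omega

theorem simplePerm_braid {i : ℕ} (hi : i ≠ 0) :
    simplePerm i * simplePerm (i + 1) * simplePerm i =
      simplePerm (i + 1) * simplePerm i * simplePerm (i + 1) := by
  ext1 ⟨k, b⟩
  simp only [Equiv.Perm.mul_apply, simplePerm_apply (by omega : i + 1 ≠ 0), simplePerm_apply hi,
    Equiv.swap_apply_def]
  congr 1
  split_ifs <;> omega

theorem simplePerm_braid_zero :
    simplePerm 1 * simplePerm 0 * simplePerm 1 * simplePerm 0 =
      simplePerm 0 * simplePerm 1 * simplePerm 0 * simplePerm 1 := by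
  ext1 ⟨k, b⟩
  simp only [Equiv.Perm.mul_apply]
  by_cases h1 : k = 1
  · subst h1
    simp [simplePerm_zero_apply, simplePerm_apply one_ne_zero]
  · by_cases h2 : k = 2
    · subst h2
      simp [simplePerm_zero_apply, simplePerm_apply one_ne_zero]
    · simp [simplePerm_zero_apply, simplePerm_apply one_ne_zero, Equiv.swap_apply_def, h1, h2]

/-- The simple reflections as automorphisms of the field of rational functions. -/
def sAut (i : ℕ) : RatField F ≃ₐ[F] RatField F := permAut (simplePerm i)

theorem sAut_sq (i : ℕ) (f : RatField F) : sAut i (sAut i f) = f := by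
  rw [sAut, permAut_permAut, simplePerm_sq, permAut_one]

theorem sAut_comm {i j : ℕ} (h : i + 1 < j) (f : RatField F) :
    sAut i (sAut j f) = sAut j (sAut i f) := by
  rw [sAut, sAut, permAut_permAut, permAut_permAut, simplePerm_comm h]

theorem sAut_braid {i : ℕ} (hi : i ≠ 0) (f : RatField F) :
    sAut i (sAut (i + 1) (sAut i f)) = sAut (i + 1) (sAut i (sAut (i + 1) f)) := by
  simp only [sAut, permAut_permAut, ← mul_assoc]
  rw [simplePerm_braid hi]

theorem sAut_braid_zero (f : RatField F) :
    sAut 1 (sAut 0 (sAut 1 (sAut 0 f))) = sAut 0 (sAut 1 (sAut 0 (sAut 1 f))) := by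
  simp only [sAut, permAut_permAut, ← mul_assoc]
  rw [simplePerm_braid_zero]

theorem sAut_xRat {N i j : ℕ} (hi : i ≠ 0) (hj : j ≠ 0) :
    sAut i (xRat N j : RatField F) = xRat N (Equiv.swap i (i + 1) j) := by
  have : Equiv.swap i (i + 1) j ≠ 0 := by
    rw [Equiv.swap_apply_def]
    split_ifs <;> omega
  simp [xRat_of_ne_zero hj, xRat_of_ne_zero this, sAut, simplePerm_apply hi]

theorem sAut_xRat_left {N i : ℕ} (hi : i ≠ 0) :
    sAut i (xRat N i : RatField F) = xRat N (i + 1) := by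
  rw [sAut_xRat hi hi, Equiv.swap_apply_left]

theorem sAut_xRat_right {N i : ℕ} (hi : i ≠ 0) :
    sAut i (xRat N (i + 1) : RatField F) = xRat N i := by
  rw [sAut_xRat hi (by omega), Equiv.swap_apply_right]

/-- The product defining `X_0` is symmetric in the indices up to `N`, so both `i` and `i + 1` must
lie in that range. -/
theorem sAut_xRat_zero {N i : ℕ} (hi : i ≠ 0) (hN : i + 1 ≤ N) :
    sAut i (xRat N 0 : RatField F) = xRat N 0 := by
  rw [xRat_zero, map_prod]
  simp only [sAut, permAut_zVar, simplePerm_apply hi]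
  refine Equiv.Perm.prod_comp (Equiv.swap i (i + 1)) _ (fun j => zVar (j, false)) ?_
  intro j hj
  have : j = i ∨ j = i + 1 := by
    by_contra h
    push Not at h
    exact hj (Equiv.swap_apply_of_ne_of_ne h.1 h.2)
  simp
  omega

theorem sAut_xRat_of_ne {N i j : ℕ} (hN : i + 1 ≤ N) (h : j ≠ i) (h' : j ≠ i + 1) :
    sAut i (xRat N j : RatField F) = xRat N j := by
  rcases eq_or_ne i 0 with rfl | hi
  · simp [xRat_of_ne_zero h, sAut, simplePerm_zero_apply, (by omega : j ≠ 1)]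
  · rcases eq_or_ne j 0 with rfl | hj
    · exact sAut_xRat_zero hi hN
    · rw [sAut_xRat hi hj, Equiv.swap_apply_of_ne_of_ne h h']

theorem sAut_zero_xRat_one (N : ℕ) : sAut 0 (xRat N 1 : RatField F) = (xRat N 1)⁻¹ := by
  simp [xRat_of_ne_zero one_ne_zero, sAut, simplePerm_zero_apply]

/-- Only the factor `z_{1,-}` of `X_0` moves, to `z_{1,+} = z_{1,-} X_1`. Doubling the variables
makes this possible: `s_0` inverts `X_1` and multiplies `X_0` by `X_1`, yet merely permutes
variables. -/
theorem sAut_zero_xRat_zero {N : ℕ} (hN : 1 ≤ N) :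
    sAut 0 (xRat N 0 : RatField F) = xRat N 0 * xRat N 1 := by
  have h1 : (1 : ℕ) ∈ Finset.Icc 1 N := by simpa using hN
  rw [xRat_zero, map_prod, ← Finset.mul_prod_erase _ _ h1, ← Finset.mul_prod_erase _ _ h1,
    xRat_of_ne_zero one_ne_zero]
  have : ∀ i ∈ (Finset.Icc 1 N).erase 1, sAut 0 (zVar (i, false) : RatField F) = zVar (i, false) :=
    fun i hi => by simp [sAut, simplePerm_zero_apply, Finset.ne_of_mem_erase hi]
  rw [Finset.prod_congr rfl this]
  have := zVar_ne_zero (F := F) (1, false)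
  simp only [sAut, permAut_zVar, simplePerm_zero_apply, if_true, Bool.not_false]
  field_simp

/-! #### Scaling -/

theorem scaleAut_xRat_self (c : Fˣ) (N : ℕ) {j : ℕ} (hj : j ≠ 0) :
    scaleAut c (j, true) (xRat N j : RatField F) = algebraMap F _ (c : F) * xRat N j := by
  rw [xRat_of_ne_zero hj, map_div₀, scaleAut_self, scaleAut_of_ne c (by simp), mul_div_assoc]

theorem scaleAut_xRat_of_ne (c : Fˣ) (N : ℕ) {i j : ℕ} (h : i ≠ j) :
    scaleAut c (j, true) (xRat N i : RatField F) = xRat N i := by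
  rcases eq_or_ne i 0 with rfl | hi
  · rw [xRat_zero, map_prod]
    exact Finset.prod_congr rfl fun k _ => scaleAut_of_ne c (by simp)
  · rw [xRat_of_ne_zero hi, map_div₀, scaleAut_of_ne c (by simp [h]), scaleAut_of_ne c (by simp)]

theorem scaleAut_xRat_zero (c : Fˣ) {N : ℕ} (hN : 1 ≤ N) :
    scaleAut c (1, false) (xRat N 0 : RatField F) = algebraMap F _ (c : F) * xRat N 0 := by
  have h1 : (1 : ℕ) ∈ Finset.Icc 1 N := by simpa using hN
  rw [xRat_zero, map_prod, ← Finset.mul_prod_erase _ _ h1, ← Finset.mul_prod_erase _ _ h1,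
    scaleAut_self, mul_assoc]
  congr 2
  exact Finset.prod_congr rfl fun k hk => scaleAut_of_ne c (by simp [Finset.ne_of_mem_erase hk])

/-- `s_i` involves only variables of index at most `i + 1`, so it fixes `z_{j,+}` and permutes the
others. -/
theorem scaleAut_sAut (c : Fˣ) {i j : ℕ} (h : i + 1 < j) (f : RatField F) :
    scaleAut c (j, true) (sAut i f) = sAut i (scaleAut c (j, true) f) := by
  have hne : ∀ v : ℕ × Bool, v ≠ (j, true) → simplePerm i v ≠ (j, true) := by
    rintro ⟨k, b⟩ hv hv'
    have h1 : simplePerm i (simplePerm i (k, b)) = (k, b) :=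
      DFunLike.congr_fun (simplePerm_sq i) (k, b)
    rw [hv'] at h1
    apply hv
    rw [← h1]
    rcases eq_or_ne i 0 with rfl | hi
    · rw [simplePerm_zero_apply, if_neg (by omega)]
    · simp [simplePerm_apply hi, Equiv.swap_apply_of_ne_of_ne (by omega : j ≠ i)
        (by omega : j ≠ i + 1)]
  have hfix : simplePerm i (j, true) = (j, true) := by
    rcases eq_or_ne i 0 with rfl | hi
    · rw [simplePerm_zero_apply, if_neg (by omega)]
    · simp [simplePerm_apply hi, Equiv.swap_apply_of_ne_of_ne (by omega : j ≠ i)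
        (by omega : j ≠ i + 1)]
  have : (scaleAut c (j, true)).toAlgHom.comp (sAut i : RatField F ≃ₐ[F] RatField F).toAlgHom =
      (sAut i).toAlgHom.comp (scaleAut c (j, true)).toAlgHom := by
    refine ratField_algHom_ext fun v => ?_
    rcases eq_or_ne v (j, true) with rfl | hv
    · simp [sAut, hfix, scaleAut_self]
    · simp [sAut, scaleAut_of_ne c hv, scaleAut_of_ne c (hne v hv)]
  exact DFunLike.congr_fun this f

/-- Scaling `z_{j,+}` by `c` multiplies `X_j` by `c ≠ 1` but fixes `y`. Most of the inequalities
needed for denominators and eigenvalues follow from this. -/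
theorem xRat_mul_ne {c : Fˣ} (hc : (c : F) ≠ 1) {N j : ℕ} (hj : j ≠ 0) {y : RatField F}
    (hy : scaleAut c (j, true) y = y) : xRat N j ≠ y := by
  intro h
  have h1 := scaleAut_xRat_self c N hj
  rw [h, hy] at h1
  have h2 : (algebraMap F (RatField F) c - 1) * y = 0 := by linear_combination -h1
  rcases mul_eq_zero.mp h2 with h3 | h3
  · apply hc
    apply (algebraMap F (RatField F)).injective
    rw [map_one]
    exact sub_eq_zero.mp h3
  · exact xRat_ne_zero N j (h.trans h3)

theorem xRat_ne {c : Fˣ} (hc : (c : F) ≠ 1) {N i j : ℕ} (hj : j ≠ 0) (h : i ≠ j) :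
    (xRat N j : RatField F) ≠ xRat N i :=
  xRat_mul_ne hc hj (scaleAut_xRat_of_ne c N h)

theorem xRat_ne_inv {c : Fˣ} (hc : (c : F) ≠ 1) (hc2 : (c : F) ^ 2 ≠ 1) {N i j : ℕ} (hj : j ≠ 0) :
    (xRat N j : RatField F) ≠ (xRat N i)⁻¹ := by
  rcases eq_or_ne i j with rfl | h
  · intro h
    have h1 : (xRat N i : RatField F) * xRat N i = 1 := by
      nth_rewrite 1 [h]
      exact inv_mul_cancel₀ (xRat_ne_zero N i)
    have h2 := congrArg (scaleAut c (i, true)) h1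
    rw [map_mul, map_one, scaleAut_xRat_self c N hj, mul_mul_mul_comm, h1, mul_one, ← pow_two,
      ← map_pow] at h2
    apply hc2
    apply (algebraMap F (RatField F)).injective
    rw [h2, map_one]
  · exact xRat_mul_ne hc hj (by rw [map_inv₀, scaleAut_xRat_of_ne c N h])

theorem xRat_ne_one {c : Fˣ} (hc : (c : F) ≠ 1) {N j : ℕ} (hj : j ≠ 0) :
    (xRat N j : RatField F) ≠ 1 :=
  xRat_mul_ne hc hj (map_one _)

end RationalFunctions

/-! ### The action of `H_n` by Demazure–Lusztig operators -/

section PolynomialRepresentation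

variable {F : Type u} [Field F] (p q : F) (N : ℕ)

/-- The rational function whose Demazure–Lusztig operator is `T_i`. -/
def rootRat (F : Type u) [Field F] (N i : ℕ) : RatField F :=
  if i = 0 then xRat N 1 else xRat N (i + 1) / xRat N i

/-- The operator by which `T_i` acts on rational functions. -/
def opT (i : ℕ) : Module.End F (RatField F) :=
  dlOp (if i = 0 then p else q) (rootRat F N i) (sAut i)

variable {p q N}

theorem rootRat_zero : rootRat F N 0 = xRat N 1 := if_pos rfl

theorem rootRat_pos {i : ℕ} (hi : i ≠ 0) : rootRat F N i = xRat N (i + 1) / xRat N i := if_neg hi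

theorem rootRat_ne_zero (i : ℕ) : rootRat F N i ≠ 0 := by
  rcases eq_or_ne i 0 with rfl | hi
  · rw [rootRat_zero]
    exact xRat_ne_zero N 1
  · rw [rootRat_pos hi]
    exact div_ne_zero (xRat_ne_zero _ _) (xRat_ne_zero _ _)

theorem xRat_div_ne_one {c : Fˣ} (hc : (c : F) ≠ 1) {i j : ℕ} (hj : j ≠ 0) (h : i ≠ j) :
    (xRat N j / xRat N i : RatField F) ≠ 1 := by
  rw [Ne, div_eq_one_iff_eq (xRat_ne_zero _ _)]
  exact xRat_ne hc hj h

theorem rootRat_ne_one {c : Fˣ} (hc : (c : F) ≠ 1) (i : ℕ) : rootRat F N i ≠ 1 := by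
  rcases eq_or_ne i 0 with rfl | hi
  · rw [rootRat_zero]
    exact xRat_ne_one hc one_ne_zero
  · rw [rootRat_pos hi]
    exact xRat_div_ne_one hc (by omega) (by omega)

theorem sAut_rootRat (i : ℕ) : sAut i (rootRat F N i) = (rootRat F N i)⁻¹ := by
  rcases eq_or_ne i 0 with rfl | hi
  · rw [rootRat_zero, sAut_zero_xRat_one]
  · rw [rootRat_pos hi, map_div₀, sAut_xRat_left hi, sAut_xRat_right hi, inv_div]

theorem opT_quad (hp : p ≠ 0) (hq : q ≠ 0) {c : Fˣ} (hc : (c : F) ≠ 1) (i : ℕ) :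
    (opT p q N i - algebraMap F _ (if i = 0 then p else q)) *
      (opT p q N i + algebraMap F _ (if i = 0 then p else q)⁻¹) = 0 :=
  dlOp_quad (by split_ifs <;> assumption) (sAut_sq i) (rootRat_ne_zero i) (rootRat_ne_one hc i)
    (sAut_rootRat i)

theorem opT_braid (hq : q ≠ 0) {c : Fˣ} (hc : (c : F) ≠ 1) {i : ℕ} (hi : i ≠ 0) :
    opT p q N i * opT p q N (i + 1) * opT p q N i =
      opT p q N (i + 1) * opT p q N i * opT p q N (i + 1) := by
  have hi' : i + 1 ≠ 0 := by omega
  have hm : rootRat F N i * rootRat F N (i + 1) = xRat N (i + 2) / xRat N i := by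
    rw [rootRat_pos hi, rootRat_pos hi']
    have := xRat_ne_zero (F := F) N (i + 1)
    field_simp
  have e : opT p q N i = dlOp q (rootRat F N i) (sAut i) := by rw [opT, if_neg hi]
  have e' : opT p q N (i + 1) = dlOp q (rootRat F N (i + 1)) (sAut (i + 1)) := by
    rw [opT, if_neg hi']
  rw [e, e']
  refine dlOp_braid hq (sAut_sq _) (sAut_sq _) (sAut_braid hi) (rootRat_ne_zero _)
    (rootRat_ne_one hc _) (rootRat_ne_zero _) (rootRat_ne_one hc _) ?_ (sAut_rootRat _) ?_ ?_
    (sAut_rootRat _)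
  · rw [hm]
    exact xRat_div_ne_one hc (by omega) (by omega)
  · rw [hm, rootRat_pos hi', map_div₀, sAut_xRat_right hi, sAut_xRat hi (by omega),
      Equiv.swap_apply_of_ne_of_ne (by omega) (by omega)]
  · rw [hm, rootRat_pos hi, map_div₀, sAut_xRat_left hi', sAut_xRat hi' (by omega),
      Equiv.swap_apply_of_ne_of_ne (by omega) (by omega)]

theorem opT_comm {i j : ℕ} (hN : j + 1 ≤ N) (h : i + 1 < j) :
    opT p q N i * opT p q N j = opT p q N j * opT p q N i := by
  refine dlOp_comm _ _ (sAut_comm h) ?_ ?_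
  · rw [rootRat_pos (by omega), map_div₀, sAut_xRat_of_ne (by omega) (by omega) (by omega),
      sAut_xRat_of_ne (by omega) (by omega) (by omega)]
  · rcases eq_or_ne i 0 with rfl | hi
    · rw [rootRat_zero, sAut_xRat_of_ne (by omega) (by omega) (by omega)]
    · rw [rootRat_pos hi, map_div₀, sAut_xRat_of_ne (by omega) (by omega) (by omega),
        sAut_xRat_of_ne (by omega) (by omega) (by omega)]

theorem opT_braid_zero {c : Fˣ} (hc : (c : F) ≠ 1) (hc2 : (c : F) ^ 2 ≠ 1) :
    opT p q N 1 * opT p q N 0 * opT p q N 1 * opT p q N 0 =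
      opT p q N 0 * opT p q N 1 * opT p q N 0 * opT p q N 1 := by
  have h1 := xRat_ne_zero (F := F) N 1
  have hm : rootRat F N 0 * rootRat F N 1 = xRat N 2 := by
    rw [rootRat_zero, rootRat_pos one_ne_zero]
    field_simp
  have hm' : xRat N 1 * xRat N 2 ≠ (1 : RatField F) := fun h =>
    xRat_ne_inv hc hc2 (N := N) (i := 2) one_ne_zero (eq_inv_of_mul_eq_one_left h)
  have e : opT p q N 0 = dlOp p (rootRat F N 0) (sAut 0) := by rw [opT, if_pos rfl]
  have e' : opT p q N 1 = dlOp q (rootRat F N 1) (sAut 1) := by rw [opT, if_neg one_ne_zero]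
  rw [e, e']
  refine dlOp_braid_zero (sAut_sq _) (sAut_sq _) sAut_braid_zero (rootRat_ne_zero _)
    (rootRat_ne_one hc _) (rootRat_ne_zero _) (rootRat_ne_one hc _) ?_ ?_ (sAut_rootRat _) ?_ ?_
    (sAut_rootRat _)
  · rw [hm]
    exact xRat_ne_one hc two_ne_zero
  · rw [hm, rootRat_zero]
    exact hm'
  · have h0 : sAut 0 (xRat N 2 : RatField F) = xRat N 2 := by
      simp [xRat_of_ne_zero two_ne_zero, sAut, simplePerm_zero_apply]
    rw [hm, rootRat_zero, rootRat_pos one_ne_zero, map_div₀, sAut_zero_xRat_one, h0]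
    field_simp
  · rw [hm, rootRat_zero, sAut_xRat_left one_ne_zero]

theorem opT_lmul_zero (hp : p ≠ 0) {c : Fˣ} (hc : (c : F) ≠ 1) (hN : 1 ≤ N) :
    opT p q N 0 * Algebra.lmul F _ (xRat N 0) * opT p q N 0 =
      Algebra.lmul F _ (xRat N 0) * Algebra.lmul F _ (xRat N 1) := by
  have h0 := xRat_ne_zero (F := F) N 0
  have h1 := xRat_ne_zero (F := F) N 1
  have e : (xRat N 0 * xRat N 1) / xRat N 0 = (xRat N 1 : RatField F) := by field_simp
  rw [← map_mul, opT, if_pos rfl, rootRat_zero]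
  have := dlOp_sandwich hp (sAut_sq 0) h0 (mul_ne_zero h0 h1) (fun h => xRat_ne_one hc (N := N)
    one_ne_zero (mul_left_cancel₀ h0 (h.trans (mul_one _).symm))) (sAut_zero_xRat_zero hN)
  rwa [e] at this

theorem opT_lmul (hq : q ≠ 0) {c : Fˣ} (hc : (c : F) ≠ 1) {i : ℕ} (hi : i ≠ 0) :
    opT p q N i * Algebra.lmul F _ (xRat N i) * opT p q N i =
      Algebra.lmul F _ (xRat N (i + 1)) := by
  rw [opT, if_neg hi, rootRat_pos hi]
  exact dlOp_sandwich hq (sAut_sq i) (xRat_ne_zero _ _) (xRat_ne_zero _ _)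
    (xRat_ne hc (by omega) (by omega)) (sAut_xRat_left hi)

theorem opT_comm_lmul {i j : ℕ} (hN : i + 1 ≤ N) (h : j ≠ i) (h' : j ≠ i + 1) :
    opT p q N i * Algebra.lmul F _ (xRat N j) = Algebra.lmul F _ (xRat N j) * opT p q N i :=
  dlOp_comm_lmul _ _ (sAut_xRat_of_ne hN h h')

/-- The action of `H_n` on rational functions, for `n ≤ N`. -/
def rho {n N : ℕ} (hn : n ≤ N) (hp : p ≠ 0) (hq : q ≠ 0) (hq2 : q ^ 2 ≠ 1) :
    HB p q n →ₐ[F] Module.End F (RatField F) :=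
  RingQuot.liftAlgHom F ⟨FreeAlgebra.lift F fun g => match g with
    | .T i => opT p q N i
    | .X j => Algebra.lmul F _ (xRat N j)
    | .Xinv j => Algebra.lmul F _ (xRat N j)⁻¹, by
      -- The scaling factor used to separate rational functions is `q` itself.
      have hq1 : ((Units.mk0 q hq : Fˣ) : F) ≠ 1 := fun h => hq2 (by simp at h; simp [h])
      have hq2' : ((Units.mk0 q hq : Fˣ) : F) ^ 2 ≠ 1 := hq2
      intro x y h
      cases h with
      | X_mul_inv j =>
        simp only [map_mul, map_one, FreeAlgebra.lift_ι_apply]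
        rw [← map_mul, mul_inv_cancel₀ (xRat_ne_zero _ _), map_one]
      | X_inv_mul j =>
        simp only [map_mul, map_one, FreeAlgebra.lift_ι_apply]
        rw [← map_mul, inv_mul_cancel₀ (xRat_ne_zero _ _), map_one]
      | X_comm i j =>
        simp only [map_mul, FreeAlgebra.lift_ι_apply]
        rw [← map_mul, mul_comm, map_mul]
      | quad_zero h =>
        simpa using opT_quad (N := N) hp hq hq1 0
      | quad i hi =>
        have h := opT_quad (N := N) hp hq hq1 i.val
        rw [if_neg (by omega)] at h
        simpa using h
      | braid i hi h =>
        simpa using opT_braid (p := p) (N := N) hq hq1 (by omega : i ≠ 0)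
      | T_comm i j h =>
        simpa using opT_comm (p := p) (q := q) (N := N) (by omega) h
      | braid_zero h =>
        simpa using opT_braid_zero (p := p) (q := q) (N := N) hq1 hq2'
      | T_X_zero h =>
        simpa using opT_lmul_zero (q := q) (N := N) hp hq1 (by omega)
      | T_X_comm i j h h' =>
        simpa using opT_comm_lmul (p := p) (q := q) (N := N) (by omega) h h'
      | T_X i hi h =>
        simpa using opT_lmul (p := p) (N := N) hq hq1 (by omega : i ≠ 0)⟩

section

variable {n : ℕ} (hn : n ≤ N) (hp : p ≠ 0) (hq : q ≠ 0) (hq2 : q ^ 2 ≠ 1)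

@[simp] theorem rho_gT {i : ℕ} (hi : i < n) : rho hn hp hq hq2 (gT p q n i) = opT p q N i := by
  rw [gT, dif_pos hi]
  simp only [rho, TB, mkB]
  erw [RingQuot.liftAlgHom_mkAlgHom_apply]
  simp

@[simp] theorem rho_gX {j : ℕ} (hj : j ≤ n) :
    rho hn hp hq hq2 (gX p q n j) = Algebra.lmul F _ (xRat N j) := by
  rw [gX, dif_pos (by omega)]
  simp only [rho, XB, mkB]
  erw [RingQuot.liftAlgHom_mkAlgHom_apply]
  simp

@[simp] theorem rho_gY {j : ℕ} (hj : j ≤ n) :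
    rho hn hp hq hq2 (gY p q n j) = Algebra.lmul F _ (xRat N j)⁻¹ := by
  rw [gY, dif_pos (by omega)]
  simp only [rho, XinvB, mkB]
  erw [RingQuot.liftAlgHom_mkAlgHom_apply]
  simp

end

end PolynomialRepresentation

/-! ### `H_{n+1}` is free over `H_n[X_{n+1}^{±1}]` -/

section PBW

variable {F : Type u} [Field F] {p q : F} {N n : ℕ}

variable (p q n) in
/-- `X_j` as a unit. -/
def uX (j : ℕ) : (HB p q n)ˣ := ⟨gX p q n j, gY p q n j, gX_mul_gY j, gY_mul_gX j⟩

/-- The image of `X_{n+1}` under the `t`-th coset representative. -/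
def cosetRat (F : Type u) [Field F] (N n t : ℕ) : RatField F :=
  if t ≤ n then xRat N (n + 1 - t) else (xRat N (t - n))⁻¹

/-- Distinct representatives give distinct eigenvalues of right multiplication by `X_{n+1}`, hence
independent eigenspaces. -/
theorem cosetRat_injOn {c : Fˣ} (hc : (c : F) ≠ 1) (hc2 : (c : F) ^ 2 ≠ 1) {t t' : ℕ}
    (h : cosetRat F N n t = cosetRat F N n t') : t = t' := by
  unfold cosetRat at h
  by_contra hne
  split_ifs at h with h1 h2 h2
  · exact xRat_ne hc (by omega) (by omega) h
  · exact xRat_ne_inv hc hc2 (by omega) h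
  · exact xRat_ne_inv hc hc2 (by omega) h.symm
  · exact xRat_ne hc (by omega) (by omega) (inv_injective h)

theorem sAut_cosetRat (t : ℕ) :
    sAut ((n - t) + (t - n)) (cosetRat F N n t) = cosetRat F N n (t + 1) := by
  unfold cosetRat
  rcases Nat.lt_trichotomy t n with h | rfl | h
  · rw [if_pos h.le, if_pos (by omega), Nat.sub_eq_zero_of_le h.le, add_zero,
      (by omega : n + 1 - t = n - t + 1), sAut_xRat_right (by omega)]
    congr 1
    omega
  · rw [if_pos le_rfl, if_neg (by omega), Nat.sub_self, Nat.add_sub_cancel_left,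
      sAut_zero_xRat_one]
  · rw [if_neg (by omega), if_neg (by omega), Nat.sub_eq_zero_of_le h.le, zero_add, map_inv₀,
      sAut_xRat_left (by omega)]
    congr 2
    omega

/-- Controls the lower-order terms: the reflection that carries the `t`-th eigenvalue to the next
one never carries an earlier eigenvalue beyond the `t`-th. -/
theorem sAut_cosetRat_of_lt {t t' : ℕ} (h : t' < t) (ht : t ≤ 2 * n) :
    ∃ t'' ≤ t, sAut ((n - t) + (t - n)) (cosetRat F N n t') = cosetRat F N n t'' := by
  rcases Nat.lt_or_ge n t with h1 | h1
  · obtain ⟨k, hk⟩ : ∃ k, (n - t) + (t - n) = k := ⟨_, rfl⟩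
    rw [hk]
    by_cases h2 : t' ≤ n
    · rcases eq_or_ne (n + 1 - t') k with h3 | h3
      · refine ⟨n - k, by omega, ?_⟩
        rw [cosetRat, cosetRat, if_pos h2, if_pos (by omega), h3, sAut_xRat_left (by omega)]
        congr 1
        omega
      · rcases eq_or_ne (n + 1 - t') (k + 1) with h4 | h4
        · refine ⟨n + 1 - k, by omega, ?_⟩
          rw [cosetRat, cosetRat, if_pos h2, if_pos (by omega), h4, sAut_xRat_right (by omega)]
          congr 1
          omega
        · refine ⟨t', h.le, ?_⟩
          rw [cosetRat, if_pos h2, sAut_xRat (by omega) (by omega),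
            Equiv.swap_apply_of_ne_of_ne h3 h4]
    · refine ⟨t', h.le, ?_⟩
      rw [cosetRat, if_neg h2, map_inv₀, sAut_xRat (by omega) (by omega),
        Equiv.swap_apply_of_ne_of_ne (by omega) (by omega)]
  · refine ⟨t', h.le, ?_⟩
    rw [cosetRat, if_pos (by omega), Nat.sub_eq_zero_of_le h1, add_zero]
    rcases eq_or_ne (n - t) 0 with h2 | h2
    · rw [h2]
      obtain ⟨j, hj⟩ : ∃ j, n + 1 - t' = j := ⟨_, rfl⟩
      have hj0 : j ≠ 0 := by omega
      have hj1 : j ≠ 1 := by omega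
      rw [hj]
      simp [xRat_of_ne_zero hj0, sAut, simplePerm_zero_apply, hj1]
    · rw [sAut_xRat h2 (by omega), Equiv.swap_apply_of_ne_of_ne (by omega) (by omega)]

/-- Right multiplication by `X_j` on the endomorphisms of the field of rational functions, as a
linear map over that field. -/
def rightX (F : Type u) [Field F] (N j : ℕ) :
    Module.End (RatField F) (Module.End F (RatField F)) where
  toFun u := u * Algebra.lmul F _ (xRat N j)
  map_add' _ _ := add_mul _ _ _
  map_smul' _ _ := rfl

theorem mem_eigenspace_rightX {j : ℕ} {x : RatField F} {u : Module.End F (RatField F)} :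
    u ∈ (rightX F N j).eigenspace x ↔ ∀ f, u (xRat N j * f) = x * u f := by
  rw [Module.End.mem_eigenspace_iff, LinearMap.ext_iff]
  rfl

theorem sAut_mul_mem_eigenspace {i j : ℕ} {x : RatField F} {u : Module.End F (RatField F)}
    (hu : u ∈ (rightX F N j).eigenspace x) :
    (sAut i).toLinearMap * u ∈ (rightX F N j).eigenspace (sAut i x) := by
  rw [mem_eigenspace_rightX] at hu ⊢
  intro f
  change sAut i (u _) = _ * sAut i (u f)
  rw [hu, map_mul]

/-- The sum of the eigenspaces corresponding to the first `m` coset representatives. -/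
def ratFil (F : Type u) [Field F] (N n m : ℕ) :
    Submodule (RatField F) (Module.End F (RatField F)) :=
  ⨆ t : Fin m, (rightX F N (n + 1)).eigenspace (cosetRat F N n t)

theorem eigenspace_le_ratFil {t m : ℕ} (h : t < m) :
    (rightX F N (n + 1)).eigenspace (cosetRat F N n t) ≤ ratFil F N n m :=
  le_iSup (fun t : Fin m => (rightX F N (n + 1)).eigenspace (cosetRat F N n t)) ⟨t, h⟩

theorem ratFil_mono {m m' : ℕ} (h : m ≤ m') : ratFil F N n m ≤ ratFil F N n m' :=
  iSup_le fun t => eigenspace_le_ratFil (t.isLt.trans_le h)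

theorem sAut_mul_mem_ratFil {t : ℕ} (ht : t ≤ 2 * n) {u : Module.End F (RatField F)}
    (hu : u ∈ ratFil F N n t) :
    (sAut ((n - t) + (t - n))).toLinearMap * u ∈ ratFil F N n (t + 1) := by
  induction hu using Submodule.iSup_induction' with
  | mem i u hu =>
    obtain ⟨t'', h1, h2⟩ := sAut_cosetRat_of_lt (F := F) (N := N) i.isLt ht
    have := sAut_mul_mem_eigenspace (i := (n - t) + (t - n)) hu
    rw [h2] at this
    exact eigenspace_le_ratFil (Nat.lt_succ_of_le h1) this
  | zero => simp
  | add x y _ _ hx hy =>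
    rw [mul_add]
    exact add_mem hx hy

theorem opT_mul (i : ℕ) (u : Module.End F (RatField F)) :
    opT p q N i * u = dlCoeff (if i = 0 then p else q) (rootRat F N i) • u +
      (algebraMap F _ (if i = 0 then p else q) -
        dlCoeff (if i = 0 then p else q) (rootRat F N i)) • ((sAut i).toLinearMap * u) := rfl

theorem opT_mul_mem_ratFil {t : ℕ} (ht : t ≤ 2 * n) {u : Module.End F (RatField F)}
    (hu : u ∈ ratFil F N n t) :
    opT p q N ((n - t) + (t - n)) * u ∈ ratFil F N n (t + 1) := by
  rw [opT_mul]
  exact add_mem (Submodule.smul_mem _ _ (ratFil_mono (Nat.le_succ t) hu))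
    (Submodule.smul_mem _ _ (sAut_mul_mem_ratFil ht hu))

/-- Clearing the denominator in `r = (r - r⁻¹) x / (x - 1)` leaves `x = r²`. -/
theorem dlCoeff_ne {r : F} (hr : r ≠ 0) {x : RatField F} (hx : x ≠ 1)
    (hxr : x ≠ algebraMap F _ (r * r)) : algebraMap F _ r - dlCoeff r x ≠ 0 := by
  have h1 : x - 1 ≠ 0 := sub_ne_zero.mpr hx
  have hR : algebraMap F (RatField F) r ≠ 0 := by simpa using hr
  intro h
  apply hxr
  rw [dlCoeff, sub_eq_zero, eq_div_iff h1] at h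
  rw [map_mul]
  field_simp at h
  linear_combination h

theorem rootRat_ne_algebraMap {c : Fˣ} (hc : (c : F) ≠ 1) (i : ℕ) (r : F) (hr : r ≠ 0) :
    rootRat F N i ≠ algebraMap F _ r := by
  have hR : algebraMap F (RatField F) r ≠ 0 := by simpa using hr
  rcases eq_or_ne i 0 with rfl | hi
  · rw [rootRat_zero]
    exact xRat_mul_ne hc one_ne_zero (AlgEquiv.commutes _ _)
  · rw [rootRat_pos hi, Ne, div_eq_iff (xRat_ne_zero _ _)]
    refine xRat_mul_ne hc (by omega) ?_
    rw [map_mul, AlgEquiv.commutes, scaleAut_xRat_of_ne c N (by omega)]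

section

variable (hn : n + 1 ≤ N) (hp : p ≠ 0) (hq : q ≠ 0) (hq2 : q ^ 2 ≠ 1)

/-- Each letter acts as `g + (r - g) s_k`. The term with `s_k` carries the current eigenspace to the
next, while the multiplication by `g` preserves eigenspaces and contributes lower terms. The leading
operator composes the terms `(r - g) s_k`, which are injective because `r - g ≠ 0`. -/
theorem exists_leading_rho_cosetRep {t : ℕ} (ht : t ≤ 2 * n + 1) :
    ∃ g : Module.End F (RatField F), Function.Injective g ∧
      ∀ u ∈ (rightX F N (n + 1)).eigenspace (cosetRat F N n 0),
        g * u ∈ (rightX F N (n + 1)).eigenspace (cosetRat F N n t) ∧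
        rho hn hp hq hq2 (cosetRep p q n t) * u - g * u ∈ ratFil F N n t := by
  have hq1 : ((Units.mk0 q hq : Fˣ) : F) ≠ 1 := fun h => hq2 (by simp at h; simp [h])
  induction t with
  | zero =>
    refine ⟨1, fun _ _ h => h, fun u hu => ⟨?_, ?_⟩⟩
    · rwa [one_mul]
    · simp
  | succ t ih =>
    obtain ⟨g, hg, h⟩ := ih (by omega)
    set k := (n - t) + (t - n) with hk
    set r := if k = 0 then p else q with hr
    have hr0 : r ≠ 0 := by
      rw [hr]
      split_ifs <;> assumption
    set b := algebraMap F (RatField F) r - dlCoeff r (rootRat F N k) with hb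
    have hb0 : b ≠ 0 := dlCoeff_ne hr0 (rootRat_ne_one hq1 k)
      (rootRat_ne_algebraMap hq1 k _ (mul_ne_zero hr0 hr0))
    refine ⟨b • ((sAut k).toLinearMap * g), ?_, fun u hu => ?_⟩
    · intro x y hxy
      exact hg ((sAut k).injective (mul_left_cancel₀ hb0 hxy))
    obtain ⟨h1, h2⟩ := h u hu
    have h3 := sAut_mul_mem_eigenspace (i := k) h1
    rw [sAut_cosetRat] at h3
    rw [smul_mul_assoc, mul_assoc]
    refine ⟨Submodule.smul_mem _ _ h3, ?_⟩
    have h4 := opT_mul_mem_ratFil (p := p) (q := q) (by omega : t ≤ 2 * n) h2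
    rw [mul_sub, ← hk] at h4
    rw [cosetRep_succ, map_mul, ← hk, rho_gT hn hp hq hq2 (by omega), mul_assoc]
    rw [← sub_add_sub_cancel _ (opT p q N k * (g * u)) _]
    refine add_mem h4 ?_
    rw [opT_mul, ← hr, ← hb, add_sub_cancel_right]
    exact Submodule.smul_mem _ _ (eigenspace_le_ratFil (Nat.lt_succ_self t) h1)

/-- The leading term of the last summand lies in its own eigenspace and also in the sum of the
earlier ones. Independence of eigenspaces and injectivity of the leading operator kill that summand,
and induction does the rest. -/
theorem eq_zero_of_sum_rho_cosetRep {m : ℕ} (hm : m ≤ 2 * n + 2)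
    {e : ℕ → Module.End F (RatField F)}
    (he : ∀ t, e t ∈ (rightX F N (n + 1)).eigenspace (cosetRat F N n 0))
    (h : ∑ t ∈ Finset.range m, rho hn hp hq hq2 (cosetRep p q n t) * e t = 0) :
    ∀ t < m, e t = 0 := by
  have hq1 : ((Units.mk0 q hq : Fˣ) : F) ≠ 1 := fun h => hq2 (by simp at h; simp [h])
  have hq2' : ((Units.mk0 q hq : Fˣ) : F) ^ 2 ≠ 1 := hq2
  induction m with
  | zero => intro t ht; omega
  | succ m ih =>
    have hmem : ∀ t < m, rho hn hp hq hq2 (cosetRep p q n t) * e t ∈ ratFil F N n m := by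
      intro t ht
      obtain ⟨g, -, h'⟩ := exists_leading_rho_cosetRep hn hp hq hq2 (by omega : t ≤ 2 * n + 1)
      obtain ⟨h1, h2⟩ := h' _ (he t)
      rw [← sub_add_cancel (rho hn hp hq hq2 (cosetRep p q n t) * e t) (g * e t)]
      exact add_mem (ratFil_mono ht.le h2) (eigenspace_le_ratFil ht h1)
    have hzero : e m = 0 := by
      obtain ⟨g, hg, h'⟩ := exists_leading_rho_cosetRep hn hp hq hq2 (by omega : m ≤ 2 * n + 1)
      obtain ⟨h1, h2⟩ := h' _ (he m)
      have h3 : g * e m ∈ ratFil F N n m := by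
        rw [Finset.sum_range_succ, add_comm, add_eq_zero_iff_eq_neg] at h
        have h4 : rho hn hp hq hq2 (cosetRep p q n m) * e m ∈ ratFil F N n m := by
          rw [h]
          exact neg_mem (sum_mem fun t ht => hmem t (Finset.mem_range.mp ht))
        have := sub_mem h4 h2
        rwa [sub_sub_cancel] at this
      have h5 : ratFil F N n m ≤ ⨆ (x) (_ : x ≠ cosetRat F N n m),
          (rightX F N (n + 1)).eigenspace x :=
        iSup_le fun t => le_iSup₂_of_le (cosetRat F N n t)
          (fun h => t.isLt.ne (cosetRat_injOn hq1 hq2' h)) le_rfl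
      have h6 := Submodule.disjoint_def.mp
        ((rightX F N (n + 1)).eigenspaces_iSupIndep (cosetRat F N n m)) _ h1 (h5 h3)
      ext f
      apply hg
      rw [LinearMap.zero_apply, map_zero]
      exact LinearMap.congr_fun h6 f
    intro t ht
    rcases Nat.lt_succ_iff_lt_or_eq.mp ht with h1 | rfl
    · refine ih (by omega) ?_ t h1
      rw [Finset.sum_range_succ, hzero, mul_zero, add_zero] at h
      exact h
    · exact hzero

end

/-- Conjugation by an automorphism of the field of rational functions. -/
def conjAut (τ : RatField F ≃ₐ[F] RatField F) : Module.End F (Module.End F (RatField F)) where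
  toFun u := τ.toLinearMap * u * τ.symm.toLinearMap
  map_add' _ _ := by rw [mul_add, add_mul]
  map_smul' _ _ := by simp

/-- Conjugation by `τ` multiplies `x^k e_k` by `c^k`, and these eigenvalues are distinct because `c`
is not a root of unity. -/
theorem eq_zero_of_sum_zpow {c : Fˣ} (hc : ∀ k : ℕ, 0 < k → (c : F) ^ k ≠ 1)
    (τ : RatField F ≃ₐ[F] RatField F) {x : RatField F} (hx0 : x ≠ 0)
    (hx : τ x = algebraMap F _ (c : F) * x) {e : ℤ → Module.End F (RatField F)}
    (he : ∀ k f, τ (e k f) = e k (τ f)) {s : Finset ℤ}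
    (h : ∑ k ∈ s, Algebra.lmul F _ (x ^ k) * e k = 0) : ∀ k ∈ s, e k = 0 := by
  have hinj : Function.Injective fun k : ℤ => (c : F) ^ k := by
    have key : ∀ k : ℕ, 0 < k → (c : F) ^ (k : ℤ) ≠ 1 := fun k hk => by
      rw [zpow_natCast]
      exact hc k hk
    intro k l hkl
    by_contra hne
    have h1 : (c : F) ^ (k - l) = 1 := by
      rw [zpow_sub₀ c.ne_zero]
      exact (div_eq_one_iff_eq (zpow_ne_zero _ c.ne_zero)).mpr hkl
    rcases lt_or_gt_of_ne hne with h2 | h2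
    · apply key (l - k).toNat (by omega)
      rw [Int.toNat_of_nonneg (by omega), ← neg_sub, zpow_neg, h1, inv_one]
    · apply key (k - l).toNat (by omega)
      rw [Int.toNat_of_nonneg (by omega), h1]
  have hind := ((conjAut τ).eigenspaces_iSupIndep).comp hinj
  rw [iSupIndep_iff_finsetSum_eq_zero_imp_eq_zero] at hind
  intro k hk
  have h1 := hind s (fun k => Algebra.lmul F _ (x ^ k) * e k) (fun k _ => by
    rw [Function.comp_apply, Module.End.mem_eigenspace_iff]
    ext f
    change τ (x ^ k * e k (τ.symm f)) = (c : F) ^ k • (x ^ k * e k f)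
    rw [map_mul, he, AlgEquiv.apply_symm_apply, map_zpow₀, hx, mul_zpow, ← map_zpow₀, mul_assoc,
      ← Algebra.smul_def]) h k hk
  ext f
  have h2 : x ^ k * e k f = 0 := LinearMap.congr_fun h1 f
  exact (mul_eq_zero.mp h2).resolve_left (zpow_ne_zero k hx0)

theorem rho_inclB (hn : n + 1 ≤ N) (hp : p ≠ 0) (hq : q ≠ 0) (hq2 : q ^ 2 ≠ 1) (h : HB p q n) :
    rho hn hp hq hq2 (inclB p q n 1 h) = rho (by omega : n ≤ N) hp hq hq2 h := by
  induction h using HB.induction_on with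
  | halg r => simp
  | hT i hi => rw [inclB_gT hi, rho_gT _ _ _ _ (by omega), rho_gT _ _ _ _ hi]
  | hX j hj => rw [inclB_gX hj, rho_gX _ _ _ _ (by omega), rho_gX _ _ _ _ hj]
  | hY j hj => rw [inclB_gY hj, rho_gY _ _ _ _ (by omega), rho_gY _ _ _ _ hj]
  | hmul x y hx hy => rw [map_mul, map_mul, hx, hy, map_mul]
  | hadd x y hx hy => rw [map_add, map_add, hx, hy, map_add]

theorem rho_uX_zpow (hn : n ≤ N) (hp : p ≠ 0) (hq : q ≠ 0) (hq2 : q ^ 2 ≠ 1) {j : ℕ} (hj : j ≤ n)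
    (k : ℤ) : rho hn hp hq hq2 ((uX p q n j ^ k : (HB p q n)ˣ) : HB p q n) =
      Algebra.lmul F _ (xRat N j ^ k) := by
  have h1 : Units.map (MonoidHomClass.toMonoidHom (rho hn hp hq hq2)) (uX p q n j) =
      Units.map (MonoidHomClass.toMonoidHom (Algebra.lmul F (RatField F)))
        (Units.mk0 _ (xRat_ne_zero N j)) := Units.ext (rho_gX hn hp hq hq2 hj)
  have h2 := congrArg (fun u => ((u ^ k : (Module.End F (RatField F))ˣ) :
    Module.End F (RatField F))) h1
  simp only [← map_zpow, Units.coe_map] at h2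
  simpa using h2

theorem lmul_ratField_apply (x y : RatField F) : Algebra.lmul F (RatField F) x y = x * y := rfl

/-- The operators of `H_n` do not involve `z_{n+1,+}`, whereas `X_{n+1}` is scaled; this separates
the powers of `X_{n+1}`. -/
theorem scaleAut_rho (hn : n ≤ N) (hp : p ≠ 0) (hq : q ≠ 0) (hq2 : q ^ 2 ≠ 1) (c : Fˣ)
    (h : HB p q n) (f : RatField F) :
    scaleAut c (n + 1, true) (rho hn hp hq hq2 h f) =
      rho hn hp hq hq2 h (scaleAut c (n + 1, true) f) := by
  induction h using HB.induction_on generalizing f with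
  | halg r => simp
  | hT i hi =>
    have hr : scaleAut c (n + 1, true) (rootRat F N i) = rootRat F N i := by
      rcases eq_or_ne i 0 with rfl | h0
      · rw [rootRat_zero, scaleAut_xRat_of_ne c N (by omega)]
      · rw [rootRat_pos h0, map_div₀, scaleAut_xRat_of_ne c N (by omega),
          scaleAut_xRat_of_ne c N (by omega)]
    rw [rho_gT _ _ _ _ hi, opT, dlOp_apply, dlOp_apply, map_add, map_mul, map_mul, map_sub,
      map_dlCoeff, hr, AlgEquiv.commutes, scaleAut_sAut c (by omega)]
  | hX j hj =>
    rw [rho_gX _ _ _ _ hj, lmul_ratField_apply, lmul_ratField_apply, map_mul, scaleAut_xRat_of_ne c N (by omega)]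
  | hY j hj =>
    rw [rho_gY _ _ _ _ hj, lmul_ratField_apply, lmul_ratField_apply, map_mul, map_inv₀, scaleAut_xRat_of_ne c N (by omega)]
  | hmul x y hx hy => rw [map_mul, Module.End.mul_apply, Module.End.mul_apply, hx, hy]
  | hadd x y hx hy => rw [map_add, LinearMap.add_apply, LinearMap.add_apply, map_add, hx, hy]

variable (p q n) in
/-- The map `H_n[x^{±1}] → H_{n+1}` with `x ↦ X_{n+1}`. -/
def leviMap : (ℤ →₀ HB p q n) →ₗ[F] HB p q (n + 1) :=
  Finsupp.lsum F fun k =>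
    (LinearMap.mulLeft F ((uX p q (n + 1) (n + 1) ^ k : (HB p q (n + 1))ˣ) : HB p q (n + 1))).comp
      (inclB p q n 1).toLinearMap

theorem leviMap_single (k : ℤ) (h : HB p q n) :
    leviMap p q n (Finsupp.single k h) =
      ((uX p q (n + 1) (n + 1) ^ k : (HB p q (n + 1))ˣ) : HB p q (n + 1)) * inclB p q n 1 h := by
  simp [leviMap]

theorem leviMap_apply (f : ℤ →₀ HB p q n) :
    leviMap p q n f = ∑ k ∈ f.support,
      ((uX p q (n + 1) (n + 1) ^ k : (HB p q (n + 1))ˣ) : HB p q (n + 1)) *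
        inclB p q n 1 (f k) := by
  simp [leviMap, Finsupp.sum]

variable (p q n) in
/-- The map sending `(f_t)` to `∑ D_t f_t`. -/
def pbwMap : (Fin (2 * n + 2) → ℤ →₀ HB p q n) →ₗ[F] HB p q (n + 1) :=
  ∑ t : Fin (2 * n + 2), (LinearMap.mulLeft F (cosetRep p q n t)).comp ((leviMap p q n).comp (LinearMap.proj t))

theorem pbwMap_apply (f : Fin (2 * n + 2) → ℤ →₀ HB p q n) :
    pbwMap p q n f = ∑ t : Fin (2 * n + 2), cosetRep p q n t * leviMap p q n (f t) := by
  simp [pbwMap]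

theorem pbwMap_single (t : Fin (2 * n + 2)) (k : ℤ) (h : HB p q n) :
    pbwMap p q n (Pi.single t (Finsupp.single k h)) = cosetRep p q n t *
      (((uX p q (n + 1) (n + 1) ^ k : (HB p q (n + 1))ˣ) : HB p q (n + 1)) * inclB p q n 1 h) := by
  rw [pbwMap_apply, Finset.sum_eq_single t]
  · rw [Pi.single_eq_same, leviMap_single]
  · intro s _ hs
    rw [Pi.single_eq_of_ne hs, map_zero, mul_zero]
  · simp

theorem commute_inclB_gX (h : HB p q n) :
    Commute (inclB p q n 1 h) (gX p q (n + 1) (n + 1)) := by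
  induction h using HB.induction_on with
  | halg r => simpa using Algebra.commute_algebraMap_left r _
  | hT i hi =>
    rw [inclB_gT hi]
    exact gT_gX_comm (by omega) (by omega)
  | hX j hj =>
    rw [inclB_gX hj]
    exact gX_comm _ _
  | hY j hj =>
    rw [inclB_gY hj]
    exact (gX_gY_comm _ _).symm
  | hmul x y hx hy =>
    rw [map_mul]
    exact hx.mul_left hy
  | hadd x y hx hy =>
    rw [map_add]
    exact hx.add_left hy

/-- Makes the filtration by coset representatives available in the left regular module `H_{n+1}`. -/
theorem leviStable_range_leviMap : LeviStable p q n (LinearMap.range (leviMap p q n)) := by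
  have key : ∀ z : HB p q (n + 1), (∀ k h, z * leviMap p q n (Finsupp.single k h) ∈
      LinearMap.range (leviMap p q n)) → ∀ y ∈ LinearMap.range (leviMap p q n),
      z • y ∈ LinearMap.range (leviMap p q n) := by
    rintro z hz _ ⟨f, rfl⟩
    induction f using Finsupp.induction_linear with
    | zero => simp
    | add f g hf hg =>
      rw [map_add, smul_add]
      exact add_mem hf hg
    | single k h => exact hz k h
  have key' : ∀ y : HB p q n, ∀ z ∈ LinearMap.range (leviMap p q n),
      inclB p q n 1 y • z ∈ LinearMap.range (leviMap p q n) := by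
    intro y
    apply key
    intro k h
    refine ⟨Finsupp.single k (y * h), ?_⟩
    rw [leviMap_single, leviMap_single, map_mul, ← mul_assoc, ← mul_assoc]
    congr 1
    exact (Commute.units_zpow_right (u := uX p q (n + 1) (n + 1)) (commute_inclB_gX y) k).symm.eq
  refine ⟨fun k hk y hy => ?_, fun j w hw => ?_⟩
  · rw [← inclB_gT hk]
    exact key' _ y hy
  · rcases Nat.lt_trichotomy j (n + 1) with h | rfl | h
    · rw [← inclB_gX (by omega), ← inclB_gY (by omega)]
      exact ⟨key' _ w hw, key' _ w hw⟩
    · constructor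
      · refine key _ (fun k h => ⟨Finsupp.single (k + 1) h, ?_⟩) w hw
        rw [leviMap_single, leviMap_single, ← mul_assoc, add_comm k 1, zpow_add, zpow_one,
          Units.val_mul]
        rfl
      · refine key _ (fun k h => ⟨Finsupp.single (k - 1) h, ?_⟩) w hw
        rw [leviMap_single, leviMap_single, ← mul_assoc, sub_eq_neg_add k 1, zpow_add, zpow_neg_one,
          Units.val_mul]
        rfl
    · rw [gX, dif_neg (by omega), gY, dif_neg (by omega), one_smul]
      exact ⟨hw, hw⟩

/-- The full filtration step is a left ideal containing `1`. -/
theorem pbwMap_surjective (hp : p ≠ 0) (hq : q ≠ 0) : Function.Surjective (pbwMap p q n) := by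
  intro x
  have h0 : (1 : HB p q (n + 1)) ∈ LinearMap.range (leviMap p q n) :=
    ⟨Finsupp.single 0 1, by simp [leviMap_single]⟩
  have h1 : (1 : HB p q (n + 1)) ∈
      cosetFil p q n (LinearMap.range (leviMap p q n)) (2 * n + 2) := by
    simpa using cosetRep_smul_mem (t := 0) (m := 2 * n + 2) (by omega) h0
  have h2 := smul_mem_cosetFil hp hq leviStable_range_leviMap x _ h1
  obtain ⟨e, he, h3⟩ := exists_sum_of_mem_cosetFil h2
  choose f hf using he
  refine ⟨fun t => f t, ?_⟩
  rw [smul_eq_mul, mul_one] at h3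
  rw [pbwMap_apply, h3, ← Fin.sum_univ_eq_sum_range (fun t => cosetRep p q n t • e t)]
  simp [hf]

/-- Three separations in turn: the representatives by `eq_zero_of_sum_rho_cosetRep`, since elements
of `H_n[X_{n+1}^{±1}]` commute with `X_{n+1}`; the powers of `X_{n+1}` by scaling; the coefficients
by faithfulness for `H_n`. -/
theorem eq_zero_of_rho_pbwMap (hn : n + 1 ≤ N) (hp : p ≠ 0) (hq : q ≠ 0)
    (hqk : ∀ k : ℕ, 0 < k → q ^ k ≠ 1)
    (hinj : Function.Injective (rho (by omega : n ≤ N) hp hq (hqk 2 two_pos)))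
    {f : Fin (2 * n + 2) → ℤ →₀ HB p q n}
    (h : rho hn hp hq (hqk 2 two_pos) (pbwMap p q n f) = 0) : f = 0 := by
  set hq2 := hqk 2 two_pos
  have h0 : cosetRat F N n 0 = xRat N (n + 1) := by simp [cosetRat]
  have hlevi : ∀ g : ℤ →₀ HB p q n, rho hn hp hq hq2 (leviMap p q n g) =
      ∑ k ∈ g.support, Algebra.lmul F _ (xRat N (n + 1) ^ k) *
        rho (by omega : n ≤ N) hp hq hq2 (g k) := fun g => by
    rw [leviMap_apply, map_sum]
    refine Finset.sum_congr rfl fun k _ => ?_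
    rw [map_mul, rho_uX_zpow hn hp hq hq2 le_rfl, rho_inclB]
  let e : ℕ → Module.End F (RatField F) := fun t =>
    if ht : t < 2 * n + 2 then rho hn hp hq hq2 (leviMap p q n (f ⟨t, ht⟩)) else 0
  have he : ∀ t, e t ∈ (rightX F N (n + 1)).eigenspace (cosetRat F N n 0) := by
    intro t
    by_cases ht : t < 2 * n + 2
    · simp only [e, ht, dif_pos]
      rw [h0, hlevi]
      refine sum_mem fun k _ => ?_
      rw [mem_eigenspace_rightX]
      intro y
      have hc := congrArg (rho hn hp hq hq2) (commute_inclB_gX (f ⟨t, ht⟩ k)).eq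
      rw [map_mul, map_mul, rho_gX hn hp hq hq2 le_rfl, rho_inclB] at hc
      have hc' := LinearMap.congr_fun hc y
      rw [Module.End.mul_apply, Module.End.mul_apply, lmul_ratField_apply,
        lmul_ratField_apply] at hc'
      rw [Module.End.mul_apply, Module.End.mul_apply, lmul_ratField_apply, lmul_ratField_apply,
        hc', mul_left_comm]
    · simp only [e, ht, dif_neg, not_false_iff]
      exact zero_mem _
  have hsum : ∑ t ∈ Finset.range (2 * n + 2), rho hn hp hq hq2 (cosetRep p q n t) * e t = 0 := by
    rw [← Fin.sum_univ_eq_sum_range (fun t => rho hn hp hq hq2 (cosetRep p q n t) * e t), ← h,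
      pbwMap_apply, map_sum]
    refine Finset.sum_congr rfl fun t _ => ?_
    simp [e]
  have hz := eq_zero_of_sum_rho_cosetRep hn hp hq hq2 le_rfl he hsum
  funext t
  ext k
  have h1 := hz t t.isLt
  simp only [e, t.isLt, dif_pos] at h1
  rw [hlevi] at h1
  by_cases hk : k ∈ (f t).support
  · have h2 := eq_zero_of_sum_zpow (c := Units.mk0 q hq) hqk
      (scaleAut (Units.mk0 q hq) (n + 1, true)) (xRat_ne_zero N (n + 1))
      (scaleAut_xRat_self _ N (by omega))
      (e := fun k => rho (by omega : n ≤ N) hp hq hq2 (f t k))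
      (fun k y => scaleAut_rho _ hp hq hq2 _ _ y) h1 k hk
    exact hinj (h2.trans (map_zero _).symm)
  · simpa using hk

/-- Induction on `n` inside one fixed field: surjectivity of `pbwMap` puts every element of
`H_{n+1}` in the normal form to which `eq_zero_of_rho_pbwMap` applies. -/
theorem rho_injective (hN : 1 ≤ N) (hn : n ≤ N) (hp : p ≠ 0) (hq : q ≠ 0)
    (hqk : ∀ k : ℕ, 0 < k → q ^ k ≠ 1) :
    Function.Injective (rho hn hp hq (hqk 2 two_pos)) := by
  rw [injective_iff_map_eq_zero]
  induction n with
  | zero =>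
    intro b hb
    -- `H_0` is spanned by the powers of `X_0`. They act independently because scaling `z_{1,-}`
    -- scales `X_0`, which needs `N ≥ 1`.
    let g : (ℤ →₀ F) →ₗ[F] HB p q 0 := Finsupp.lsum F fun k =>
      LinearMap.toSpanSingleton F _ ((uX p q 0 0 ^ k : (HB p q 0)ˣ) : HB p q 0)
    have hstab : ∀ z : HB p q 0, (∀ k : ℤ, z * ((uX p q 0 0 ^ k : (HB p q 0)ˣ) : HB p q 0) ∈
        LinearMap.range g) → ∀ y ∈ LinearMap.range g, z • y ∈ LinearMap.range g := by
      rintro z hz _ ⟨f, rfl⟩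
      induction f using Finsupp.induction_linear with
      | zero => simp
      | add f g hf hg =>
        rw [map_add, smul_add]
        exact add_mem hf hg
      | single k c =>
        simp only [g, Finsupp.lsum_single, LinearMap.toSpanSingleton_apply, smul_eq_mul,
          mul_smul_comm]
        exact Submodule.smul_mem _ _ (hz k)
    have hbr : b • (1 : HB p q 0) ∈ LinearMap.range g := by
      refine smul_mem_of_generators ?_ ?_ ?_ b 1 ⟨Finsupp.single 0 1, by simp [g]⟩
      · intro i hi
        omega
      · intro j hj
        obtain rfl : j = 0 := by omega
        refine hstab _ fun k => ⟨Finsupp.single (k + 1) 1, ?_⟩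
        simp only [g, Finsupp.lsum_single, LinearMap.toSpanSingleton_apply, one_smul]
        rw [add_comm k 1, zpow_add, zpow_one, Units.val_mul]
        rfl
      · intro j hj
        obtain rfl : j = 0 := by omega
        refine hstab _ fun k => ⟨Finsupp.single (k - 1) 1, ?_⟩
        simp only [g, Finsupp.lsum_single, LinearMap.toSpanSingleton_apply, one_smul]
        rw [sub_eq_neg_add k 1, zpow_add, zpow_neg_one, Units.val_mul]
        rfl
    obtain ⟨f, hf⟩ := hbr
    rw [smul_eq_mul, mul_one] at hf
    have hg : g f = ∑ k ∈ f.support, f k • ((uX p q 0 0 ^ k : (HB p q 0)ˣ) : HB p q 0) := by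
      simp [g, Finsupp.sum]
    have h1 : ∑ k ∈ f.support, Algebra.lmul F _ (xRat N 0 ^ k) *
        (algebraMap F (Module.End F (RatField F)) (f k)) = 0 := by
      rw [← hb, ← hf, hg, map_sum]
      refine Finset.sum_congr rfl fun k _ => ?_
      rw [map_smul, rho_uX_zpow hn hp hq _ le_rfl, ← Algebra.commutes, Algebra.smul_def]
    have h2 := eq_zero_of_sum_zpow (c := Units.mk0 q hq) hqk
      (scaleAut (Units.mk0 q hq) (1, false)) (xRat_ne_zero N 0) (scaleAut_xRat_zero _ hN)
      (e := fun k => algebraMap F (Module.End F (RatField F)) (f k)) (fun k y => by simp) h1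
    have h3 : f = 0 := by
      ext k
      by_cases hk : k ∈ f.support
      · exact (algebraMap F (Module.End F (RatField F))).injective
          ((h2 k hk).trans (map_zero _).symm)
      · simpa using hk
    rw [← hf, h3, map_zero]
  | succ n ih =>
    intro b hb
    obtain ⟨f, rfl⟩ := pbwMap_surjective hp hq b
    have hinj := (injective_iff_map_eq_zero _).mpr (ih (by omega))
    rw [eq_zero_of_rho_pbwMap hn hp hq hqk hinj hb, map_zero]

theorem pbwMap_bijective (hp : p ≠ 0) (hq : q ≠ 0) (hqk : ∀ k : ℕ, 0 < k → q ^ k ≠ 1) :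
    Function.Bijective (pbwMap p q n) := by
  refine ⟨?_, pbwMap_surjective hp hq⟩
  rw [injective_iff_map_eq_zero]
  intro f hf
  exact eq_zero_of_rho_pbwMap (N := n + 1) le_rfl hp hq hqk
    (rho_injective (by omega) (by omega) hp hq hqk) (by rw [hf, map_zero])

end PBW

/-! ### Inducing from `H_n[X_{n+1}^{±1}]` to `H_{n+1}` -/

section StepInd

variable {F : Type u} [Field F] (p q : F) (n : ℕ) (a : F)
variable (E : Type w) [AddCommGroup E] [Module F E] [Module (HB p q n) E]
  [IsScalarTower F (HB p q n) E]

/-- The relations `b h ⊗ y = b ⊗ h y` for `h ∈ H_n` and `b X_{n+1} ⊗ y = a b ⊗ y`. -/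
def stepRel : Submodule (HB p q (n + 1)) (HB p q (n + 1) ⊗[F] E) :=
  Submodule.span _ ({z | ∃ (h : HB p q n) (y : E), z = inclB p q n 1 h ⊗ₜ[F] y - 1 ⊗ₜ[F] (h • y)} ∪
    {z | ∃ y : E, z = gX p q (n + 1) (n + 1) ⊗ₜ[F] y - 1 ⊗ₜ[F] (a • y)})

/-- The `H_{n+1}`-module induced from the `H_n`-module `E`, on which `X_{n+1}` acts as `a`. -/
def StepInd : Type (max u w) := (HB p q (n + 1) ⊗[F] E) ⧸ stepRel p q n a E

instance : AddCommGroup (StepInd p q n a E) :=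
  inferInstanceAs (AddCommGroup ((HB p q (n + 1) ⊗[F] E) ⧸ stepRel p q n a E))

instance : Module (HB p q (n + 1)) (StepInd p q n a E) :=
  inferInstanceAs (Module (HB p q (n + 1)) ((HB p q (n + 1) ⊗[F] E) ⧸ stepRel p q n a E))

instance : Module F (StepInd p q n a E) :=
  inferInstanceAs (Module F ((HB p q (n + 1) ⊗[F] E) ⧸ stepRel p q n a E))

instance : IsScalarTower F (HB p q (n + 1)) (StepInd p q n a E) :=
  inferInstanceAs (IsScalarTower F (HB p q (n + 1))
    ((HB p q (n + 1) ⊗[F] E) ⧸ stepRel p q n a E))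

/-- The quotient map `H_{n+1} ⊗ E → StepInd E`. -/
def stepMk : HB p q (n + 1) ⊗[F] E →ₗ[HB p q (n + 1)] StepInd p q n a E :=
  (stepRel p q n a E).mkQ

/-- The unit `E → StepInd E`. -/
def stepUnit : E →ₗ[F] StepInd p q n a E :=
  ((stepMk p q n a E).restrictScalars F).comp (TensorProduct.mk F (HB p q (n + 1)) E 1)

variable {p q n a E}

omit [IsScalarTower F (HB p q n) E] in
theorem stepMk_tmul (b : HB p q (n + 1)) (y : E) :
    stepMk p q n a E (b ⊗ₜ[F] y) = b • stepUnit p q n a E y := by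
  change _ = b • stepMk p q n a E (1 ⊗ₜ[F] y)
  rw [← map_smul, TensorProduct.smul_tmul', smul_eq_mul, mul_one]

omit [IsScalarTower F (HB p q n) E] in
theorem stepUnit_smul (h : HB p q n) (y : E) :
    stepUnit p q n a E (h • y) = inclB p q n 1 h • stepUnit p q n a E y := by
  rw [← stepMk_tmul]
  symm
  rw [← sub_eq_zero]
  change stepMk p q n a E _ - stepMk p q n a E (1 ⊗ₜ[F] (h • y)) = 0
  rw [← map_sub]
  exact (Submodule.Quotient.mk_eq_zero _).mpr (Submodule.subset_span (Or.inl ⟨h, y, rfl⟩))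

omit [IsScalarTower F (HB p q n) E] in
theorem gX_smul_stepUnit (y : E) :
    gX p q (n + 1) (n + 1) • stepUnit p q n a E y = a • stepUnit p q n a E y := by
  rw [← stepMk_tmul, ← map_smul, ← sub_eq_zero]
  change stepMk p q n a E _ - stepMk p q n a E (1 ⊗ₜ[F] (a • y)) = 0
  rw [← map_sub]
  exact (Submodule.Quotient.mk_eq_zero _).mpr (Submodule.subset_span (Or.inr ⟨y, rfl⟩))

omit [IsScalarTower F (HB p q n) E] in
theorem span_range_stepUnit :
    Submodule.span (HB p q (n + 1)) (Set.range (stepUnit p q n a E)) = ⊤ := by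
  rw [eq_top_iff]
  rintro x -
  obtain ⟨x, rfl⟩ : ∃ z, stepMk p q n a E z = x := Submodule.mkQ_surjective _ x
  induction x using TensorProduct.induction_on with
  | zero => simp
  | tmul b y =>
    rw [stepMk_tmul]
    exact Submodule.smul_mem _ _ (Submodule.subset_span ⟨y, rfl⟩)
  | add x y hx hy =>
    rw [map_add]
    exact add_mem hx hy

omit [IsScalarTower F (HB p q n) E] in
theorem exists_stepInd_lift {V : Type*} [AddCommGroup V] [Module F V] [Module (HB p q (n + 1)) V]
    [IsScalarTower F (HB p q (n + 1)) V] (f : E →ₗ[F] V)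
    (hf : ∀ (h : HB p q n) y, f (h • y) = inclB p q n 1 h • f y)
    (hf' : ∀ y, gX p q (n + 1) (n + 1) • f y = a • f y) :
    ∃ g : StepInd p q n a E →ₗ[HB p q (n + 1)] V, ∀ y, g (stepUnit p q n a E y) = f y := by
  let g₀ : HB p q (n + 1) ⊗[F] E →ₗ[HB p q (n + 1)] V :=
    TensorProduct.AlgebraTensorModule.lift
      { toFun := fun b => (Algebra.lsmul F F V b).comp f
        map_add' := fun b b' => by
          ext y
          simp
        map_smul' := fun b b' => by
          ext y
          simp }
  have hg₀ : ∀ b y, g₀ (b ⊗ₜ[F] y) = b • f y := fun b y => rfl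
  refine ⟨(stepRel p q n a E).liftQ g₀ ?_, fun y => ?_⟩
  · rw [stepRel, Submodule.span_le]
    rintro _ (⟨h, y, rfl⟩ | ⟨y, rfl⟩)
    · change g₀ _ = 0
      rw [map_sub, hg₀, hg₀, one_smul, hf, sub_self]
    · change g₀ _ = 0
      rw [map_sub, hg₀, hg₀, one_smul, map_smul, hf', sub_self]
  · exact (hg₀ 1 y).trans (one_smul _ _)

/-! #### Coordinates -/

theorem pbw_induction (hp : p ≠ 0) (hq : q ≠ 0) {P : HB p q (n + 1) → Prop} (h0 : P 0)
    (hadd : ∀ x y, P x → P y → P (x + y))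
    (hs : ∀ (t : Fin (2 * n + 2)) (k : ℤ) (h : HB p q n), P (cosetRep p q n t *
      (((uX p q (n + 1) (n + 1) ^ k : (HB p q (n + 1))ˣ) : HB p q (n + 1)) * inclB p q n 1 h)))
    (b : HB p q (n + 1)) : P b := by
  obtain ⟨f, rfl⟩ := pbwMap_surjective hp hq b
  rw [pbwMap_apply]
  refine Finset.sum_induction _ P hadd h0 fun t _ => ?_
  rw [leviMap_apply, Finset.mul_sum]
  exact Finset.sum_induction _ P hadd h0 fun k _ => hs t k _

section

variable (hp : p ≠ 0) (hq : q ≠ 0) (hqk : ∀ k : ℕ, 0 < k → q ^ k ≠ 1) (ha : a ≠ 0)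

variable (a E) in
/-- The coefficient of `D_t`, as a map `H_{n+1} ⊗ E → E`. -/
def coord (t : Fin (2 * n + 2)) : HB p q (n + 1) ⊗[F] E →ₗ[F] E :=
  TensorProduct.lift
    (((Finsupp.lsum F fun k : ℤ => a ^ k • (Algebra.lsmul F F E (A := HB p q n)).toLinearMap).comp
      (LinearMap.proj t)).comp
      (LinearEquiv.ofBijective _ (pbwMap_bijective (n := n) hp hq hqk)).symm.toLinearMap)

theorem coord_tmul (s t : Fin (2 * n + 2)) (k : ℤ) (h : HB p q n) (y : E) :
    coord a E hp hq hqk s ((cosetRep p q n t *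
      (((uX p q (n + 1) (n + 1) ^ k : (HB p q (n + 1))ˣ) : HB p q (n + 1)) *
        inclB p q n 1 h)) ⊗ₜ[F] y) = if t = s then a ^ k • h • y else 0 := by
  rw [← pbwMap_single, coord, TensorProduct.lift.tmul]
  have h1 : (LinearEquiv.ofBijective _ (pbwMap_bijective (n := n) hp hq hqk)).symm
      (pbwMap p q n (Pi.single t (Finsupp.single k h))) = Pi.single t (Finsupp.single k h) := by
    rw [LinearEquiv.symm_apply_eq]
    rfl
  simp only [LinearMap.comp_apply, LinearEquiv.coe_coe, h1, LinearMap.proj_apply]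
  split_ifs with hts
  · subst hts
    simp
  · rw [Pi.single_eq_of_ne (Ne.symm hts)]
    simp

/-- In normal form, right multiplication by `H_n` only changes the last factor. This and
`coord_mul_gX` make the coordinates descend to `StepInd`. -/
theorem coord_mul_inclB (s : Fin (2 * n + 2)) (b : HB p q (n + 1)) (h : HB p q n) (y : E) :
    coord a E hp hq hqk s ((b * inclB p q n 1 h) ⊗ₜ[F] y) =
      coord a E hp hq hqk s (b ⊗ₜ[F] (h • y)) := by
  induction b using pbw_induction hp hq with
  | h0 => simp
  | hadd b b' hb hb' => rw [add_mul, TensorProduct.add_tmul, TensorProduct.add_tmul, map_add,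
      map_add, hb, hb']
  | hs t k h' =>
    rw [mul_assoc, mul_assoc, ← map_mul, coord_tmul, coord_tmul, mul_smul]

include ha in
theorem coord_mul_gX (s : Fin (2 * n + 2)) (b : HB p q (n + 1)) (y : E) :
    coord a E hp hq hqk s ((b * gX p q (n + 1) (n + 1)) ⊗ₜ[F] y) =
      coord a E hp hq hqk s (b ⊗ₜ[F] (a • y)) := by
  induction b using pbw_induction hp hq with
  | h0 => simp
  | hadd b b' hb hb' => rw [add_mul, TensorProduct.add_tmul, TensorProduct.add_tmul, map_add,
      map_add, hb, hb']
  | hs t k h' =>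
    have h1 : ((uX p q (n + 1) (n + 1) ^ k : (HB p q (n + 1))ˣ) : HB p q (n + 1)) *
        gX p q (n + 1) (n + 1) =
        ((uX p q (n + 1) (n + 1) ^ (k + 1) : (HB p q (n + 1))ˣ) : HB p q (n + 1)) := by
      rw [zpow_add, zpow_one, Units.val_mul]
      rfl
    rw [mul_assoc, mul_assoc, (commute_inclB_gX h').eq, ← mul_assoc _ (gX p q (n + 1) (n + 1)), h1,
      coord_tmul, coord_tmul]
    split_ifs
    · rw [zpow_add₀ ha, zpow_one, mul_smul, smul_comm h' a]
    · rfl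

include ha in
theorem coord_eq_zero_of_mem (s : Fin (2 * n + 2)) {z : HB p q (n + 1) ⊗[F] E}
    (hz : z ∈ stepRel p q n a E) : coord a E hp hq hqk s z = 0 := by
  -- The coordinates are not `H_{n+1}`-linear, so the induction over the span must treat all left
  -- multiples together.
  suffices ∀ b : HB p q (n + 1), coord a E hp hq hqk s (b • z) = 0 by
    simpa using this 1
  induction hz using Submodule.span_induction with
  | mem z hz =>
    intro b
    rcases hz with ⟨h, y, rfl⟩ | ⟨y, rfl⟩
    · rw [smul_sub, TensorProduct.smul_tmul', TensorProduct.smul_tmul', map_sub, smul_eq_mul,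
        smul_eq_mul, mul_one, coord_mul_inclB, sub_self]
    · rw [smul_sub, TensorProduct.smul_tmul', TensorProduct.smul_tmul', map_sub, smul_eq_mul,
        smul_eq_mul, mul_one, coord_mul_gX hp hq hqk ha, sub_self]
  | zero => simp
  | add x y _ _ hx hy =>
    intro b
    rw [smul_add, map_add, hx, hy, add_zero]
  | smul c x _ hx =>
    intro b
    rw [smul_smul]
    exact hx _

include hp hq hqk ha in
-- The coordinates recover each `e_t`: the sum of the `D_t E` is direct, and each `D_t` is injective
-- on `E`.
theorem eq_zero_of_sum_cosetRep_smul_stepUnit {e : ℕ → E}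
    (h : ∑ t ∈ Finset.range (2 * n + 2), cosetRep p q n t • stepUnit p q n a E (e t) = 0) :
    ∀ t < 2 * n + 2, e t = 0 := by
  intro s hs
  simp only [← stepMk_tmul, ← map_sum] at h
  have h1 := coord_eq_zero_of_mem hp hq hqk ha ⟨s, hs⟩ ((Submodule.Quotient.mk_eq_zero _).mp h)
  have h2 : ∀ t : Fin (2 * n + 2), coord a E hp hq hqk ⟨s, hs⟩ (cosetRep p q n t ⊗ₜ[F] e t) =
      if t = ⟨s, hs⟩ then e t else 0 := fun t => by
    have := coord_tmul (a := a) hp hq hqk ⟨s, hs⟩ t 0 1 (e t)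
    simpa using this
  rw [← Fin.sum_univ_eq_sum_range (fun t => cosetRep p q n t ⊗ₜ[F] e t), map_sum] at h1
  simpa [h2] using h1

include hp hq hqk ha in
theorem stepUnit_injective : Function.Injective (stepUnit p q n a E) := by
  rw [injective_iff_map_eq_zero]
  intro y hy
  have := eq_zero_of_sum_cosetRep_smul_stepUnit (n := n) hp hq hqk ha
    (e := (Pi.single 0 y : ℕ → E)) (by
    refine Finset.sum_eq_zero fun t _ => ?_
    rcases eq_or_ne t 0 with rfl | ht
    · simp [hy]
    · simp [Pi.single_eq_of_ne ht]) 0 (by omega)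
  simpa using this

end

/-! #### The image of the unit -/

theorem inv_smul_of_smul {V : Type*} [AddCommGroup V] [Module F V] [Module (HB p q n) V]
    [IsScalarTower F (HB p q n) V] (ha : a ≠ 0) {j : ℕ} {v : V} (h : gX p q n j • v = a • v) :
    gY p q n j • v = a⁻¹ • v := by
  have h1 : gY p q n j • gX p q n j • v = v := by rw [smul_smul, gY_mul_gX, one_smul]
  rw [h, smul_comm] at h1
  rw [eq_inv_smul_iff₀ ha, h1]

omit [IsScalarTower F (HB p q n) E] in
theorem leviStable_range {V : Type*} [AddCommGroup V] [Module F V] [Module (HB p q (n + 1)) V]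
    [IsScalarTower F (HB p q (n + 1)) V] (ha : a ≠ 0) {f : E →ₗ[F] V}
    (hf : ∀ (h : HB p q n) y, f (h • y) = inclB p q n 1 h • f y)
    (hf' : ∀ y, gX p q (n + 1) (n + 1) • f y = a • f y) :
    LeviStable p q n (LinearMap.range f) := by
  constructor
  · rintro k hk _ ⟨y, rfl⟩
    rw [← inclB_gT hk, ← hf]
    exact ⟨_, rfl⟩
  · rintro j _ ⟨y, rfl⟩
    rcases Nat.lt_trichotomy j (n + 1) with h | rfl | h
    · rw [← inclB_gX (by omega), ← inclB_gY (by omega), ← hf, ← hf]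
      exact ⟨⟨_, rfl⟩, ⟨_, rfl⟩⟩
    · rw [inv_smul_of_smul ha (hf' y), hf', ← map_smul, ← map_smul]
      exact ⟨⟨_, rfl⟩, ⟨_, rfl⟩⟩
    · rw [gX, dif_neg (by omega), gY, dif_neg (by omega), one_smul]
      exact ⟨⟨_, rfl⟩, ⟨_, rfl⟩⟩

omit [IsScalarTower F (HB p q n) E] in
theorem cosetFil_range_stepUnit (hp : p ≠ 0) (hq : q ≠ 0) (ha : a ≠ 0) :
    cosetFil p q n (LinearMap.range (stepUnit p q n a E)) (2 * n + 2) = ⊤ := by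
  rw [eq_top_iff]
  rintro x -
  have h1 : LeviStable p q n (LinearMap.range (stepUnit p q n a E)) :=
    leviStable_range ha stepUnit_smul gX_smul_stepUnit
  have hx : x ∈ Submodule.span (HB p q (n + 1)) (Set.range (stepUnit p q n a E)) := by
    rw [span_range_stepUnit]
    trivial
  induction hx using Submodule.span_induction with
  | mem x hx =>
    have := cosetRep_smul_mem (t := 0) (m := 2 * n + 2) (p := p) (q := q) (n := n) (by omega)
      (show x ∈ LinearMap.range (stepUnit p q n a E) from hx)
    simpa using this
  | zero => exact zero_mem _
  | add x y _ _ hx hy => exact add_mem hx hy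
  | smul b x _ hx => exact smul_mem_cosetFil hp hq h1 b x hx

omit [IsScalarTower F (HB p q n) E] in
theorem finiteDimensional_stepInd (hp : p ≠ 0) (hq : q ≠ 0) (ha : a ≠ 0)
    [FiniteDimensional F E] : FiniteDimensional F (StepInd p q n a E) := by
  have h1 : ∀ m, FiniteDimensional F
      (cosetFil p q n (LinearMap.range (stepUnit p q n a E)) m) := by
    intro m
    induction m with
    | zero => exact inferInstanceAs (FiniteDimensional F (⊥ : Submodule F (StepInd p q n a E)))
    | succ m ih =>
      exact Submodule.finiteDimensional_sup _ _
  have h2 := h1 (2 * n + 2)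
  rw [cosetFil_range_stepUnit hp hq ha] at h2
  exact Module.Finite.equiv (Submodule.topEquiv (R := F) (M := StepInd p q n a E))

end StepInd

/-! ### Eigenvectors in the one-step induced module -/

section StepInd

variable {F : Type u} [Field F] {p q : F} {n : ℕ} {a : F}
variable {E : Type w} [AddCommGroup E] [Module F E] [Module (HB p q n) E]
  [IsScalarTower F (HB p q n) E]

omit [IsScalarTower F (HB p q n) E] in
theorem leviStable_range_stepUnit (ha : a ≠ 0) :
    LeviStable p q n (LinearMap.range (stepUnit p q n a E)) :=
  leviStable_range ha stepUnit_smul gX_smul_stepUnit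

omit [IsScalarTower F (HB p q n) E] in
theorem gX_smul_stepUnit_of_le {l : ℕ} (hl : l ≤ n) (y : E) :
    gX p q (n + 1) l • stepUnit p q n a E y = stepUnit p q n a E (gX p q n l • y) := by
  rw [stepUnit_smul, inclB_gX hl]

omit [IsScalarTower F (HB p q n) E] in
theorem cosetRep_smul_sub_mem {t : ℕ} {E' : Submodule F (StepInd p q n a E)} {y y' : E}
    {z : StepInd p q n a E}
    (h : z - cosetRep p q n t • stepUnit p q n a E y ∈ cosetFil p q n E' t)
    (h' : z - cosetRep p q n t • stepUnit p q n a E y' ∈ cosetFil p q n E' t) :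
    cosetRep p q n t • stepUnit p q n a E (y - y') ∈ cosetFil p q n E' t := by
  have := sub_mem h' h
  rwa [sub_sub_sub_cancel_left, ← smul_sub, ← map_sub] at this

variable (hp : p ≠ 0) (hq : q ≠ 0) (hqk : ∀ k : ℕ, 0 < k → q ^ k ≠ 1) (ha : a ≠ 0)

include hp hq hqk ha

theorem eq_zero_of_cosetRep_smul_mem {t : ℕ} (ht : t < 2 * n + 2) {y : E}
    (h : cosetRep p q n t • stepUnit p q n a E y ∈
      cosetFil p q n (LinearMap.range (stepUnit p q n a E)) t) : y = 0 := by
  obtain ⟨e, he, hsum⟩ := exists_sum_of_mem_cosetFil h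
  choose e' he' using he
  have h1 := eq_zero_of_sum_cosetRep_smul_stepUnit (n := n) hp hq hqk ha
    (e := fun s => if s < t then e' s else if s = t then -y else 0) (by
      rw [← Finset.sum_subset (Finset.range_subset_range.mpr (show t + 1 ≤ 2 * n + 2 by omega)),
        Finset.sum_range_succ, Finset.sum_congr rfl (g := fun s => cosetRep p q n s • e s), ← hsum]
      · simp
      · intro s hs
        rw [if_pos (Finset.mem_range.mp hs), he']
      · intro s _ hs
        simp only [Finset.mem_range, not_lt] at hs
        rw [if_neg (by omega), if_neg (by omega)]
        simp) t ht
  simpa using h1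

/-- Write `x = z + D_{t+1} e` with `z` in the previous step and let `j` be the position to which
`D_{t+1}` moves the last coordinate. Comparing leading terms in `X_l x = a x` gives `e = 0` in three
cases: `j ≤ n'`; `j > n'` with `a` not inverted; `j > n'` with `a` inverted. -/
theorem mem_cosetFil_of_eigenvector {n' : ℕ} (ha2 : a ^ 2 ≠ 1)
    (hE : 1 ≤ n' → ∀ e : E, (∀ l, n' ≤ l → l ≤ n → gX p q n l • e = a • e) → e = 0)
    {x : StepInd p q n a E}
    (hx : ∀ l, n' < l → l ≤ n + 1 → gX p q (n + 1) l • x = a • x) {t : ℕ} (ht : t + 1 < 2 * n + 2)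
    (hxt : x ∈ cosetFil p q n (LinearMap.range (stepUnit p q n a E)) (t + 1 + 1)) :
    x ∈ cosetFil p q n (LinearMap.range (stepUnit p q n a E)) (t + 1) := by
  have hS := leviStable_range_stepUnit (p := p) (q := q) (n := n) (E := E) ha
  have hX : ∀ y ∈ LinearMap.range (stepUnit p q n a E), gX p q (n + 1) (n + 1) • y = a • y := by
    rintro _ ⟨y, rfl⟩
    exact gX_smul_stepUnit y
  have hst : ∀ {m : ℕ}, m ≤ 2 * n + 2 → ∀ {z : StepInd p q n a E} (l : ℕ),
      z ∈ cosetFil p q n (LinearMap.range (stepUnit p q n a E)) m →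
      gX p q (n + 1) l • z - a • z ∈ cosetFil p q n (LinearMap.range (stepUnit p q n a E)) m :=
    fun hm z l hz => sub_mem (cosetFil_xStable hp hq hS hm l _ hz).1 (Submodule.smul_mem _ _ hz)
  obtain ⟨z, hz, _, ⟨_, ⟨e, rfl⟩, rfl⟩, rfl⟩ := Submodule.mem_sup.mp hxt
  suffices e = 0 by simpa [this] using hz
  obtain ⟨hlt, heq, hgt⟩ := leadingTerms ha hX hp hq hS (t := t + 1) (by omega)
  have hD : ∀ l, n' < l → l ≤ n + 1 →
      gX p q (n + 1) l • cosetRep p q n (t + 1) • stepUnit p q n a E e -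
        cosetRep p q n (t + 1) • stepUnit p q n a E (a • e) ∈
      cosetFil p q n (LinearMap.range (stepUnit p q n a E)) (t + 1) := by
    intro l h1 h2
    have h3 := hx l h1 h2
    have h4 := hst (by omega) l hz
    rw [smul_add, smul_add, ← sub_eq_zero, add_sub_add_comm] at h3
    rw [eq_neg_of_add_eq_zero_left h3, Algebra.lsmul_coe] at h4
    rw [map_smul, smul_comm _ a]
    simpa only [neg_mem_iff] using h4
  -- Beyond position `j`, `X_{l+1}` acts on `D_{t+1} e` to leading order as `X_l` acts on `e`.
  have hgt' : ∀ l, n' ≤ l → l ≤ n → (if t + 1 ≤ n then n + 1 - (t + 1) else t + 1 - n) ≤ l →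
      gX p q n l • e = a • e := by
    intro l h1 h2 h3
    have h4 := hgt l h2 h3 _ ⟨e, rfl⟩
    rw [gX_smul_stepUnit_of_le h2] at h4
    exact sub_eq_zero.mp (eq_zero_of_cosetRep_smul_mem hp hq hqk ha (by omega)
      (cosetRep_smul_sub_mem h4 (hD (l + 1) (by omega) (by omega))))
  by_cases hk : (if t + 1 ≤ n then n + 1 - (t + 1) else t + 1 - n) ≤ n'
  -- If `j ≤ n'`, then `e` is an eigenvector of all of `X_{n'}, …, X_n`; moreover `j ≥ 1` gives `n'
  -- ≥ 1`, so `hE` applies.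
  · refine hE ?_ e fun l h1 h2 => hgt' l h1 h2 (hk.trans h1)
    split_ifs at hk <;> omega
  rw [not_le] at hk
  by_cases htn : t + 1 ≤ n
  · rw [if_pos htn] at hk
    -- Here `j = n - t` and all leading eigenvalues equal `a`, so the next order is needed: the
    -- `D_t`-component of `(X_{j+1} - a) x = 0`.
    have hke : gX p q n (n - t) • e = a • e := by
      refine hgt' _ (by omega) (by omega) ?_
      rw [if_pos htn]
      omega
    obtain ⟨z', hz', _, ⟨_, ⟨e', rfl⟩, rfl⟩, rfl⟩ := Submodule.mem_sup.mp hz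
    obtain ⟨-, heq, -⟩ := leadingTerms ha hX hp hq hS (t := t) (by omega)
    rw [if_pos (by omega), if_pos (by omega)] at heq
    have hk1 : n + 1 - t = n - t + 1 := by omega
    rw [hk1] at heq
    have hcomm : gX p q (n + 1) (n - t) * cosetRep p q n t =
        cosetRep p q n t * gX p q (n + 1) (n - t) := by
      have : ∀ s ≤ t, Commute (gX p q (n + 1) (n - t)) (cosetRep p q n s) := by
        intro s hs
        induction s with
        | zero => exact Commute.one_right _
        | succ s ih =>
          rw [cosetRep_succ_of_le (by omega)]
          exact (gT_gX_comm (by omega) (by omega)).symm.mul_right (ih (by omega))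
      exact (this t le_rfl).eq
    have hDu : gX p q (n + 1) (n - t) • cosetRep p q n t • stepUnit p q n a E e =
        a • cosetRep p q n t • stepUnit p q n a E e := by
      rw [smul_smul, hcomm, mul_smul, gX_smul_stepUnit_of_le (by omega), hke, LinearMap.map_smul,
        smul_comm (cosetRep p q n t) a]
    have h1 : gX p q (n + 1) (n - t + 1) • cosetRep p q n (t + 1) • stepUnit p q n a E e =
        a • cosetRep p q n (t + 1) • stepUnit p q n a E e +
          qc p q (n - t) • gX p q (n + 1) (n - t + 1) • cosetRep p q n t • stepUnit p q n a E e := by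
      have h0 : cosetRep p q n (t + 1) • stepUnit p q n a E e =
          gT p q (n + 1) (n - t) • cosetRep p q n t • stepUnit p q n a E e := by
        rw [cosetRep_succ_of_le (by omega), mul_smul]
      rw [h0, smul_smul (gX p q (n + 1) (n - t + 1)),
        gX_succ_mul_gT hp hq (by omega) (by omega), add_smul, mul_smul, hDu,
        smul_comm (gT p q (n + 1) (n - t)) a, smul_assoc]
    have h2 : gX p q (n + 1) (n - t + 1) • (z' + cosetRep p q n t • stepUnit p q n a E e' +
        cosetRep p q n (t + 1) • stepUnit p q n a E e) =
        a • (z' + cosetRep p q n t • stepUnit p q n a E e' +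
        cosetRep p q n (t + 1) • stepUnit p q n a E e) := hx (n - t + 1) (by omega) (by omega)
    rw [smul_add (gX p q (n + 1) (n - t + 1)), smul_add (gX p q (n + 1) (n - t + 1)), h1,
      smul_add a, smul_add a, ← sub_eq_zero] at h2
    -- `X_{j+1}` has leading eigenvalue `a` on `D_t E`, so the `D_t e'` part of `x` contributes
    -- nothing at this order. What remains is the Jordan term `c a e` with `c = q - q⁻¹`, as `j ≥
    -- 1`.
    have h3 : cosetRep p q n t • stepUnit p q n a E ((qc p q (n - t) * a) • e) ∈
        cosetFil p q n (LinearMap.range (stepUnit p q n a E)) t := by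
      have h4 := Submodule.smul_mem _ (qc p q (n - t)) (heq _ ⟨e, rfl⟩)
      have h5 := heq _ ⟨e', rfl⟩
      have h6 := hst (by omega) (n - t + 1) hz'
      have h7 := add_mem (add_mem h4 h5) h6
      rw [← neg_mem_iff]
      convert h7 using 1
      rw [LinearMap.map_smul, smul_comm (cosetRep p q n t), mul_smul, smul_sub, ← sub_eq_zero,
        ← neg_eq_zero, ← h2]
      abel
    have h4 := eq_zero_of_cosetRep_smul_mem hp hq hqk ha (by omega) h3
    refine (smul_eq_zero.mp h4).resolve_left (mul_ne_zero ?_ ha)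
    rw [qc, if_neg (by omega), sub_ne_zero]
    intro h5
    refine hqk 2 (by omega) ?_
    rw [sq]
    nth_rewrite 2 [h5]
    exact mul_inv_cancel₀ hq
  · rw [if_neg htn] at hk heq
    rw [if_neg htn] at heq
    -- In the inverted case `X_j` acts on the leading term both as `a⁻¹` and as `a`.
    have h1 := heq _ ⟨e, rfl⟩
    rw [smul_comm a⁻¹ (cosetRep p q n (t + 1)), ← LinearMap.map_smul] at h1
    have h2 := eq_zero_of_cosetRep_smul_mem hp hq hqk ha (by omega)
      (cosetRep_smul_sub_mem h1 (hD _ hk (by omega)))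
    rw [← sub_smul] at h2
    refine (smul_eq_zero.mp h2).resolve_left (sub_ne_zero.mpr fun h3 => ha2 ?_)
    rw [sq]
    nth_rewrite 1 [← h3]
    exact inv_mul_cancel₀ ha

/-- Descend from the full filtration to its first step `D_0 E = E`. -/
theorem mem_range_stepUnit_of_eigenvector {n' : ℕ} (ha2 : a ^ 2 ≠ 1)
    (hE : 1 ≤ n' → ∀ e : E, (∀ l, n' ≤ l → l ≤ n → gX p q n l • e = a • e) → e = 0)
    {x : StepInd p q n a E}
    (hx : ∀ l, n' < l → l ≤ n + 1 → gX p q (n + 1) l • x = a • x) :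
    x ∈ LinearMap.range (stepUnit p q n a E) := by
  have h : ∀ s ≤ 2 * n + 1,
      x ∈ cosetFil p q n (LinearMap.range (stepUnit p q n a E)) (2 * n + 1 - s + 1) := by
    intro s hs
    induction s with
    | zero =>
      change x ∈ cosetFil p q n _ (2 * n + 2)
      rw [cosetFil_range_stepUnit hp hq ha]
      trivial
    | succ s ih =>
      refine mem_cosetFil_of_eigenvector hp hq hqk ha ha2 hE hx (by omega) ?_
      have := ih (by omega)
      rwa [show 2 * n + 1 - s + 1 = 2 * n + 1 - (s + 1) + 1 + 1 by omega] at this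
  have h1 := h (2 * n + 1) le_rfl
  rw [Nat.sub_self] at h1
  obtain ⟨z, hz, _, ⟨y, hy, rfl⟩, rfl⟩ := Submodule.mem_sup.mp h1
  rw [(Submodule.mem_bot F).mp hz]
  simpa using hy

end StepInd

/-! ### Iterated induction -/

section LeviHom

variable {F : Type u} [Field F]

/-- A linear map `f` from an `H_k`-module to an `H_n`-module that is a homomorphism for the
subalgebra of `H_n` generated by `H_k` and the `X_l` with `k < l ≤ n`, these `X_l` acting as `a`
on the source. -/
structure IsLeviHom (p q : F) (k n : ℕ) (a : F) {K V : Type*} [AddCommGroup K] [Module F K]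
    [Module (HB p q k) K] [AddCommGroup V] [Module F V] [Module (HB p q n) V] (f : K →ₗ[F] V) :
    Prop where
  T : ∀ i < k, ∀ y, f (gT p q k i • y) = gT p q n i • f y
  X : ∀ j ≤ k, ∀ y, f (gX p q k j • y) = gX p q n j • f y
  eigen : ∀ l, k < l → l ≤ n → ∀ y, gX p q n l • f y = a • f y

/-- The universal map `ι` from the `H_k`-module `K` to an induced `H_n`-module, with a description
of the joint `a`-eigenspace of the `X_l`, `k < l ≤ n`. -/
structure IsLeviInd (p q : F) (k n : ℕ) (a : F) {K M : Type*} [AddCommGroup K] [Module F K]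
    [Module (HB p q k) K] [AddCommGroup M] [Module F M] [Module (HB p q n) M] (ι : K →ₗ[F] M) :
    Prop extends IsLeviHom p q k n a ι where
  injective : Function.Injective ι
  span_range : Submodule.span (HB p q n) (Set.range ι) = ⊤
  lift : ∀ (V : Type w) [AddCommGroup V] [Module F V] [Module (HB p q n) V]
    [IsScalarTower F (HB p q n) V] (f : K →ₗ[F] V), IsLeviHom p q k n a f →
    ∃ g : M →ₗ[HB p q n] V, ∀ y, g (ι y) = f y
  mem_range : (1 ≤ k → ∀ y : K, gX p q k k • y = a • y → y = 0) →
    ∀ x : M, (∀ l, k < l → l ≤ n → gX p q n l • x = a • x) → x ∈ LinearMap.range ι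

variable {p q : F} {k n : ℕ} {a : F} {K V : Type*} [AddCommGroup K] [Module F K]
  [Module (HB p q k) K] [AddCommGroup V] [Module F V] [Module (HB p q n) V]

theorem IsLeviHom.Y {f : K →ₗ[F] V} (hf : IsLeviHom p q k n a f) {j : ℕ} (hj : j ≤ k) (y : K) :
    f (gY p q k j • y) = gY p q n j • f y := by
  have h := hf.X j hj (gY p q k j • y)
  rw [smul_smul, gX_mul_gY, one_smul] at h
  rw [h, smul_smul, gY_mul_gX, one_smul]

theorem IsLeviHom.smul {j : ℕ} {V : Type*} [AddCommGroup V] [Module F V]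
    [Module (HB p q (k + j)) V] [IsScalarTower F (HB p q k) K] [IsScalarTower F (HB p q (k + j)) V]
    {f : K →ₗ[F] V}
    (hf : IsLeviHom p q k (k + j) a f) (h : HB p q k) (y : K) :
    f (h • y) = inclB p q k j h • f y := by
  induction h using HB.induction_on generalizing y with
  | halg r => simp
  | hT i hi => rw [hf.T i hi, inclB_gT hi]
  | hX i hi => rw [hf.X i hi, inclB_gX hi]
  | hY i hi => rw [hf.Y hi, inclB_gY hi]
  | hmul x x' hx hx' => rw [mul_smul, hx, hx', map_mul, mul_smul]
  | hadd x x' hx hx' => rw [add_smul, map_add, hx, hx', map_add, add_smul]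

theorem isLeviHom_of_smul {j : ℕ} {V : Type*} [AddCommGroup V] [Module F V]
    [Module (HB p q (k + j)) V] {f : K →ₗ[F] V}
    (hf : ∀ (h : HB p q k) y, f (h • y) = inclB p q k j h • f y)
    (hf' : ∀ l, k < l → l ≤ k + j → ∀ y, gX p q (k + j) l • f y = a • f y) :
    IsLeviHom p q k (k + j) a f :=
  ⟨fun i hi y => by rw [hf, inclB_gT hi], fun i hi y => by rw [hf, inclB_gX hi], hf'⟩

theorem IsLeviHom.comp {n' : ℕ} {V' : Type*} [AddCommGroup V'] [Module F V'] [Module (HB p q n') V']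
    {f : K →ₗ[F] V} {g : V →ₗ[F] V'} (hg : IsLeviHom p q n n' a g) (hf : IsLeviHom p q k n a f)
    (hkn : k ≤ n) : IsLeviHom p q k n' a (g.comp f) where
  T i hi y := by rw [LinearMap.comp_apply, hf.T i hi, hg.T i (by omega), LinearMap.comp_apply]
  X i hi y := by rw [LinearMap.comp_apply, hf.X i hi, hg.X i (by omega), LinearMap.comp_apply]
  eigen l hl hl' y := by
    rcases Nat.lt_or_ge n l with h | h
    · exact hg.eigen l h hl' _
    · rw [LinearMap.comp_apply, ← hg.X l h, hf.eigen l hl h, map_smul]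

theorem IsLeviHom.comp_linearMap {V' : Type*} [AddCommGroup V'] [Module F V'] [Module (HB p q n) V']
    [IsScalarTower F (HB p q n) V] [IsScalarTower F (HB p q n) V']
    {f : K →ₗ[F] V} (hf : IsLeviHom p q k n a f) (g : V →ₗ[HB p q n] V') :
    IsLeviHom p q k n a ((g.restrictScalars F).comp f) where
  T i hi y := by simp [hf.T i hi]
  X i hi y := by simp [hf.X i hi]
  eigen l hl hl' y := by
    have h := congrArg g (hf.eigen l hl hl' y)
    rw [map_smul, ← algebraMap_smul (HB p q n) a (f y), map_smul, algebraMap_smul] at h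
    exact h

theorem isLeviHom_stepUnit {E : Type*} [AddCommGroup E] [Module F E] [Module (HB p q n) E] :
    IsLeviHom p q n (n + 1) a (stepUnit p q n a E) :=
  isLeviHom_of_smul stepUnit_smul fun l hl hl' => by
    obtain rfl : l = n + 1 := by omega
    exact gX_smul_stepUnit

end LeviHom

/-! ### Existence of iterated induced modules -/

section

variable {F : Type u} [Field F] {p q a : F} (hp : p ≠ 0) (hq : q ≠ 0)
  (hqk : ∀ k : ℕ, 0 < k → q ^ k ≠ 1) (ha : a ≠ 0) (ha2 : a ^ 2 ≠ 1)

include hp hq hqk ha ha2 in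
-- Iterates `StepInd`, adjoining `X_{k+1}, X_{k+2}, …` one at a time; the description of the
-- eigenspace is carried along the induction.
theorem exists_isLeviInd (k j : ℕ) (K : Type v) [AddCommGroup K] [Module F K] [Module (HB p q k) K]
    [IsScalarTower F (HB p q k) K] [FiniteDimensional F K] :
    ∃ (M : Type (max u v)) (_ : AddCommGroup M) (_ : Module F M) (_ : Module (HB p q (k + j)) M)
      (_ : IsScalarTower F (HB p q (k + j)) M) (_ : FiniteDimensional F M) (ι : K →ₗ[F] M),
      IsLeviInd.{u, w} p q k (k + j) a ι := by
  induction j with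
  | zero =>
    refine ⟨ULift.{u} K, inferInstance, inferInstance, inferInstance, ⟨fun r h x => ?_⟩,
      Module.Finite.equiv (ULift.moduleEquiv (R := F) (M := K)).symm,
      (ULift.moduleEquiv (R := F) (M := K)).symm.toLinearMap,
      ⟨fun _ _ _ => rfl, fun _ _ _ => rfl, fun l h h' => absurd (h.trans_le h') (lt_irrefl _)⟩,
      (ULift.moduleEquiv (R := F) (M := K)).symm.injective, ?_, ?_, fun _ x _ => ⟨x.down, rfl⟩⟩
    · exact congrArg ULift.up (smul_assoc r h x.down)
    · rw [eq_top_iff]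
      exact fun x _ => Submodule.subset_span ⟨x.down, rfl⟩
    · intro V _ _ _ _ f hf
      have key : ∀ (h : HB p q k) (y : K), f (h • y) = h • f y := by
        intro h y
        induction h using HB.induction_on generalizing y with
        | halg r => simp
        | hT i hi => rw [hf.T i hi]; rfl
        | hX i hi => rw [hf.X i hi]; rfl
        | hY i hi => rw [hf.Y hi]; rfl
        | hmul x x' hx hx' => rw [mul_smul, hx, hx', mul_smul]
        | hadd x x' hx hx' => rw [add_smul, map_add, hx, hx', add_smul]
      exact ⟨{ toFun := fun x => f x.down
               map_add' := fun x y => map_add f _ _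
               map_smul' := fun h x => key h x.down }, fun y => rfl⟩
  | succ j ih =>
    obtain ⟨M, _, _, _, _, _, ι, hι⟩ := ih
    refine ⟨StepInd p q (k + j) a M, inferInstance, inferInstance, inferInstance, inferInstance,
      finiteDimensional_stepInd hp hq ha, (stepUnit p q (k + j) a M).comp ι,
      isLeviHom_stepUnit.comp hι.toIsLeviHom (Nat.le_add_right k j),
      (stepUnit_injective hp hq hqk ha).comp hι.injective, ?_, ?_, ?_⟩
    · rw [eq_top_iff, ← span_range_stepUnit, Submodule.span_le]
      rintro _ ⟨x, rfl⟩
      have hx : x ∈ Submodule.span (HB p q (k + j)) (Set.range ι) := by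
        rw [hι.span_range]
        trivial
      induction hx using Submodule.span_induction with
      | mem x hx =>
        obtain ⟨y, rfl⟩ := hx
        exact Submodule.subset_span ⟨y, rfl⟩
      | zero => simp
      | add x y _ _ hx hy =>
        rw [map_add]
        exact add_mem hx hy
      | smul h x _ hx =>
        rw [stepUnit_smul]
        exact Submodule.smul_mem _ _ hx
    · intro V _ _ _ _ f hf
      let _ : Module (HB p q (k + j)) V := Module.compHom V (inclB p q (k + j) 1).toRingHom
      have hact : ∀ (h : HB p q (k + j)) (v : V), h • v = inclB p q (k + j) 1 h • v :=
        fun _ _ => rfl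
      have : IsScalarTower F (HB p q (k + j)) V := ⟨fun r h v => by
        rw [hact, hact, map_smul, smul_assoc]⟩
      obtain ⟨g, hg⟩ := hι.lift V f
        ⟨fun i hi y => by rw [hact, inclB_gT (by omega)]; exact hf.T i hi y,
          fun i hi y => by rw [hact, inclB_gX (by omega)]; exact hf.X i hi y,
          fun l hl hl' y => by rw [hact, inclB_gX hl']; exact hf.eigen l hl (by omega) y⟩
      -- The eigenvalue equation holds on the image of `K` and spreads to the `H_{k+j}`-module it
      -- generates, which commutes with `X_{k+j+1}`.
      have hgX : ∀ x, gX p q (k + j + 1) (k + j + 1) • g x = a • g x := by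
        intro x
        have hx : x ∈ Submodule.span (HB p q (k + j)) (Set.range ι) := by
          rw [hι.span_range]
          trivial
        induction hx using Submodule.span_induction with
        | mem x hx =>
          obtain ⟨y, rfl⟩ := hx
          rw [hg]
          exact hf.eigen _ (by omega) le_rfl y
        | zero => simp
        | add x y _ _ hx hy => rw [map_add, smul_add, smul_add, hx, hy]
        | smul h x _ hx =>
          rw [map_smul, hact, smul_smul, ← (commute_inclB_gX h).eq, mul_smul, hx, smul_comm]
      obtain ⟨g', hg'⟩ := exists_stepInd_lift (p := p) (q := q) (n := k + j) (a := a)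
        (g.restrictScalars F) (fun h y => g.map_smul h y) hgX
      exact ⟨g', fun y => (hg' (ι y)).trans (hg y)⟩
    · intro hK x hx
      -- Its hypothesis on `M` holds by induction: an eigenvector of `X_k, …, X_{k+j}` comes from
      -- `K`, where `X_k` has no `a`-eigenvector.
      obtain ⟨z, rfl⟩ := mem_range_stepUnit_of_eigenvector (n := k + j) hp hq hqk ha ha2
        (fun hk e he => by
          obtain ⟨y, rfl⟩ := hι.mem_range hK e fun l hl hl' => he l hl.le hl'
          have h1 := he k le_rfl (by omega)
          rw [← hι.X k le_rfl, ← map_smul] at h1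
          rw [hK hk y (hι.injective h1), map_zero]) hx
      obtain ⟨y, rfl⟩ := hι.mem_range hK z fun l hl hl' => by
        have h1 : gX p q (k + j + 1) l • stepUnit p q (k + j) a M z = _ := hx l hl (by omega)
        rw [gX_smul_stepUnit_of_le hl', ← map_smul] at h1
        exact stepUnit_injective hp hq hqk ha h1
      exact ⟨y, rfl⟩

end

/-! ### Joint eigenspaces of commuting endomorphisms -/

section Eigen

variable {F : Type*} [Field F] {A Q : Type*} [AddCommGroup A] [Module F A] [AddCommGroup Q]
  [Module F Q] {I : Type*}

theorem map_mem_maxGenEigenspace {f : Module.End F A} {g : Module.End F Q} {π : A →ₗ[F] Q}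
    (h : ∀ x, π (f x) = g (π x)) {c : F} {x : A} (hx : x ∈ f.maxGenEigenspace c) :
    π x ∈ g.maxGenEigenspace c := by
  rw [Module.End.mem_maxGenEigenspace] at hx ⊢
  obtain ⟨k, hk⟩ := hx
  refine ⟨k, ?_⟩
  have h1 : ∀ (k : ℕ) (x : A), π (((f - c • (1 : Module.End F A)) ^ k) x) =
      ((g - c • (1 : Module.End F Q)) ^ k) (π x) := by
    intro k
    induction k with
    | zero => simp
    | succ k ih =>
      intro x
      rw [pow_succ, pow_succ, Module.End.mul_apply, Module.End.mul_apply, ih]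
      simp [h]
  rw [← h1, hk, map_zero]

/-- `A` is the sum of its joint generalized eigenspaces. If the one for `χ` vanished, `Q` would be
the sum of those for the other characters, which is independent of the one for `χ`. -/
theorem iInf_maxGenEigenspace_ne_bot_of_surjective [IsAlgClosed F] [FiniteDimensional F A]
    {f : I → Module.End F A} {g : I → Module.End F Q} (hf : ∀ i j, Commute (f i) (f j))
    (hg : ∀ i j, Commute (g i) (g j)) {π : A →ₗ[F] Q} (hπ : Function.Surjective π)
    (h : ∀ i x, π (f i x) = g i (π x)) {χ : I → F}
    (hQ : ⨅ i, (g i).maxGenEigenspace (χ i) ≠ ⊥) : ⨅ i, (f i).maxGenEigenspace (χ i) ≠ ⊥ := by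
  intro hA
  apply hQ
  have h1 := Module.End.iSup_iInf_maxGenEigenspace_eq_top_of_iSup_maxGenEigenspace_eq_top_of_commute
    f (fun i j _ => hf i j) fun i => Module.End.iSup_maxGenEigenspace_eq_top (f i)
  have h2 := Module.End.independent_iInf_maxGenEigenspace_of_forall_mapsTo g
    fun i j c => Module.End.mapsTo_maxGenEigenspace_of_comm (hg j i) c
  have h3 : ⨆ χ' : I → F, ⨆ _ : χ' ≠ χ, ⨅ i, (g i).maxGenEigenspace (χ' i) = ⊤ := by
    rw [eq_top_iff, ← LinearMap.range_eq_top.mpr hπ, LinearMap.range_eq_map, ← h1,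
      Submodule.map_iSup]
    refine iSup_le fun χ' => ?_
    rcases eq_or_ne χ' χ with rfl | hχ
    · rw [hA, Submodule.map_bot]
      exact bot_le
    · refine le_trans ?_ (le_iSup₂_of_le χ' hχ le_rfl)
      rintro _ ⟨x, hx, rfl⟩
      simp only [SetLike.mem_coe, Submodule.mem_iInf] at hx ⊢
      exact fun i => map_mem_maxGenEigenspace (h i) (hx i)
  have h4 := h2 χ
  rw [h3, disjoint_top] at h4
  exact h4

theorem exists_joint_eigenvector [Finite I] {f : I → Module.End F A}
    (hf : ∀ i j, Commute (f i) (f j)) {χ : I → F} (h : ⨅ i, (f i).maxGenEigenspace (χ i) ≠ ⊥) :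
    ∃ x ≠ 0, ∀ i, f i x = χ i • x := by
  classical
  have := Fintype.ofFinite I
  suffices ∀ s : Finset I, ∃ x ≠ 0, (∀ i, x ∈ (f i).maxGenEigenspace (χ i)) ∧
      ∀ i ∈ s, f i x = χ i • x by
    obtain ⟨x, hx, -, hx'⟩ := this Finset.univ
    exact ⟨x, hx, fun i => hx' i (Finset.mem_univ i)⟩
  intro s
  induction s using Finset.induction_on with
  | empty =>
    obtain ⟨x, hx, hx0⟩ := (Submodule.ne_bot_iff _).mp h
    exact ⟨x, hx0, by simpa using hx, by simp⟩
  | insert j s _ ih =>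
    obtain ⟨x, hx0, hx, hxs⟩ := ih
    have hex := (Module.End.mem_maxGenEigenspace _ _ _).mp (hx j)
    have hk := Nat.find_spec hex
    -- With `k + 1` the least exponent killing `x`, the vector `(f_j - χ_j)^k x` is a nonzero
    -- eigenvector of `f_j`. By commutativity it keeps the properties already obtained for `x`.
    obtain ⟨k, hk'⟩ : ∃ k, Nat.find hex = k + 1 := by
      refine Nat.exists_eq_succ_of_ne_zero fun h0 => hx0 ?_
      rw [h0] at hk
      simpa using hk
    have hcomm : ∀ i, Commute (f i) ((f j - χ j • (1 : Module.End F A)) ^ k) := fun i =>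
      ((hf i j).sub_right ((Commute.one_right _).smul_right _)).pow_right _
    have hcomm' : ∀ i y, f i (((f j - χ j • (1 : Module.End F A)) ^ k) y) =
        ((f j - χ j • (1 : Module.End F A)) ^ k) (f i y) := fun i y =>
      LinearMap.congr_fun (hcomm i).eq y
    refine ⟨((f j - χ j • (1 : Module.End F A)) ^ k) x, Nat.find_min hex (by omega), fun i => ?_,
      fun i hi => ?_⟩
    · exact map_mem_maxGenEigenspace (fun y => (hcomm' i y).symm) (hx i)
    · rcases Finset.mem_insert.mp hi with rfl | hi
      · rw [hk', pow_succ', Module.End.mul_apply] at hk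
        simpa [sub_eq_zero] using hk
      · rw [hcomm', hxs i hi, map_smul]

end Eigen

/-! ### Generalized eigenspaces and `ε_a` -/

section Delta

variable {F : Type u} [Field F] {p q : F} {n : ℕ} {a : F}
variable {M Q : Type*} [AddCommGroup M] [Module F M] [Module (HB p q n) M]
  [IsScalarTower F (HB p q n) M] [AddCommGroup Q] [Module F Q] [Module (HB p q n) Q]
  [IsScalarTower F (HB p q n) Q]

theorem delta_antitone : Antitone fun m => Delta p q n a m M := by
  intro m m' h
  refine le_iInf₂ fun j hj => ?_
  exact iInf₂_le_of_le j (by omega) le_rfl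

theorem delta_zero : Delta p q n a 0 M = ⊤ := by
  rw [Delta, iInf₂_eq_top]
  intro j hj
  omega

theorem delta_eq_iInf_subtype (m : ℕ) : Delta p q n a m M =
    ⨅ j : {j : Fin (n + 1) // n < j.val + m},
      Module.End.maxGenEigenspace (Algebra.lsmul F F M (XB p q j.val)) a := by
  rw [Delta, iInf_subtype]

theorem commute_lsmul_XB (i j : Fin (n + 1)) :
    Commute (Algebra.lsmul F F M (XB p q i)) (Algebra.lsmul F F M (XB p q j)) := by
  have : Commute (XB p q i) (XB p q j) := X_commB i j
  exact this.map (Algebra.lsmul F F M)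

theorem delta_ne_bot_of_eigenvector {m : ℕ} {x : M} (hx : x ≠ 0)
    (h : ∀ l, n < l + m → l ≤ n → gX p q n l • x = a • x) : Delta p q n a m M ≠ ⊥ := by
  rw [Submodule.ne_bot_iff]
  refine ⟨x, ?_, hx⟩
  simp only [Delta, Submodule.mem_iInf]
  intro j hj
  apply Module.End.eigenspace_le_maxGenEigenspace
  rw [Module.End.mem_eigenspace_iff, Algebra.lsmul_coe, ← gX_fin]
  exact h j hj (by omega)

/-- Reduces vanishing of `Δ` on a quotient to the absence of genuine joint eigenvectors upstairs.
The eigenvector found in `M` need not survive in `Q`. -/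
theorem exists_eigenvector_of_delta_ne_bot [IsAlgClosed F] [FiniteDimensional F M]
    (π : M →ₗ[HB p q n] Q) (hπ : Function.Surjective π) {m : ℕ} (h : Delta p q n a m Q ≠ ⊥) :
    ∃ x : M, x ≠ 0 ∧ ∀ l, n < l + m → l ≤ n → gX p q n l • x = a • x := by
  rw [delta_eq_iInf_subtype] at h
  have h1 := iInf_maxGenEigenspace_ne_bot_of_surjective
    (f := fun j : {j : Fin (n + 1) // n < j.val + m} => Algebra.lsmul F F M (XB p q j.val))
    (g := fun j : {j : Fin (n + 1) // n < j.val + m} => Algebra.lsmul F F Q (XB p q j.val))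
    (fun i j => commute_lsmul_XB _ _) (fun i j => commute_lsmul_XB _ _)
    (π := π.restrictScalars F) hπ (fun i x => π.map_smul _ x) (χ := fun _ => a) h
  obtain ⟨x, hx, hx'⟩ := exists_joint_eigenvector (fun i j => commute_lsmul_XB _ _) h1
  refine ⟨x, hx, fun l hl hl' => ?_⟩
  have h2 := hx' ⟨⟨l, by omega⟩, hl⟩
  rwa [Algebra.lsmul_coe, ← gX_fin] at h2

theorem epsilon_eq_of {r : ℕ} (hr : r ≤ n) (h : Delta p q n a r M ≠ ⊥)
    (h' : r < n → Delta p q n a (r + 1) M = ⊥) : epsilon p q n a M = r := by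
  apply le_antisymm
  · refine csSup_le ⟨r, hr, h⟩ ?_
    rintro m ⟨hm, hm'⟩
    by_contra! hlt
    refine hm' (le_bot_iff.mp ?_)
    rw [← h' (by omega)]
    exact delta_antitone hlt
  · exact le_csSup ⟨n, fun m hm => hm.1⟩ ⟨hr, h⟩

theorem epsilon_lt_of [Nontrivial M] {r : ℕ} (h : Delta p q n a r M = ⊥) :
    epsilon p q n a M < r := by
  have h1 : epsilon p q n a M ∈ {m : ℕ | m ≤ n ∧ Delta p q n a m M ≠ ⊥} :=
    Nat.sSup_mem ⟨0, Nat.zero_le _, by rw [delta_zero]; exact top_ne_bot⟩ ⟨n, fun m hm => hm.1⟩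
  by_contra! hle
  refine h1.2 (le_bot_iff.mp ?_)
  rw [← h]
  exact delta_antitone hle

theorem epsilon_mem [Nontrivial M] :
    epsilon p q n a M ≤ n ∧ Delta p q n a (epsilon p q n a M) M ≠ ⊥ :=
  Nat.sSup_mem (s := {m : ℕ | m ≤ n ∧ Delta p q n a m M ≠ ⊥})
    ⟨0, Nat.zero_le _, by rw [delta_zero]; exact top_ne_bot⟩ ⟨n, fun m hm => hm.1⟩

theorem delta_eq_bot_of_epsilon_lt {m : ℕ} (h : epsilon p q n a M < m) (hm : m ≤ n) :
    Delta p q n a m M = ⊥ := by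
  by_contra h1
  have h2 : m ≤ epsilon p q n a M := le_csSup ⟨n, fun m hm => hm.1⟩ ⟨hm, h1⟩
  omega

end Delta

/-! ### Modules with a unique maximal submodule -/

section Cosocle

variable {A : Type*} [Ring A] {V : Type*} [AddCommGroup V] [Module A V]

/-- If `V/S` is semisimple, the image of `J` has a complement `C`. Either `C` is everything and `J ≤
S`, or the preimage of `C` is proper, hence inside `J`, which would make `J` everything. -/
theorem cosocKer_eq_of_forall_le {J : Submodule A V} (hJ : IsCoatom J)
    (h : ∀ S : Submodule A V, S ≠ ⊤ → S ≤ J) : cosocKer A V = J := by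
  apply le_antisymm
  · have := isSimpleModule_iff_isCoatom.mpr hJ
    exact sInf_le (show IsSemisimpleModule A (V ⧸ J) from inferInstance)
  · refine le_sInf fun S (hS : IsSemisimpleModule A (V ⧸ S)) => ?_
    obtain ⟨C, hC⟩ := exists_isCompl (J.map S.mkQ)
    by_cases hCt : C.comap S.mkQ = ⊤
    · have hC' : C = ⊤ := by
        rw [← Submodule.map_comap_eq_of_surjective S.mkQ_surjective C, hCt, Submodule.map_top,
          Submodule.range_mkQ]
      have h1 := hC.disjoint
      rw [hC', disjoint_top, ← LinearMap.le_ker_iff_map, Submodule.ker_mkQ] at h1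
      exact h1
    · exfalso
      have hS' : S ≤ J := by
        refine h S fun hS => hCt ?_
        rw [eq_top_iff]
        intro x _
        have : S.mkQ x = 0 := by
          rw [Submodule.mkQ_apply, Submodule.Quotient.mk_eq_zero, hS]
          trivial
        rw [Submodule.mem_comap, this]
        exact zero_mem _
      have h1 : C ≤ J.map S.mkQ := by
        rw [← Submodule.map_comap_eq_of_surjective S.mkQ_surjective C]
        exact Submodule.map_mono (h _ hCt)
      have h2 := hC.codisjoint.eq_top
      rw [sup_eq_left.mpr h1] at h2
      refine hJ.1 ?_
      rw [← sup_eq_left.mpr hS', ← Submodule.ker_mkQ S, ← Submodule.comap_map_eq, h2,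
        Submodule.comap_top]

/-- The term just below `⊤` is a maximal submodule, hence equal to `J`. -/
theorem factor_equiv_of_last {J : Submodule A V} (hJ : ∀ S : Submodule A V, S ≠ ⊤ → S ≤ J)
    (s : CompositionSeries (Submodule A V)) {i : Fin s.length} (hi : s i.succ = ⊤) (hJt : J ≠ ⊤) :
    Nonempty (factor s i ≃ₗ[A] V ⧸ J) := by
  have h1 : s i.castSucc ⋖ ⊤ := hi ▸ s.step i
  have h2 : s i.castSucc = J :=
    (h1.eq_or_eq (hJ _ h1.lt.ne) le_top).resolve_right hJt |>.symm
  exact ⟨Submodule.Quotient.equiv _ _ (LinearEquiv.ofTop (s i.succ) hi) (by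
    rw [h2]
    ext x
    simp only [Submodule.mem_map, Submodule.submoduleOf, Submodule.mem_comap]
    constructor
    · rintro ⟨y, hy, rfl⟩
      exact hy
    · intro hx
      exact ⟨⟨x, hi ▸ trivial⟩, hx, rfl⟩)⟩

end Cosocle

/-! ### Quotients of induced modules -/

section Quotient

variable {F : Type u} [Field F] [IsAlgClosed F] {p q : F} {k r n : ℕ} (hn : n = k + r) {a : F}
variable {K M V : Type*} [AddCommGroup K] [Module F K] [Module (HB p q k) K]
  [IsScalarTower F (HB p q k) K] [IsSimpleModule (HB p q k) K]
  [AddCommGroup M] [Module F M] [Module (HB p q n) M] [IsScalarTower F (HB p q n) M]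
  [FiniteDimensional F M]
  [AddCommGroup V] [Module F V] [Module (HB p q n) V] [IsScalarTower F (HB p q n) V]
  {ι : K →ₗ[F] M} (hι : IsLeviInd.{u, w} p q k n a ι)
  (hK : 1 ≤ k → ∀ y : K, gX p q k k • y = a • y → y = 0)
  {π : M →ₗ[HB p q n] V} (hπ : Function.Surjective π)

include hn

omit [IsAlgClosed F] [FiniteDimensional F M] in
-- The preimage of `P` in the simple module `K` is a nonzero submodule, so `P` contains the
-- generating set `f(K)`.
theorem eq_top_of_map_mem {f : K →ₗ[F] M} (hf : IsLeviHom p q k n a f)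
    (hspan : Submodule.span (HB p q n) (Set.range f) = ⊤) {P : Submodule (HB p q n) M} {y : K}
    (hy : y ≠ 0) (hP : f y ∈ P) : P = ⊤ := by
  subst hn
  let R : Submodule (HB p q k) K :=
    { carrier := {y | f y ∈ P}
      add_mem' := fun {x y} hx hy => by
        rw [Set.mem_ofPred_eq, map_add]
        exact add_mem hx hy
      zero_mem' := by simp
      smul_mem' := fun h x hx => by
        rw [Set.mem_ofPred_eq, hf.smul]
        exact P.smul_mem _ hx }
  have hR : R = ⊤ := (eq_bot_or_eq_top R).resolve_left fun h => hy (by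
    have : y ∈ R := hP
    rwa [h, Submodule.mem_bot] at this)
  rw [eq_top_iff, ← hspan, Submodule.span_le]
  rintro _ ⟨x, rfl⟩
  have : x ∈ R := hR ▸ trivial
  exact this

include hι
include hK hπ

omit [Module F V] [IsScalarTower F (HB p q n) V] in
-- A nonzero `Δ` on a quotient of `S` would give a joint eigenvector in the preimage of `S` in `M`.
-- It lies in `ι(K)`, and simplicity of `K` makes that preimage all of `M`.
theorem delta_eq_bot_of_ne_top {S : Submodule (HB p q n) V} (hS : S ≠ ⊤) {Q : Type*}
    [AddCommGroup Q] [Module F Q] [Module (HB p q n) Q] [IsScalarTower F (HB p q n) Q]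
    (σ : S →ₗ[HB p q n] Q) (hσ : Function.Surjective σ) : Delta p q n a r Q = ⊥ := by
  by_contra h
  let ρ : S.comap π →ₗ[HB p q n] S := π.restrict fun x hx => hx
  have hρ : Function.Surjective ρ := by
    rintro ⟨y, hy⟩
    obtain ⟨x, rfl⟩ := hπ y
    exact ⟨⟨x, hy⟩, rfl⟩
  have : FiniteDimensional F (S.comap π) :=
    inferInstanceAs (FiniteDimensional F ((S.comap π).restrictScalars F))
  obtain ⟨x, hx0, hx⟩ := exists_eigenvector_of_delta_ne_bot (σ.comp ρ) (hσ.comp hρ) h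
  obtain ⟨y, hy⟩ := hι.mem_range hK x fun l hl hl' => congrArg Subtype.val (hx l (by omega) hl')
  have h1 := eq_top_of_map_mem hn hι.toIsLeviHom hι.span_range (P := S.comap π) (y := y)
    (fun h0 => hx0 (Subtype.ext (by rw [← hy, h0, map_zero]; rfl))) (hy ▸ x.2)
  refine hS (eq_top_iff.mpr fun v _ => ?_)
  obtain ⟨z, rfl⟩ := hπ v
  have : z ∈ S.comap π := h1 ▸ trivial
  exact this

omit hK [IsAlgClosed F] [IsScalarTower F (HB p q k) K] [IsSimpleModule (HB p q k) K] [FiniteDimensional F M] in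
-- Since `K` generates, some element of `K` survives in the quotient, and it is a joint eigenvector
-- there.
theorem delta_quotient_ne_bot {J : Submodule (HB p q n) V} (hJ : J ≠ ⊤) :
    Delta p q n a r (V ⧸ J) ≠ ⊥ := by
  obtain ⟨y, hy⟩ : ∃ y, π (ι y) ∉ J := by
    by_contra! h
    refine hJ (eq_top_iff.mpr fun v _ => ?_)
    obtain ⟨x, rfl⟩ := hπ v
    have h1 : Submodule.span (HB p q n) (Set.range ι) ≤ J.comap π := by
      rw [Submodule.span_le]
      rintro _ ⟨y, rfl⟩
      exact h y
    rw [hι.span_range] at h1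
    exact h1 trivial
  refine delta_ne_bot_of_eigenvector (x := J.mkQ (π (ι y)))
    (fun h => hy ((Submodule.Quotient.mk_eq_zero J).mp h)) fun l hl hl' => ?_
  exact ((hι.toIsLeviHom.comp_linearMap π).comp_linearMap J.mkQ).eigen l (by omega) hl' y

omit [IsScalarTower F (HB p q k) K] [IsSimpleModule (HB p q k) K] in
theorem epsilon_quotient {J : Submodule (HB p q n) V} (hJ : J ≠ ⊤) :
    epsilon p q n a (V ⧸ J) = r := by
  refine epsilon_eq_of (by omega) (delta_quotient_ne_bot hn hι hπ hJ) fun hr => ?_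
  by_contra h
  -- Passing from `r` to `r + 1` adds `X_k` to the list: the eigenvector comes from `K` and would be
  -- an `a`-eigenvector of `X_k` there.
  obtain ⟨x, hx0, hx⟩ := exists_eigenvector_of_delta_ne_bot (J.mkQ.comp π)
    (J.mkQ_surjective.comp hπ) h
  obtain ⟨y, rfl⟩ := hι.mem_range hK x fun l hl hl' => hx l (by omega) hl'
  have h1 := hx k (by omega) (by omega)
  rw [← hι.X k le_rfl, ← map_smul] at h1
  rw [hK (by omega) y (hι.injective h1), map_zero] at hx0
  exact hx0 rfl

/-- Otherwise `J + S` is everything, and `V/J` is a quotient of the proper submodule `S`, with `Δ`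
both zero and nonzero. -/
theorem le_of_isCoatom {J : Submodule (HB p q n) V} (hJ : IsCoatom J) (S : Submodule (HB p q n) V)
    (hS : S ≠ ⊤) : S ≤ J := by
  by_contra h
  have h1 : J ⊔ S = ⊤ := hJ.2 _ (left_lt_sup.mpr h)
  refine delta_quotient_ne_bot hn hι hπ hJ.1
    (delta_eq_bot_of_ne_top hn hι hK hπ hS (J.mkQ.comp S.subtype) ?_)
  intro z
  obtain ⟨v, rfl⟩ := J.mkQ_surjective z
  obtain ⟨x, hx, y, hy, rfl⟩ := Submodule.mem_sup.mp (h1 ▸ trivial : v ∈ J ⊔ S)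
  refine ⟨⟨y, hy⟩, ?_⟩
  rw [map_add, show J.mkQ x = 0 from (Submodule.Quotient.mk_eq_zero J).mpr hx, zero_add]
  rfl

theorem cosocle_of_isLeviInd_quotient [Nontrivial V] :
    FiniteDimensional F V ∧ IsSimpleModule (HB p q n) (Cosoc (HB p q n) V) ∧
    epsilon p q n a (Cosoc (HB p q n) V) = r ∧
    ∀ s : CompositionSeries (Submodule (HB p q n) V), s.head = ⊥ → s.last = ⊤ →
      ∃ i : Fin s.length, Nonempty (factor s i ≃ₗ[HB p q n] Cosoc (HB p q n) V) ∧
        ∀ j : Fin s.length, j ≠ i → epsilon p q n a (factor s j) < r := by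
  have hfin : FiniteDimensional F V := Module.Finite.of_surjective (π.restrictScalars F) hπ
  have : IsNoetherian (HB p q n) V := isNoetherian_of_tower F inferInstance
  obtain ⟨J, hJ, -⟩ := (eq_top_or_exists_le_coatom (⊥ : Submodule (HB p q n) V)).resolve_left
    bot_ne_top
  have hle := le_of_isCoatom hn hι hK hπ hJ
  have hc := cosocKer_eq_of_forall_le hJ hle
  refine ⟨hfin, ?_, ?_, fun s hs0 hs1 => ?_⟩
  · exact isSimpleModule_iff_isCoatom.mpr (hc ▸ hJ)
  · exact epsilon_quotient hn hι hK hπ (hc ▸ hJ.1)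
  · have hlen : s.length ≠ 0 := fun h => bot_ne_top (α := Submodule (HB p q n) V) (by
      rw [← hs0, ← hs1, RelSeries.head, RelSeries.last]
      congr 1
      apply Fin.ext
      simp [h])
    obtain ⟨i, hi⟩ : ∃ i : Fin s.length, i.succ = Fin.last s.length :=
      ⟨⟨s.length - 1, by omega⟩, Fin.ext (by simp; omega)⟩
    refine ⟨i, ?_, fun j hj => ?_⟩
    · obtain ⟨e⟩ := factor_equiv_of_last hle s (i := i) (by rw [hi]; exact hs1) hJ.1
      exact ⟨e.trans (Submodule.quotEquivOfEq _ _ hc.symm)⟩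
    -- Every factor but the top one is a quotient of a proper submodule.
    · have hjt : s j.succ ≠ ⊤ := by
        rw [← hs1, RelSeries.last, ← hi]
        intro h
        exact hj (Fin.succ_injective _ (s.injective h))
      have hlt := (s.step j).lt
      have : Nontrivial (factor s j) := by
        rw [Submodule.Quotient.nontrivial_iff]
        intro h
        refine hlt.not_ge fun x hx => ?_
        have h1 : (⟨x, hx⟩ : s j.succ) ∈ (s j.castSucc).submoduleOf (s j.succ) := h ▸ trivial
        exact h1
      exact epsilon_lt_of (delta_eq_bot_of_ne_top hn hι hK hπ hjt
        ((s j.castSucc).submoduleOf (s j.succ)).mkQ (Submodule.mkQ_surjective _))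

end Quotient

/-! ### Modules induced along an algebra homomorphism -/

section Ind

variable {F : Type u} [Field F] {A B : Type*} [Ring A] [Algebra F A] [Ring B] [Algebra F B]
  {φ : A →ₐ[F] B} {N : Type*} [AddCommGroup N] [Module F N] [Module A N]

variable (φ N) in
/-- The unit `N → B ⊗_A N`. -/
def indUnit : N →ₗ[F] Ind φ N :=
  ((indRel φ N).mkQ.restrictScalars F).comp (TensorProduct.mk F B N 1)

theorem indRel_mkQ_tmul (b : B) (v : N) :
    (indRel φ N).mkQ (b ⊗ₜ[F] v) = b • indUnit φ N v := by
  change _ = b • (indRel φ N).mkQ (1 ⊗ₜ[F] v)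
  rw [← map_smul, TensorProduct.smul_tmul', smul_eq_mul, mul_one]

theorem indUnit_smul (x : A) (v : N) : indUnit φ N (x • v) = φ x • indUnit φ N v := by
  rw [← indRel_mkQ_tmul]
  symm
  have h : (φ x) ⊗ₜ[F] v - 1 ⊗ₜ[F] (x • v) ∈ indRel φ N :=
    Submodule.subset_span ⟨1, x, v, by rw [one_mul]⟩
  exact (Submodule.Quotient.eq _).mpr h

theorem span_range_indUnit : Submodule.span B (Set.range (indUnit φ N)) = ⊤ := by
  rw [eq_top_iff]
  rintro x -
  obtain ⟨x, rfl⟩ := (indRel φ N).mkQ_surjective x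
  induction x using TensorProduct.induction_on with
  | zero =>
    rw [map_zero]
    exact zero_mem _
  | tmul b y =>
    rw [indRel_mkQ_tmul]
    exact Submodule.smul_mem _ _ (Submodule.subset_span ⟨y, rfl⟩)
  | add x y hx hy =>
    rw [map_add]
    exact add_mem hx hy

theorem exists_ind_lift {V : Type*} [AddCommGroup V] [Module F V] [Module B V]
    [IsScalarTower F B V] (f : N →ₗ[F] V) (hf : ∀ (x : A) v, f (x • v) = φ x • f v) :
    ∃ g : Ind φ N →ₗ[B] V, ∀ v, g (indUnit φ N v) = f v := by
  let g₀ : B ⊗[F] N →ₗ[B] V :=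
    TensorProduct.AlgebraTensorModule.lift
      { toFun := fun b => (Algebra.lsmul F F V b).comp f
        map_add' := fun b b' => by
          ext y
          simp
        map_smul' := fun b b' => by
          ext y
          simp }
  have hg₀ : ∀ b y, g₀ (b ⊗ₜ[F] y) = b • f y := fun b y => rfl
  refine ⟨(indRel φ N).liftQ g₀ ?_, fun y => ?_⟩
  · rw [indRel, Submodule.span_le]
    rintro _ ⟨b, x, v, rfl⟩
    change g₀ _ = 0
    rw [map_sub, hg₀, hg₀, hf, mul_smul, sub_self]
  · exact (hg₀ 1 y).trans (one_smul _ _)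

theorem ind_hom_ext {V : Type*} [AddCommGroup V] [Module B V] {g g' : Ind φ N →ₗ[B] V}
    (h : ∀ v, g (indUnit φ N v) = g' (indUnit φ N v)) : g = g' := by
  refine LinearMap.ext_on span_range_indUnit ?_
  rintro _ ⟨v, rfl⟩
  exact h v

theorem nonempty_ind_equiv {N' : Type*} [AddCommGroup N'] [Module F N'] [Module A N']
    (e : N ≃ₗ[F] N') (he : ∀ (x : A) v, e (x • v) = x • e v) :
    Nonempty (Ind φ N ≃ₗ[B] Ind φ N') := by
  obtain ⟨g, hg⟩ := exists_ind_lift (φ := φ) ((indUnit φ N').comp e.toLinearMap) fun x v => by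
    simp [he, indUnit_smul]
  obtain ⟨g', hg'⟩ := exists_ind_lift (φ := φ) ((indUnit φ N).comp e.symm.toLinearMap) fun x v => by
    have : e.symm (x • v) = x • e.symm v := by rw [LinearEquiv.symm_apply_eq, he]; simp
    simp [this, indUnit_smul]
  exact ⟨LinearEquiv.ofLinearMap g g' (ind_hom_ext fun v => by simp [hg, hg'])
    (ind_hom_ext fun v => by simp [hg, hg'])⟩

end Ind

/-! ### Invariance of the cosocle under isomorphism -/

section Cosocle

variable {A : Type*} [Ring A] {V V' : Type*} [AddCommGroup V] [Module A V] [AddCommGroup V']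
  [Module A V']

theorem map_mem_cosocKer (e : V ≃ₗ[A] V') {x : V} (hx : x ∈ cosocKer A V) :
    e x ∈ cosocKer A V' := by
  rw [cosocKer, Submodule.mem_sInf] at hx ⊢
  intro S (hS : IsSemisimpleModule A (V' ⧸ S))
  refine hx (S.comap e.toLinearMap) ?_
  exact IsSemisimpleModule.congr (Submodule.Quotient.equiv _ S e
    (Submodule.map_comap_eq_of_surjective e.surjective S))

theorem nonempty_cosoc_equiv (e : V ≃ₗ[A] V') : Nonempty (Cosoc A V ≃ₗ[A] Cosoc A V') := by
  refine ⟨Submodule.Quotient.equiv _ _ e ?_⟩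
  ext x
  constructor
  · rintro ⟨y, hy, rfl⟩
    exact map_mem_cosocKer e hy
  · intro hx
    exact ⟨e.symm x, map_mem_cosocKer e.symm hx, by simp⟩

end Cosocle

/-! ### The source of a crystal string -/

section Source

variable {F : Type u} [Field F] {p q : F}

theorem commute_inclB_gX_of_lt {k r l : ℕ} (hl : k < l) (h : HB p q k) :
    Commute (inclB p q k r h) (gX p q (k + r) l) := by
  induction h using HB.induction_on with
  | halg c => simpa using Algebra.commute_algebraMap_left c _
  | hT i hi =>
    rw [inclB_gT hi]
    exact gT_gX_comm (by omega) (by omega)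
  | hX i hi =>
    rw [inclB_gX hi]
    exact gX_comm _ _
  | hY i hi =>
    rw [inclB_gY hi]
    exact (gX_gY_comm _ _).symm
  | hmul x y hx hy =>
    rw [map_mul]
    exact hx.mul_left hy
  | hadd x y hx hy =>
    rw [map_add]
    exact hx.add_left hy

variable [IsAlgClosed F] {a : F}

/-- The joint `a`-eigenspace of `X_{k+1}, …, X_n` is stable under `H_k` and nonzero; `K` is a simple
submodule of it. An `a`-eigenvector of `X_k` in `K` would make `Δ_{a^{(r+1)}} N` nonzero. -/
theorem exists_isLeviHom_of_epsilon {n k r : ℕ} (hn : n = k + r) {N : Type v} [AddCommGroup N]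
    [Module F N] [Module (HB p q n) N] [IsScalarTower F (HB p q n) N] [FiniteDimensional F N]
    [Nontrivial N] (hr : epsilon p q n a N = r) :
    ∃ (K : Type v) (_ : AddCommGroup K) (_ : Module F K) (_ : Module (HB p q k) K)
      (_ : IsScalarTower F (HB p q k) K) (_ : FiniteDimensional F K)
      (_ : IsSimpleModule (HB p q k) K) (κ : K →ₗ[F] N), Function.Injective κ ∧
      IsLeviHom p q k n a κ ∧ (1 ≤ k → ∀ y : K, gX p q k k • y = a • y → y = 0) := by
  subst hn
  let _ : Module (HB p q k) N := Module.compHom N (inclB p q k r).toRingHom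
  have hact : ∀ (h : HB p q k) (v : N), h • v = inclB p q k r h • v := fun _ _ => rfl
  have : IsScalarTower F (HB p q k) N := ⟨fun c h v => by
    rw [hact, hact, map_smul, smul_assoc]⟩
  let E : Submodule (HB p q k) N :=
    { carrier := {x | ∀ l, k < l → l ≤ k + r → gX p q (k + r) l • x = a • x}
      add_mem' := fun {x y} hx hy l hl hl' => by
        rw [smul_add, smul_add, hx l hl hl', hy l hl hl']
      zero_mem' := fun l _ _ => by simp
      smul_mem' := fun h x hx l hl hl' => by
        rw [hact, smul_smul, ← (commute_inclB_gX_of_lt hl h).eq, mul_smul, hx l hl hl', smul_comm] }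
  have hE : E ≠ ⊥ := by
    have h1 := (epsilon_mem (p := p) (q := q) (n := k + r) (a := a) (M := N)).2
    rw [hr] at h1
    obtain ⟨x, hx0, hx⟩ := exists_eigenvector_of_delta_ne_bot LinearMap.id Function.surjective_id h1
    exact (Submodule.ne_bot_iff _).mpr ⟨x, fun l hl hl' => hx l (by omega) hl', hx0⟩
  have : IsArtinian (HB p q k) N := isArtinian_of_tower F inferInstance
  obtain ⟨K, hK, hKE⟩ := (eq_bot_or_exists_atom_le E).resolve_left hE
  have hKs := isSimpleModule_iff_isAtom.mpr hK
  refine ⟨K, inferInstance, inferInstance, inferInstance, inferInstance,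
    inferInstanceAs (FiniteDimensional F (K.restrictScalars F)), hKs,
    K.subtype.restrictScalars F, Subtype.val_injective,
    isLeviHom_of_smul (fun h y => rfl) fun l hl hl' y => hKE y.2 l hl hl', fun hk y hy => ?_⟩
  by_contra hy0
  refine delta_ne_bot_of_eigenvector (m := r + 1) (fun h => hy0 (Subtype.ext h))
    (fun l hl hl' => ?_)
    (delta_eq_bot_of_epsilon_lt (p := p) (q := q) (n := k + r) (a := a) (M := N) (by omega)
      (by omega))
  rcases Nat.lt_or_ge k l with h | h
  · exact hKE y.2 l h hl'
  · obtain rfl : l = k := by omega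
    have h1 := congrArg Subtype.val hy
    change gX p q l l • (y : N) = a • (y : N) at h1
    rwa [hact, inclB_gX le_rfl] at h1

variable (hp : p ≠ 0) (hq : q ≠ 0) (hqk : ∀ k : ℕ, 0 < k → q ^ k ≠ 1) (ha : a ≠ 0) (ha2 : a ^ 2 ≠ 1)

include hp hq hqk ha ha2 in
-- The composite `K → N → V` extends to a map from the module induced from `K`. It is surjective
-- because its image meets the image of the simple generating module `N` in the image of a nonzero
-- vector.
theorem cosocle_of_isLeviHom {n m : ℕ} {N : Type v} [AddCommGroup N]
    [Module F N] [Module (HB p q n) N] [IsScalarTower F (HB p q n) N] [FiniteDimensional F N]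
    [IsSimpleModule (HB p q n) N] {V : Type w} [AddCommGroup V] [Module F V]
    [Module (HB p q (n + m)) V] [IsScalarTower F (HB p q (n + m)) V] [Nontrivial V]
    {f : N →ₗ[F] V} (hf : IsLeviHom p q n (n + m) a f)
    (hspan : Submodule.span (HB p q (n + m)) (Set.range f) = ⊤) :
    FiniteDimensional F V ∧ IsSimpleModule (HB p q (n + m)) (Cosoc (HB p q (n + m)) V) ∧
    epsilon p q (n + m) a (Cosoc (HB p q (n + m)) V) = epsilon p q n a N + m ∧
    ∀ s : CompositionSeries (Submodule (HB p q (n + m)) V), s.head = ⊥ → s.last = ⊤ →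
      ∃ i : Fin s.length, Nonempty (factor s i ≃ₗ[HB p q (n + m)] Cosoc (HB p q (n + m)) V) ∧
        ∀ j : Fin s.length, j ≠ i →
          epsilon p q (n + m) a (factor s j) < epsilon p q n a N + m := by
  have : Nontrivial N := IsSimpleModule.nontrivial (HB p q n) N
  obtain ⟨k, hk⟩ : ∃ k, n = k + epsilon p q n a N :=
    ⟨n - epsilon p q n a N, by have := (epsilon_mem (p := p) (q := q) (n := n) (a := a) (M := N)).1
                               omega⟩
  obtain ⟨K, _, _, _, _, _, _, κ, hκ, hκl, hK⟩ := exists_isLeviHom_of_epsilon hk (a := a) rfl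
  have hex : ∀ L, L = k + (epsilon p q n a N + m) →
      ∃ (M : Type (max u v)) (_ : AddCommGroup M) (_ : Module F M) (_ : Module (HB p q L) M)
        (_ : IsScalarTower F (HB p q L) M) (_ : FiniteDimensional F M) (ι : K →ₗ[F] M),
        IsLeviInd.{u, w} p q k L a ι := by
    rintro _ rfl
    exact exists_isLeviInd hp hq hqk ha ha2 _ _ K
  have hL : n + m = k + (epsilon p q n a N + m) := by omega
  obtain ⟨M, _, _, _, _, _, ι, hι⟩ := hex (n + m) hL
  obtain ⟨π, hπ⟩ := hι.lift V (f.comp κ) (hf.comp hκl (by omega))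
  have : Nontrivial K := IsSimpleModule.nontrivial (HB p q k) K
  obtain ⟨y, hy⟩ := exists_ne (0 : K)
  have hπs : Function.Surjective π := by
    rw [← LinearMap.range_eq_top]
    refine eq_top_of_map_mem rfl hf hspan (y := κ y) (fun h => hy (hκ (by rw [h, map_zero]))) ?_
    exact ⟨ι y, hπ y⟩
  exact cosocle_of_isLeviInd_quotient hL hι hK hπs

end Source

/-! ### Parabolic induction of outer tensor products -/

section Outer

variable {F : Type u} [Field F] {N L : Type*} [AddCommGroup N] [Module F N] [AddCommGroup L]
  [Module F L]

variable (F N L) in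
/-- The pure tensors in `N ⊠ L`. -/
def outerMk : N →ₗ[F] L →ₗ[F] Outer F N L := TensorProduct.mk F N L

theorem outer_induction {P : Outer F N L → Prop} (h0 : P 0) (hadd : ∀ x y, P x → P y → P (x + y))
    (hmk : ∀ v l, P (outerMk F N L v l)) (x : Outer F N L) : P x :=
  TensorProduct.induction_on (motive := P) x h0 hmk hadd

theorem exists_outer_lift {W : Type*} [AddCommGroup W] [Module F W] (f : N →ₗ[F] L →ₗ[F] W) :
    ∃ g : Outer F N L →ₗ[F] W, ∀ v l, g (outerMk F N L v l) = f v l :=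
  ⟨TensorProduct.lift f, fun _ _ => rfl⟩

theorem tmul_smul_outerMk {A B : Type*} [Ring A] [Algebra F A] [Ring B] [Algebra F B] [Module A N]
    [IsScalarTower F A N] [Module B L] [IsScalarTower F B L] (x : A) (y : B) (v : N) (l : L) :
    (x ⊗ₜ[F] y : A ⊗[F] B) • outerMk F N L v l = outerMk F N L (x • v) (y • l) := rfl

theorem exists_outer_congr {A B : Type*} [Ring A] [Algebra F A] [Ring B] [Algebra F B] [Module A N]
    [IsScalarTower F A N] [Module B L] [IsScalarTower F B L] {N' : Type*} [AddCommGroup N']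
    [Module F N'] [Module A N'] [IsScalarTower F A N'] (e : N ≃ₗ[A] N') :
    ∃ e' : Outer F N L ≃ₗ[F] Outer F N' L, ∀ (x : A ⊗[F] B) v, e' (x • v) = x • e' v := by
  let e' : Outer F N L ≃ₗ[F] Outer F N' L :=
    TensorProduct.congr (e.restrictScalars F) (LinearEquiv.refl F L)
  have he' : ∀ v l, e' (outerMk F N L v l) = outerMk F N' L (e v) l := fun _ _ => rfl
  refine ⟨e', fun x v => ?_⟩
  induction v using outer_induction with
  | h0 => simp
  | hadd v v' hv hv' => rw [smul_add, map_add, hv, hv', map_add, smul_add]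
  | hmk v l =>
    induction x using TensorProduct.induction_on with
    | zero => rw [zero_smul, zero_smul, map_zero]
    | add x x' hx hx' => rw [add_smul, map_add, hx, hx', add_smul]
    | tmul x y => rw [tmul_smul_outerMk, he', he', tmul_smul_outerMk, e.map_smul]

end Outer

/-! ### Parabolic induction from a cyclic type `A` module -/

section ParabolicInduction

variable {F : Type u} [Field F] {p q : F} {n m : ℕ}

theorem parabolic_tmul (x : HB p q n) (y : HA q m) :
    parabolic p q n m (x ⊗ₜ[F] y) = inclB p q n m x * inclA p q n m y := by
  simp [parabolic]

theorem inclA_XA (j : Fin m) :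
    inclA p q n m (XA q j).val = gX p q (n + m) (n + j + 1) := by
  have h : n + j.val + 1 < n + m + 1 := by omega
  exact (inclA_X p q n m j).trans (gX_fin ⟨_, h⟩).symm

variable {a : F} {N L : Type*} [AddCommGroup N] [Module F N] [Module (HB p q n) N]
  [IsScalarTower F (HB p q n) N] [AddCommGroup L] [Module F L] [Module (HA q m) L]
  [IsScalarTower F (HA q m) L] {l₀ : L}

variable (p q n m N) in
/-- The map `v ↦ 1 ⊗ (v ⊠ l₀)` to the induced module. -/
def parabolicUnit (l₀ : L) : N →ₗ[F] Ind (parabolic p q n m) (Outer F N L) :=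
  (indUnit (parabolic p q n m) (Outer F N L)).comp ((outerMk F N L).flip l₀)

theorem isLeviHom_parabolicUnit (h₀ : ∀ j : Fin m, (XA q j).val • l₀ = a • l₀) :
    IsLeviHom p q n (n + m) a (parabolicUnit p q n m N l₀) := by
  refine isLeviHom_of_smul (fun h y => ?_) fun l hl hl' y => ?_
  · change indUnit _ _ (outerMk F N L (h • y) l₀) = _ • indUnit _ _ (outerMk F N L y l₀)
    have h1 := tmul_smul_outerMk (F := F) h (1 : HA q m) y l₀
    rw [one_smul] at h1
    rw [← h1, indUnit_smul, parabolic_tmul, map_one, mul_one]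
  · obtain ⟨j, rfl⟩ : ∃ j : Fin m, l = n + j + 1 := ⟨⟨l - n - 1, by omega⟩, by simp; omega⟩
    change _ • indUnit _ _ (outerMk F N L y l₀) = a • indUnit _ _ (outerMk F N L y l₀)
    have h1 := tmul_smul_outerMk (F := F) (1 : HB p q n) (XA q j).val y l₀
    rw [one_smul, h₀, map_smul] at h1
    rw [← LinearMap.map_smul, ← h1, indUnit_smul, parabolic_tmul, map_one, one_mul, inclA_XA]

theorem span_range_parabolicUnit (hL : Submodule.span (HA q m) {l₀} = ⊤) :
    Submodule.span (HB p q (n + m)) (Set.range (parabolicUnit p q n m N l₀)) = ⊤ := by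
  rw [eq_top_iff, ← span_range_indUnit, Submodule.span_le]
  rintro _ ⟨x, rfl⟩
  induction x using outer_induction with
  | h0 => simp
  | hadd x y hx hy =>
    rw [map_add]
    exact add_mem hx hy
  | hmk v l =>
    have hl : l ∈ Submodule.span (HA q m) {l₀} := hL ▸ trivial
    obtain ⟨y, rfl⟩ := Submodule.mem_span_singleton.mp hl
    have h1 := tmul_smul_outerMk (F := F) (1 : HB p q n) y v l₀
    rw [one_smul] at h1
    rw [← h1, indUnit_smul]
    exact Submodule.smul_mem _ _ (Submodule.subset_span ⟨v, rfl⟩)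

theorem exists_parabolic_lift (hL : Submodule.span (HA q m) {l₀} = ⊤) {W : Type*}
    [AddCommGroup W] [Module F W] [Module (HB p q (n + m)) W] [IsScalarTower F (HB p q (n + m)) W]
    {f : N →ₗ[F] W} (hf : IsLeviHom p q n (n + m) a f) {G : L →ₗ[F] N →ₗ[F] W} (hG₀ : G l₀ = f)
    (hG : ∀ (y : HA q m) l v, G (y • l) v = inclA p q n m y • G l v) :
    ∃ g : Ind (parabolic p q n m) (Outer F N L) →ₗ[HB p q (n + m)] W,
      ∀ v, g (parabolicUnit p q n m N l₀ v) = f v := by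
  obtain ⟨T, hT⟩ := exists_outer_lift G.flip
  -- As `l₀` generates `L` and the two subalgebras commute, linearity over `H_n` need only be known
  -- at `l₀`.
  have hGB : ∀ (x : HB p q n) l v, G l (x • v) = inclB p q n m x • G l v := by
    intro x l v
    have hl : l ∈ Submodule.span (HA q m) {l₀} := hL ▸ trivial
    obtain ⟨y, rfl⟩ := Submodule.mem_span_singleton.mp hl
    rw [hG, hG, hG₀, hf.smul, smul_smul, smul_smul, (commute_inclB_inclA p q n m x y).eq]
  obtain ⟨g, hg⟩ := exists_ind_lift (φ := parabolic p q n m) T fun x v => by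
    induction v using outer_induction with
    | h0 => simp
    | hadd v v' hv hv' => rw [smul_add, map_add, hv, hv', map_add, smul_add]
    | hmk v l =>
      induction x using TensorProduct.induction_on with
      | zero => rw [zero_smul, map_zero, map_zero, zero_smul]
      | add x x' hx hx' => rw [add_smul, map_add, hx, hx', map_add, add_smul]
      | tmul x y =>
        rw [tmul_smul_outerMk, hT, hT, LinearMap.flip_apply, LinearMap.flip_apply, hG, hGB,
          parabolic_tmul, (commute_inclB_inclA p q n m x y).eq, mul_smul]
  refine ⟨g, fun v => (hg _).trans ?_⟩
  rw [LinearMap.flip_apply, hT, LinearMap.flip_apply, hG₀]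

end ParabolicInduction

/-! ### The modules `L^A(a^{(m)})` and `(a)` -/

section Laurent

variable {F : Type u} [Field F] {m : ℕ}

theorem laurentLift_of_mulSingle {B : Type*} [Ring B] [Algebra F B] (x : Fin m → Bˣ)
    (hx : ∀ i j, Commute (x i) (x j)) (j : Fin m) (z : Multiplicative ℤ) :
    laurentLift (F := F) x hx (MonoidAlgebra.of F _ (Pi.mulSingle j z)) =
      ((x j ^ z.toAdd : Bˣ) : B) := by
  simp [laurentLift]

variable {q : F} (a : Fˣ)

variable (m q) in
/-- The generator of `L^A(a^{(m)})`. -/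
def laGen : LA q a m := indUnit _ _ (show OneDim _ from (1 : F))

theorem span_laGen : Submodule.span (HA q m) {laGen m q a} = ⊤ := by
  rw [eq_top_iff, ← span_range_indUnit, Submodule.span_le]
  rintro _ ⟨c, rfl⟩
  have : indUnit (laurentLift (F := F) (B := HA q m) (XA q) (XA_comm q))
      (OneDim (laurentLift (F := F) (fun _ : Fin m => a) (fun _ _ => Commute.refl a))) c =
      (show F from c) • laGen m q a := by
    rw [laGen, ← map_smul]
    congr 1
    exact (mul_one (show F from c)).symm
  rw [this, ← algebraMap_smul (HA q m)]
  exact Submodule.smul_mem _ _ (Submodule.mem_span_singleton_self _)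

theorem XA_smul_laGen (j : Fin m) : (XA q j).val • laGen m q a = (a : F) • laGen m q a := by
  have h1 := indUnit_smul (φ := laurentLift (F := F) (B := HA q m) (XA q) (XA_comm q))
    (N := OneDim (laurentLift (F := F) (fun _ : Fin m => a) (fun _ _ => Commute.refl a)))
    (MonoidAlgebra.of F _ (Pi.mulSingle j (Multiplicative.ofAdd 1))) (1 : F)
  rw [laurentLift_of_mulSingle, toAdd_ofAdd, zpow_one] at h1
  rw [laGen, ← h1, ← map_smul]
  congr 1
  change laurentLift (F := F) (fun _ : Fin m => a) (fun _ _ => Commute.refl a) _ * (1 : F) =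
    (a : F) * 1
  rw [laurentLift_of_mulSingle, toAdd_ofAdd, zpow_one]

theorem zpow_smul_of_smul {B : Type*} [Ring B] [Algebra F B] {V : Type*} [AddCommGroup V]
    [Module F V] [Module B V] [IsScalarTower F B V] {x : Bˣ} {v : V}
    (h : (x : B) • v = (a : F) • v) (z : ℤ) :
    ((x ^ z : Bˣ) : B) • v = ((a ^ z : Fˣ) : F) • v := by
  have h' : ((x⁻¹ : Bˣ) : B) • v = ((a⁻¹ : Fˣ) : F) • v := by
    have h1 : ((x⁻¹ : Bˣ) : B) • (x : B) • v = v := by rw [smul_smul, Units.inv_mul, one_smul]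
    rw [h, smul_comm] at h1
    nth_rewrite 2 [← h1]
    rw [smul_smul, Units.inv_mul, one_smul]
  induction z with
  | zero => simp
  | succ i ih =>
    rw [zpow_add_one, zpow_add_one, Units.val_mul, mul_smul, h, smul_comm, ih, smul_smul,
      Units.val_mul, mul_comm]
  | pred i ih =>
    rw [zpow_sub_one, zpow_sub_one, Units.val_mul, mul_smul, h', smul_comm, ih, smul_smul,
      Units.val_mul, mul_comm]

theorem laurentLift_smul_eq {B : Type*} [Ring B] [Algebra F B] (x : Fin m → Bˣ)
    (hx : ∀ i j, Commute (x i) (x j)) {V : Type*} [AddCommGroup V] [Module F V] [Module B V]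
    [IsScalarTower F B V] {v : V} (hv : ∀ j, (x j : B) • v = (a : F) • v) (y : Laurent F m) :
    laurentLift (F := F) x hx y • v =
      laurentLift (F := F) (fun _ : Fin m => a) (fun _ _ => Commute.refl a) y • v := by
  induction y using MonoidAlgebra.induction_on with
  | of g =>
    -- The monomials acting on `v` by the character form a submonoid containing all powers of each
    -- variable.
    let H : Submonoid (Fin m → Multiplicative ℤ) :=
      { carrier := {g | laurentLift (F := F) x hx (MonoidAlgebra.of F _ g) • v =
          laurentLift (F := F) (fun _ : Fin m => a) (fun _ _ => Commute.refl a)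
            (MonoidAlgebra.of F _ g) • v}
        mul_mem' := fun {g g'} hg hg' => by
          rw [Set.mem_ofPred_eq] at hg hg' ⊢
          rw [map_mul, map_mul, map_mul, mul_smul, hg', smul_comm, hg, smul_smul, mul_comm]
        one_mem' := by
          rw [Set.mem_ofPred_eq, map_one, map_one, map_one, one_smul, one_smul] }
    exact Submonoid.pi_mem_of_mulSingle_mem (H := H) g fun j => by
      change _ • v = _ • v
      rw [laurentLift_of_mulSingle, laurentLift_of_mulSingle]
      exact zpow_smul_of_smul a (hv j) _
  | add y y' hy hy' => rw [map_add, map_add, add_smul, add_smul, hy, hy']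
  | smul c y hy => rw [map_smul, map_smul, smul_assoc, smul_assoc, hy]

theorem exists_la_lift {V : Type*} [AddCommGroup V] [Module F V] [Module (HA q m) V]
    [IsScalarTower F (HA q m) V] {v : V} (hv : ∀ j : Fin m, (XA q j).val • v = (a : F) • v) :
    ∃ g : LA q a m →ₗ[HA q m] V, g (laGen m q a) = v := by
  obtain ⟨g, hg⟩ := exists_ind_lift
    (φ := laurentLift (F := F) (B := HA q m) (XA q) (XA_comm q))
    (N := OneDim (laurentLift (F := F) (fun _ : Fin m => a) (fun _ _ => Commute.refl a)))
    (LinearMap.toSpanSingleton F V v) fun y c => by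
      change (laurentLift (F := F) (fun _ : Fin m => a) (fun _ _ => Commute.refl a) y * (show F from c)) • v =
        _ • (show F from c) • v
      rw [smul_comm _ (show F from c), laurentLift_smul_eq a _ _ hv, smul_smul, mul_comm]
  exact ⟨g, (hg _).trans (one_smul F v)⟩

theorem charA_XA (j : Fin 1) : charA q a (XA q j).val = a := by
  change charA q a (mkA q 1 (aX j)) = a
  simp only [charA, mkA]
  erw [RingQuot.liftAlgHom_mkAlgHom_apply]
  simp

theorem charA_smul_eq {V : Type*} [AddCommGroup V] [Module F V] [Module (HA q 1) V]
    [IsScalarTower F (HA q 1) V] {v : V} (hv : ∀ j : Fin 1, (XA q j).val • v = (a : F) • v)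
    (y : HA q 1) : y • v = charA q a y • v := by
  obtain ⟨y, rfl⟩ : ∃ y', mkA q 1 y' = y := RingQuot.mkAlgHom_surjective F _ y
  induction y using FreeAlgebra.induction with
  | grade0 c => simp
  | grade1 g =>
    cases g with
    | T i h => omega
    | X j => exact (hv j).trans (by rw [← charA_XA (q := q) a j]; rfl)
    | Xinv j =>
      have h1 := zpow_smul_of_smul a (hv j) (-1)
      have h2 : charA q a ((XA q j)⁻¹ : (HA q 1)ˣ).val = ((a⁻¹ : Fˣ) : F) := by
        have h3 : Units.map (charA q a : HA q 1 →* F) (XA q j) = a := Units.ext (charA_XA a j)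
        have h4 := congrArg Units.val (map_inv (Units.map (charA q a : HA q 1 →* F)) (XA q j))
        rwa [h3] at h4
      rw [zpow_neg_one, zpow_neg_one, ← h2] at h1
      exact h1
  | mul x y hx hy => rw [map_mul, map_mul, mul_smul, hy, smul_comm, hx, smul_smul, mul_comm]
  | add x y hx hy => rw [map_add, map_add, add_smul, add_smul, hx, hy]

end Laurent

/-! ### Nonvanishing of the induced module -/

section

variable {F : Type u} [Field F] {p q : F} {a : F} (hp : p ≠ 0) (hq : q ≠ 0)
  (hqk : ∀ k : ℕ, 0 < k → q ^ k ≠ 1) (ha : a ≠ 0) (ha2 : a ^ 2 ≠ 1)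

include hp hq hqk ha ha2 in
-- The module is compared with the iterated one-step induction `W` of `N`, into which `N` embeds.
-- The universal property of `L` provides a homomorphism to `W` extending this embedding.
theorem nontrivial_parabolicInduction {n m : ℕ} {N : Type v} [AddCommGroup N] [Module F N]
    [Module (HB p q n) N] [IsScalarTower F (HB p q n) N] [FiniteDimensional F N] [Nontrivial N]
    {L : Type*} [AddCommGroup L] [Module F L] [Module (HA q m) L] [IsScalarTower F (HA q m) L]
    {l₀ : L} (hL : Submodule.span (HA q m) {l₀} = ⊤)
    (hlift : ∀ (V : Type (max u v)) [AddCommGroup V] [Module F V] [Module (HA q m) V]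
      [IsScalarTower F (HA q m) V] (v : V), (∀ j : Fin m, (XA q j).val • v = a • v) →
      ∃ g : L →ₗ[HA q m] V, g l₀ = v) :
    Nontrivial (Ind (parabolic p q n m) (Outer F N L)) := by
  obtain ⟨W, _, _, _, _, _, f, hf⟩ := exists_isLeviInd.{u, v, v} hp hq hqk ha ha2 n m N
  let _ : Module (HA q m) W := Module.compHom W (inclA p q n m).toRingHom
  have hact : ∀ (y : HA q m) (w : W), y • w = inclA p q n m y • w := fun _ _ => rfl
  have : IsScalarTower F (HA q m) W := ⟨fun c y w => by
    rw [hact, hact, map_smul, smul_assoc]⟩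
  -- `H_m^A` acts on `Hom(N, W)` through `W`, and there `f` is a joint `a`-eigenvector of the `X_j`.
  obtain ⟨G, hG⟩ := hlift (N →ₗ[F] W) f fun j => by
    ext v
    rw [LinearMap.smul_apply, LinearMap.smul_apply, hact, inclA_XA]
    exact hf.eigen _ (by omega) (by omega) v
  obtain ⟨g, hg⟩ := exists_parabolic_lift hL hf.toIsLeviHom (G := G.restrictScalars F) hG
    fun y l v => by
      change G (y • l) v = _
      rw [map_smul]
      rfl
  obtain ⟨v, hv⟩ := exists_ne (0 : N)
  refine ⟨parabolicUnit p q n m N l₀ v, 0, fun h => hv (hf.injective ?_)⟩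
  rw [← hg, h, map_zero, map_zero]

end

end AffineHecke

end

theorem mainTheorem5 {F : Type u} [Field F] [IsAlgClosed F] (hchar : ringChar F ≠ 2)
    (p q : F) (hp0 : p ≠ 0) (hq0 : q ≠ 0)
    (hp : ∀ k : ℕ, 0 < k → p ^ k ≠ 1) (hq : ∀ k : ℕ, 0 < k → q ^ k ≠ 1)
    (a : Fˣ) (ha : (a : F) ≠ 1) (ha' : (a : F) ≠ -1)
    (n : ℕ) (N : Type v) [AddCommGroup N] [Module F N] [Module (HB p q n) N]
    [IsScalarTower F (HB p q n) N] [FiniteDimensional F N] [IsSimpleModule (HB p q n) N] :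
    (∀ m : ℕ,
      FiniteDimensional F (IndLA p q n a m N) ∧
      IsSimpleModule (HB p q (n + m)) (Cosoc (HB p q (n + m)) (IndLA p q n a m N)) ∧
      epsilon p q (n + m) (a : F) (Cosoc (HB p q (n + m)) (IndLA p q n a m N)) =
        epsilon p q n (a : F) N + m ∧
      ∀ s : CompositionSeries (Submodule (HB p q (n + m)) (IndLA p q n a m N)),
        s.head = ⊥ → s.last = ⊤ →
        ∃ i : Fin s.length,
          Nonempty (factor s i ≃ₗ[HB p q (n + m)]
            Cosoc (HB p q (n + m)) (IndLA p q n a m N)) ∧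
          ∀ j : Fin s.length, j ≠ i →
            epsilon p q (n + m) (a : F) (factor s j) < epsilon p q n (a : F) N + m) ∧
    IsSimpleModule (HB p q (n + 1)) (fTilde p q n a N) ∧
    ∀ (N' : Type w) [AddCommGroup N'] [Module F N'] [Module (HB p q n) N']
      [IsScalarTower F (HB p q n) N'],
      Nonempty (N ≃ₗ[HB p q n] N') →
        Nonempty (fTilde p q n a N ≃ₗ[HB p q (n + 1)] fTilde p q n a N') := by
  have hq2 : (a : F) ^ 2 ≠ 1 := fun h => by
    rcases mul_eq_zero.mp (show ((a : F) - 1) * (a + 1) = 0 by linear_combination h) with h | h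
    · exact ha (sub_eq_zero.mp h)
    · exact ha' (eq_neg_of_add_eq_zero_left h)
  have hN : Nontrivial N := IsSimpleModule.nontrivial (HB p q n) N
  -- The module `(a)` is treated like `L^A(a^{(1)})`: it is cyclic on an `a`-eigenvector of `X_1`
  -- and universal with this property.
  have hone : Submodule.span (HA q 1) {(show OneDim (charA q a) from (1 : F))} = ⊤ := by
    rw [eq_top_iff]
    intro c _
    have : c = (show F from c) • (show OneDim (charA q a) from (1 : F)) :=
      (mul_one (show F from c)).symm
    rw [this, ← algebraMap_smul (HA q 1)]
    exact Submodule.smul_mem _ _ (Submodule.mem_span_singleton_self _)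
  refine ⟨fun m => ?_, ?_, fun N' _ _ _ _ ⟨e⟩ => ?_⟩
  · have := nontrivial_parabolicInduction (n := n) (m := m) (N := N) hp0 hq0 hq a.ne_zero hq2
      (span_laGen a)
      fun V _ _ _ _ v hv => exists_la_lift a hv
    exact cosocle_of_isLeviHom hp0 hq0 hq a.ne_zero hq2
      (isLeviHom_parabolicUnit (XA_smul_laGen a)) (span_range_parabolicUnit (span_laGen a))
  · have := nontrivial_parabolicInduction (n := n) (N := N) hp0 hq0 hq a.ne_zero hq2 hone
      fun V _ _ _ _ v hv => ⟨{ LinearMap.toSpanSingleton F V v with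
        map_smul' := fun y c => by
          change (charA q a y * (show F from c)) • v = y • (show F from c) • v
          rw [smul_comm y, charA_smul_eq a hv, smul_smul, mul_comm] }, one_smul F v⟩
    exact (cosocle_of_isLeviHom hp0 hq0 hq a.ne_zero hq2
      (isLeviHom_parabolicUnit fun j => by
        change charA q a _ * (1 : F) = a * 1
        rw [charA_XA]) (span_range_parabolicUnit hone)).2.1
  · obtain ⟨e', he'⟩ := exists_outer_congr (F := F) (B := HA q 1) (L := OneDim (charA q a)) e
    obtain ⟨e''⟩ := nonempty_ind_equiv (φ := parabolic p q n 1) e' he'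
    exact nonempty_cosoc_equiv e''
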